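/- **Definitions.** For $\mu\ge 0$, $\mathrm{SM}_\mu$ is the set of measures $\mathcal G$ on $(0,\infty)$ with $\operatorname{supp}\mathcal G\subset[\mu,\infty)$ and $\int (1+t)^{-1}\mathcal G(dt)<\infty$; the Stieltjes transform of $\mathcal G$ is $ST(\mathcal G)(z)=\int (z+t)^{-1}\mathcal G(dt)$. $\mathrm{SLM}_\mu$ is the set of measures $\mathcal G$ on $[\mu,\infty)$ without atom at $0$ such that $(a_2t^2+a_1t)^{-1}\mathcal G(dt)\in \mathrm{SM}_\mu$ for some $a_1,a_2\ge0$, $a_1+a_2>0$. The characteristic exponent $\psi$ of a real Lévy process $X$ is given by $E[e^{i\xi X_t}]=e^{-t\psi(\xi)}$, so that $$\psi(\xi)=\tfrac{\sigma^2}{2}\xi^2-ib\xi+\int_{\mathbb R\setminus 0}\bigl(1-e^{ix\xi}+\mathbf 1_{(-1,1)}(x)\,ix\xi\bigr)F(dx),$$ and $\psi_J$ denotes the integral term (the characteristic exponent of the pure jump component). For $\mu_-\le 0\le\mu_+$, $X$ is an SL-process of class $SL_{\mu_-,\mu_+}$ if $F(dx)=f(x)dx$ with $f(x)=\int e^{-tx}\mathcal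 G_+(dt)$ for $x>0$ and $f(x)=\int e^{tx}\mathcal G_-(dt)$ for $x<0$, where $\mathcal G_+\in \mathrm{SLM}_{-\mu_-}$, $\mathcal G_-\in \mathrm{SLM}_{\mu_+}$; $\sigma^2\ge 0$ and $b\in\mathbb R$ are arbitrary. $Z\in SL^+_\mu$ means that $Z$ is a Lévy process without Gaussian component and without negative jumps, with Lévy density $\int e^{-tx}\mathcal G(dt)$, $x>0$, where $\mathcal G\in \mathrm{SLM}_\mu$ (a drift is allowed). The Laplace exponent $\Psi$ of a subordinator $Z$ is given by $E[e^{-qZ_t}]=e^{-t\Psi(q)}$, $q\ge0$. The Stieltjes measure of a complete Bernstein function $g$ is the measure $\mathcal G^0\in \mathrm{SM}_0$ in the representation $g(z)=a_0+a_1z+z\,ST(\mathcal G^0)(z)$, $z\in\mathbb C\setminus(-\infty,0]$, with $a_0,a_1\ge 0$. $\sqrt{\cdot}$ is the standard branch of the square root. For $\beta\in\mathbb R$, the Esscher transform $\mathbb Q_\beta$ is given on $[0,T]$ by $d\mathbb Q_\beta/d\mathbb P=e^{\beta X_T}/E[e^{\beta X_T}]$. **Theorem.** Let $\mu_-\le 0\le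 \mu_+$, $\mu_-<\mu_+$, $X\in SL_{\mu_-,\mu_+}$, and denote by $\psi$ and $\psi_J$ also the analytic continuations of $\psi,\psi_J$ from the real line to $D=\mathbb C\setminus i((-\infty,\mu_-]\cup[\mu_+,\infty))$ (these continuations exist). Let $\beta=-(\mu_-+\mu_+)/2$, and assume that $$\psi(\xi-i\beta)=\psi(-\xi-i\beta)\quad\text{for all }\xi\text{ with }\xi-i\beta\in D,\qquad \lim_{A\to+\infty}\int_{|\xi|=A,\ \xi\notin i\mathbb R}\frac{|\psi_J(\xi)|}{|\xi|^3}\,|d\xi|=0.$$ Then the Esscher transform $\mathbb Q_\beta$ is well defined (i.e. $E[e^{\beta X_T}]<\infty$ for all $T\ge 0$), under $\mathbb Q_\beta$ the process $X$ has the even characteristic exponent $\psi(\xi-i\beta)-\psi(-i\beta)$, and: (a) the function $\Psi_Z(q)=\psi(\sqrt q-i\beta)-\psi(-i\beta)$ is the Laplace exponent of a subordinator $Z$; (b) $Z\in SL^+_\mu$ with $\mu=(\mu_+-\mu_-)^2/4$; (c) $\Psi_Z$ is a complete Bernstein function (that is, it has a representation as above), and its Stieltjes measure $\mathcal G^0_Z$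 satisfies $$\mathcal G^0_Z((u,v])=\frac1\pi\lim_{\epsilon\to0+}\int_{(u,v]}\frac{\operatorname{Im}\psi(i(\sqrt q-\beta)+\epsilon)}{q}\,dq$$ for all $v>u>\beta^2$ such that $\sqrt u-\beta$ and $\sqrt v-\beta$ are points of continuity of $t\mapsto\mathcal G_-((-\infty,t])$; (d) under $\mathbb Q_\beta$, $X_t=Y_{Z_t}$ in law, where $Y=\sqrt 2\,W$: if $Z$ is a subordinator with the Laplace exponent $\Psi_Z$ and $W$ is a standard Wiener process independent of $Z$ (on some probability space), then for every $T$ the process $(\sqrt2\,W_{Z_t})_{0\le t\le T}$ has the same finite-dimensional distributions as $(X_t)_{0\le t\le T}$ under $\mathbb Q_\beta$. -/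

import Mathlib

open MeasureTheory ProbabilityTheory Set Filter Topology
open scoped NNReal ENNReal

noncomputable section

namespace StieltjesLevy

/-! ### Stieltjes measures and Stieltjes-Lévy measures -/

/-- `G` is a Stieltjes measure of class `SM_μ` (`μ ≥ 0`): a measure on `(0, ∞)` with support in
`[μ, ∞)` and `∫ (1 + t)⁻¹ G(dt) < ∞`. -/
structure IsSM (μ : ℝ) (G : Measure ℝ) : Prop where
  pos : G (Iic 0) = 0
  supp : G (Iio μ) = 0
  finite : ∫⁻ t, ENNReal.ofReal ((1 + t)⁻¹) ∂G < ∞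

/-- `G` is a Stieltjes-Lévy measure of class `SLM_μ` (`μ ≥ 0`): a measure on `[μ, ∞)`, without atom
at `0`, such that `(a₂ t² + a₁ t)⁻¹ G(dt)` is of class `SM_μ` for some `a₂, a₁ ≥ 0`,
`a₂ + a₁ > 0`. -/
structure IsSLM (μ : ℝ) (G : Measure ℝ) : Prop where
  pos : G (Iic 0) = 0
  supp : G (Iio μ) = 0
  sm : ∃ a₂ a₁ : ℝ, 0 ≤ a₂ ∧ 0 ≤ a₁ ∧ 0 < a₂ + a₁ ∧
    IsSM μ (G.withDensity fun t => ENNReal.ofReal ((a₂ * t ^ 2 + a₁ * t)⁻¹))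

/-- The Stieltjes transform `z ↦ ∫ (z + t)⁻¹ G(dt)`. -/
def stieltjesTransform (G : Measure ℝ) (z : ℂ) : ℂ := ∫ t : ℝ, (z + t)⁻¹ ∂G

/-- `G` is the Stieltjes measure of the complete Bernstein function `g`:
`g(z) = a₀ + a₁ z + z ST(G)(z)` off `(-∞, 0]`, with `a₀, a₁ ≥ 0` and a Stieltjes measure `G`. -/
def IsStieltjesMeasureOf (g : ℂ → ℂ) (G : Measure ℝ) : Prop :=
  IsSM 0 G ∧ ∃ a₀ a₁ : ℝ, 0 ≤ a₀ ∧ 0 ≤ a₁ ∧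
    ∀ z ∈ Complex.slitPlane, g z = a₀ + a₁ * z + z * stieltjesTransform G z

/-! ### Lévy densities and characteristic exponents -/

/-- The density `∫ e^{-tx} G₊(dt)` at `x > 0` and `∫ e^{tx} G₋(dt)` at `x < 0`. -/
def slDensity (Gm Gp : Measure ℝ) (x : ℝ) : ℝ≥0∞ :=
  if 0 < x then ∫⁻ t, ENNReal.ofReal (Real.exp (-(t * x))) ∂Gp
  else if x < 0 then ∫⁻ t, ENNReal.ofReal (Real.exp (t * x)) ∂Gm
  else 0

/-- The measure on `ℝ ∖ {0}` with the density `slDensity Gm Gp`. -/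
def slLevyMeasure (Gm Gp : Measure ℝ) : Measure ℝ := volume.withDensity (slDensity Gm Gp)

open Classical in
/-- The Lévy-Khintchine exponent
`(σ²/2) ξ² - i b ξ + ∫ (1 - e^{ixξ} + 1_{(-1,1)}(x) i x ξ) F(dx)` for real `ξ`. -/
def lkExponent (σ2 b : ℝ) (F : Measure ℝ) (ξ : ℝ) : ℂ :=
  (σ2 / 2 : ℝ) * (ξ : ℂ) ^ 2 - Complex.I * b * ξ
    + ∫ x : ℝ, (1 - Complex.exp (Complex.I * x * ξ)
        + (if x ∈ Ioo (-1 : ℝ) 1 then Complex.I * x * ξ else 0)) ∂F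

/-- `ℂ ∖ i((-∞, μ₋] ∪ [μ₊, ∞))`. -/
def cutPlane (μm μp : ℝ) : Set ℂ := {ξ | ξ.re ≠ 0 ∨ (μm < ξ.im ∧ ξ.im < μp)}

open Classical in
/-- The analytic continuation to `D` of a function `f` given on the real line: an analytic function
on `D` that agrees with `f` at the real points of `D`. On the domains `cutPlane μm μp`, `μm < μp`,
its values on `D` are unique. If there is no continuation, the value is the junk value `0`; outside
`D` the values are irrelevant. -/
def analyticContinuation (D : Set ℂ) (f : ℝ → ℂ) : ℂ → ℂ :=
  if h : ∃ g : ℂ → ℂ, DifferentiableOn ℂ g D ∧ ∀ x : ℝ, (x : ℂ) ∈ D → g x = f x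
  then h.choose else 0

/-- The analytic continuation of the characteristic exponent with generating triplet
`(σ², b, F)` to `ℂ ∖ i((-∞, μ₋] ∪ [μ₊, ∞))`. -/
def charExponent (μm μp σ2 b : ℝ) (F : Measure ℝ) : ℂ → ℂ :=
  analyticContinuation (cutPlane μm μp) (lkExponent σ2 b F)

/-! ### Lévy processes -/

/-- Real-valued Lévy processes indexed by `[0, ∞)`: started at `0`, with independent stationary
increments and almost surely càdlàg paths (hence stochastically continuous). -/
structure IsLevyProcess {Ω : Type*} [MeasurableSpace Ω] (X : ℝ≥0 → Ω → ℝ) (P : Measure Ω) :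
    Prop where
  measurable : ∀ t, Measurable (X t)
  zero : ∀ᵐ ω ∂P, X 0 ω = 0
  indep : HasIndepIncrements X P
  stationary : ∀ s t, IdentDistrib (fun ω => X (s + t) ω - X s ω) (X t) P P
  cadlag : ∀ᵐ ω ∂P, ∀ t, ContinuousWithinAt (fun s => X s ω) (Ioi t) t ∧
    ∃ l : ℝ, Tendsto (fun s => X s ω) (𝓝[<] t) (𝓝 l)

/-- `X` has the characteristic exponent `κ`: `E e^{iξ X_t} = e^{-t κ(ξ)}` for real `ξ`. -/
def HasCharExponent {Ω : Type*} [MeasurableSpace Ω] (X : ℝ≥0 → Ω → ℝ) (P : Measure Ω)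
    (κ : ℝ → ℂ) : Prop :=
  ∀ (t : ℝ≥0) (ξ : ℝ),
    ∫ ω, Complex.exp (Complex.I * ξ * X t ω) ∂P = Complex.exp (-((t : ℝ) * κ ξ))

/-- `X` is a Stieltjes-Lévy process of class `SL_{μ₋, μ₊}` with Gaussian coefficient `σ²`, drift
`b` and Stieltjes-Lévy measures `G₋ ∈ SLM_{μ₊}`, `G₊ ∈ SLM_{-μ₋}`. -/
structure IsSLProcess {Ω : Type*} [MeasurableSpace Ω] (μm μp σ2 b : ℝ) (Gm Gp : Measure ℝ)
    (X : ℝ≥0 → Ω → ℝ) (P : Measure Ω) : Prop where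
  levy : IsLevyProcess X P
  gauss : 0 ≤ σ2
  slm_neg : IsSLM μp Gm
  slm_pos : IsSLM (-μm) Gp
  exponent : HasCharExponent X P (lkExponent σ2 b (slLevyMeasure Gm Gp))

/-- A subordinator: a Lévy process with values in `[0, ∞)`. -/
def IsSubordinator {Ω : Type*} [MeasurableSpace Ω] (Z : ℝ≥0 → Ω → ℝ≥0) (P : Measure Ω) : Prop :=
  IsLevyProcess (fun t ω => (Z t ω : ℝ)) P

/-- `Ψ` is the Laplace exponent of `Z`: `E e^{-q Z_t} = e^{-t Ψ(q)}` for real `q ≥ 0`. -/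
def HasLaplaceExponent {Ω : Type*} [MeasurableSpace Ω] (Z : ℝ≥0 → Ω → ℝ≥0) (P : Measure Ω)
    (Ψ : ℂ → ℂ) : Prop :=
  ∀ (t : ℝ≥0) (q : ℝ), 0 ≤ q →
    ((∫ ω, Real.exp (-(q * Z t ω)) ∂P : ℝ) : ℂ) = Complex.exp (-((t : ℝ) * Ψ q))

/-- `Z` is of class `SL⁺_μ`: a Lévy process without Gaussian component and without negative jumps,
whose Lévy density on `(0, ∞)` is `∫ e^{-tx} G(dt)` for some `G` of class `SLM_μ`.
A drift is allowed. -/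
def IsSLPlus {Ω : Type*} [MeasurableSpace Ω] (μ : ℝ) (Z : ℝ≥0 → Ω → ℝ) (P : Measure Ω) : Prop :=
  IsLevyProcess Z P ∧ ∃ (b : ℝ) (G : Measure ℝ), IsSLM μ G ∧
    HasCharExponent Z P (lkExponent 0 b (slLevyMeasure 0 G))

/-- The Esscher transform `Q_β` on the time interval `[0, T]`:
`dQ_β / dP = e^{β X_T} / E[e^{β X_T}]`. -/
def esscher {Ω : Type*} [MeasurableSpace Ω] (P : Measure Ω) (X : ℝ≥0 → Ω → ℝ) (β : ℝ) (T : ℝ≥0) :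
    Measure Ω :=
  P.tilted fun ω => β * X T ω

end StieltjesLevy

end

/-! The shift by `β` centres the gap between the two cuts. Put `m = (μ₊ - μ₋)/2`. Shifting `G₊` by
`β` and `G₋` by `-β` gives measures `G₁`, `G₂` on `[m, ∞)` with `∫ s⁻³ < ∞`. Expanding the kernels
`1/(t - iw)` to second order at the centre gives, for `ξ = z + iβ`, `ψ(z) = C + (σ²/2) ξ² - i b' ξ +
ξ² (T₁(ξ) + T₂(-ξ))`, where `T_j(ξ) = ∫ s⁻² (s - iξ)⁻¹ G_j(ds)` and `C`, `b'` are real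
(`exists_charExponent_eq`). Evenness kills the odd part: `b' = x ∫ (s² (s² + x))⁻¹ (G₁ - G₂)(ds)`
for all `x > 0`. Letting `x → 0` gives `b' = 0`, and then uniqueness for this Stieltjes-type
transform gives `G₁ = G₂ = G` (`IsTail.eq_of_integral_eq`, `exists_charExponent_eq_of_symm`). Hence
`Ψ(q) = (σ²/2) q + q ∫ 2 / (s (s² + q)) G(ds)`. This formula has two readings. As a complete
Bernstein function, its Stieltjes measure is the image of `(2/s) G(ds)` under `s ↦ s²`. Since `2q /
(s (s² + q)) = 2s ∫₀^∞ (1 - e^{-qx}) e^{-s² x} dx`, it is also the Laplace exponent of a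
subordinator with drift `σ²/2` whose Lévy density is the Laplace transform of the image of `2s
G(ds)`, supported in `[m², ∞)`. Such a subordinator is built from Poisson configurations, and
Campbell's formula gives its exponential moments up to the order `β²`, including the boundary case
`β² = m²` (`exists_subordinator`, `IsTail.exists_subordinator`). The Esscher transform is handled
backwards. Let `μ_t` be the law of `√(2 Z_t) N` with an independent standard normal `N`. Comparing
characteristic functions shows that `X_t` has the law `μ_t` tilted by `e^{-βy}`
(`map_eq_tilted_mixtureLaw`). So `e^{βX_t}` is integrable, and tilting back turns the increments of
`X` into independent variables with laws `μ_{t-s}` (`map_increments_esscher`). Conditioning on `Z`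
shows that `√2 W_Z` has the same increments (`map_increments_subordinated`), which is subordination.
For the inversion formula, the imaginary part of `ψ` next to the cut is an integral of differences
of Poisson kernels against `G`, plus a term of order `ε`; the kernels concentrate as `ε → 0`
(`IsTail.tendsto_inversion`). -/

namespace StieltjesLevy

/-! ### Poisson configurations of finite intensity -/

section Poisson

variable {E : Type*} [MeasurableSpace E]

/-- Finite configurations of points of `E`. -/
abbrev Config (E : Type*) := Σ k : ℕ, (Fin k → E)

/-- The sum of `g` over the points of a configuration. -/
def Config.sum {M : Type*} [AddCommMonoid M] (g : E → M) (c : Config E) : M := ∑ j, g (c.2 j)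

/-- The law of the Poisson configuration with the finite intensity `ρ`. -/
noncomputable def poissonLaw (ρ : Measure E) : Measure (Config E) :=
  Measure.sum fun k : ℕ => ENNReal.ofReal (Real.exp (-ρ.real univ) / k.factorial) •
    (Measure.pi fun _ : Fin k => ρ).map (Sigma.mk k)

lemma measurable_config {F : Type*} [MeasurableSpace F] {f : Config E → F}
    (hf : ∀ k, Measurable fun x : Fin k → E => f ⟨k, x⟩) : Measurable f := by
  intro s hs
  change MeasurableSet[⨅ a, _] _
  rw [MeasurableSpace.measurableSet_iInf]
  exact fun k => hf k hs

lemma measurable_config_mk (k : ℕ) :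
    Measurable (fun x => ⟨k, x⟩ : (Fin k → E) → Config E) := by
  intro s hs
  change MeasurableSet[⨅ a, _] _ at hs
  rw [MeasurableSpace.measurableSet_iInf] at hs
  exact hs k

lemma Config.measurable_sum {M : Type*} [AddCommMonoid M] [MeasurableSpace M] [MeasurableAdd₂ M]
    {g : E → M} (hg : Measurable g) : Measurable (Config.sum g) :=
  measurable_config fun k => by
    simp only [Config.sum]
    exact Finset.measurable_fun_sum (f := fun j (x : Fin k → E) => g (x j)) Finset.univ
      fun j _ => hg.comp (measurable_pi_apply j)

/-- Given the number `k` of points, the expectation of the product factors into a `k`-th power; the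
weights `e^{-ρ(E)}/k!` turn the sum over `k` into an exponential series. The factor `ρ(E)^k` of the
Poisson weights sits in the unnormalised product measure. -/
lemma integral_prod_poissonLaw (ρ : Measure E) [IsFiniteMeasure ρ] {f : E → ℂ}
    (hfm : Measurable f) (hf : Integrable f ρ) :
    Integrable (fun c : Config E => ∏ j, f (c.2 j)) (poissonLaw ρ) ∧
      ∫ c, ∏ j, f (c.2 j) ∂(poissonLaw ρ) = Complex.exp (∫ x, f x ∂ρ - ρ.real univ) := by
  have hmp {g : E → ℂ} (hg : Measurable g) : Measurable (fun c : Config E => ∏ j, g (c.2 j)) :=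
    measurable_config fun k =>
      Finset.measurable_fun_prod (f := fun j (x : Fin k → E) => g (x j)) Finset.univ
        fun j _ => hg.comp (measurable_pi_apply j)
  have hm := hmp hfm
  have hpos (k : ℕ) : 0 ≤ Real.exp (-ρ.real univ) / k.factorial := by positivity
  have hterm (g : E → ℂ) (hgm : Measurable g) (k : ℕ) :
      ∫ c : Config E, ∏ j, g (c.2 j) ∂(ENNReal.ofReal (Real.exp (-ρ.real univ) / k.factorial) •
        (Measure.pi fun _ : Fin k => ρ).map (Sigma.mk k)) =
      Complex.exp (-ρ.real univ) * ((∫ x, g x ∂ρ) ^ k / k.factorial) := by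
    rw [integral_smul_measure, integral_map (measurable_config_mk k).aemeasurable
      (hmp hgm).aestronglyMeasurable,
      integral_fintype_prod_eq_pow, ENNReal.toReal_ofReal (hpos k)]
    simp only [Fintype.card_fin, Complex.real_smul]
    push_cast
    ring
  have hint (k : ℕ) : Integrable (fun c : Config E => ∏ j, f (c.2 j))
      (ENNReal.ofReal (Real.exp (-ρ.real univ) / k.factorial) •
        (Measure.pi fun _ : Fin k => ρ).map (Sigma.mk k)) := by
    refine Integrable.smul_measure ?_ ENNReal.ofReal_ne_top
    rw [integrable_map_measure hm.aestronglyMeasurable (measurable_config_mk k).aemeasurable]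
    exact Integrable.fintype_prod fun _ => hf
  have hI : Integrable (fun c : Config E => ∏ j, f (c.2 j)) (poissonLaw ρ) := by
    refine integrable_sum_measure hint ?_
    have h1 (k : ℕ) : ∫ c : Config E, ‖∏ j, f (c.2 j)‖
        ∂(ENNReal.ofReal (Real.exp (-ρ.real univ) / k.factorial) •
        (Measure.pi fun _ : Fin k => ρ).map (Sigma.mk k)) =
        Real.exp (-ρ.real univ) * ((∫ x, ‖f x‖ ∂ρ) ^ k / k.factorial) := by
      rw [integral_smul_measure, integral_map (measurable_config_mk k).aemeasurable
        hm.norm.aestronglyMeasurable, ENNReal.toReal_ofReal (hpos k)]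
      simp only [norm_prod]
      rw [integral_fintype_prod_eq_pow (fun x => ‖f x‖)]
      simp only [Fintype.card_fin, smul_eq_mul]
      ring
    simp_rw [h1]
    exact (Real.summable_pow_div_factorial _).mul_left _
  refine ⟨hI, ?_⟩
  rw [poissonLaw, integral_sum_measure hI]
  simp_rw [hterm f hfm]
  rw [tsum_mul_left, sub_eq_neg_add, Complex.exp_add, Complex.exp_eq_exp_ℂ,
    NormedSpace.exp_eq_tsum_div]

instance (ρ : Measure E) [IsFiniteMeasure ρ] : IsProbabilityMeasure (poissonLaw ρ) := by
  obtain ⟨h1, h2⟩ := integral_prod_poissonLaw ρ (f := fun _ => 1) measurable_const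
    (integrable_const _)
  simp only [Finset.prod_const_one, integral_const, Complex.real_smul, mul_one, sub_self,
    Complex.exp_zero] at h2
  have h3 : (poissonLaw ρ).real univ = 1 := by exact_mod_cast h2
  constructor
  rw [measureReal_def] at h3
  exact (ENNReal.toReal_eq_one_iff _).1 h3

lemma integral_exp_sum_poissonLaw (ρ : Measure E) [IsFiniteMeasure ρ] {g : E → ℂ}
    (hgm : Measurable g) (hg : Integrable (fun x => Complex.exp (g x) - 1) ρ) :
    Integrable (fun c : Config E => Complex.exp (c.sum g)) (poissonLaw ρ) ∧
      ∫ c : Config E, Complex.exp (c.sum g) ∂(poissonLaw ρ) =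
        Complex.exp (∫ x, (Complex.exp (g x) - 1) ∂ρ) := by
  have h1 : Integrable (fun x => Complex.exp (g x)) ρ := by
    simpa [Pi.add_def] using hg.add (integrable_const 1)
  have h2 := integral_prod_poissonLaw ρ (hgm.cexp) h1
  simp only [Config.sum, Complex.exp_sum]
  refine ⟨h2.1, ?_⟩
  rw [h2.2, integral_sub h1 (integrable_const _)]
  simp

/-- The `k`-th term carries `k · ρ(E)^(k-1) ∫ g`, and `k/k! = 1/(k-1)!` shifts the series back to
the total mass one. -/
lemma lintegral_sum_poissonLaw (ρ : Measure E) [IsFiniteMeasure ρ] {g : E → ℝ≥0∞}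
    (hg : Measurable g) :
    ∫⁻ c : Config E, c.sum g ∂(poissonLaw ρ) = ∫⁻ x, g x ∂ρ := by
  have h0 : ∑' k : ℕ, ENNReal.ofReal (Real.exp (-ρ.real univ) / k.factorial) * ρ univ ^ k = 1 := by
    have h := measure_univ (μ := poissonLaw ρ)
    rw [poissonLaw, Measure.sum_apply _ MeasurableSet.univ] at h
    rw [← h]
    refine tsum_congr fun k => ?_
    rw [Measure.smul_apply, Measure.map_apply (measurable_config_mk k) MeasurableSet.univ]
    simp [Measure.pi_univ]
  have hterm (k : ℕ) : ∫⁻ c : Config E, c.sum g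
      ∂(ENNReal.ofReal (Real.exp (-ρ.real univ) / k.factorial) •
        (Measure.pi fun _ : Fin k => ρ).map (Sigma.mk k)) =
      ENNReal.ofReal (Real.exp (-ρ.real univ) / k.factorial) *
        (k * (ρ univ ^ (k - 1) * ∫⁻ x, g x ∂ρ)) := by
    rw [lintegral_smul_measure, lintegral_map (Config.measurable_sum hg) (measurable_config_mk k)]
    simp only [Config.sum, smul_eq_mul]
    congr 1
    refine (lintegral_finsetSum (f := fun j (x : Fin k → E) => g (x j)) Finset.univ
      fun j _ => hg.comp (measurable_pi_apply j)).trans ?_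
    have h1 (j : Fin k) : ∫⁻ x : Fin k → E, g (x j) ∂(Measure.pi fun _ => ρ) =
        ρ univ ^ (k - 1) * ∫⁻ x, g x ∂ρ := by
      have := lintegral_map (μ := Measure.pi fun _ : Fin k => ρ) hg (measurable_pi_apply j)
      rw [← this, Measure.pi_map_eval]
      simp [lintegral_smul_measure, Finset.card_erase_of_mem]
    simp [h1]
  rw [poissonLaw, lintegral_sum_measure]
  simp_rw [hterm]
  rw [tsum_eq_zero_add' ENNReal.summable]
  simp only [Nat.cast_zero, zero_mul, mul_zero, zero_add, Nat.add_sub_cancel]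
  calc _ = ∑' k : ℕ, ENNReal.ofReal (Real.exp (-ρ.real univ) / k.factorial) * ρ univ ^ k *
        ∫⁻ x, g x ∂ρ := tsum_congr fun k => ?_
    _ = _ := by rw [ENNReal.tsum_mul_right, h0, one_mul]
  rw [← mul_assoc, ← mul_assoc]
  congr 2
  rw [← ENNReal.ofReal_natCast, ← ENNReal.ofReal_mul (by positivity)]
  congr 1
  rw [Nat.factorial_succ]
  push_cast
  field_simp

end Poisson

/-! ### Poisson configurations of σ-finite intensity -/

section Superposition

variable {E : Type*} [MeasurableSpace E] (ρ : ℕ → Measure E) [∀ n, IsFiniteMeasure (ρ n)]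

/-- The law of a sequence of independent Poisson configurations. -/
noncomputable abbrev poissonSeq : Measure (ℕ → Config E) :=
  Measure.infinitePi fun n => poissonLaw (ρ n)

lemma lintegral_tsum_poissonSeq {g : E → ℝ≥0∞} (hg : Measurable g) :
    ∫⁻ ω, ∑' n, (ω n).sum g ∂(poissonSeq ρ) = ∫⁻ x, g x ∂(Measure.sum ρ) := by
  rw [lintegral_tsum (f := fun n (ω : ℕ → Config E) => (ω n).sum g)
    fun n => ((Config.measurable_sum hg).comp (measurable_pi_apply n)).aemeasurable,
    lintegral_sum_measure]
  refine tsum_congr fun n => ?_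
  rw [← lintegral_sum_poissonLaw (ρ n) hg,
    ← Measure.infinitePi_map_eval (fun n => poissonLaw (ρ n)) n,
    lintegral_map (Config.measurable_sum hg) (measurable_pi_apply n)]

/-- The sum has a finite mean by `lintegral_tsum_poissonSeq`, hence is almost surely finite. -/
lemma ae_summable_poissonSeq {g : E → ℝ≥0} (hgm : Measurable g)
    (hg : ∫⁻ x, g x ∂(Measure.sum ρ) < ∞) :
    ∀ᵐ ω ∂(poissonSeq ρ), Summable fun n => (ω n).sum g := by
  have h1 := lintegral_tsum_poissonSeq ρ hgm.coe_nnreal_ennreal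
  have hm : Measurable fun ω : ℕ → Config E => ∑' n, (ω n).sum fun x => (g x : ℝ≥0∞) :=
    Measurable.tsum fun n =>
      (Config.measurable_sum hgm.coe_nnreal_ennreal).comp (measurable_pi_apply n)
  have h2 := ae_lt_top hm (by rw [h1]; exact hg.ne)
  filter_upwards [h2] with ω hω
  rw [← ENNReal.tsum_coe_ne_top_iff_summable]
  convert hω.ne using 5 with n
  simp [Config.sum]

lemma ae_summable_norm_poissonSeq {F : Type*} [NormedAddCommGroup F] [MeasurableSpace F]
    [OpensMeasurableSpace F] {g : E → F} (hgm : Measurable g)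
    (hg : Integrable g (Measure.sum ρ)) :
    ∀ᵐ ω ∂(poissonSeq ρ), Summable fun n => ‖(ω n).sum g‖ := by
  have h := ae_summable_poissonSeq ρ (g := fun x => ‖g x‖₊) hgm.nnnorm hg.2
  filter_upwards [h] with ω hω
  refine Summable.of_nonneg_of_le (fun _ => norm_nonneg _) (fun n => ?_) (NNReal.summable_coe.2 hω)
  simpa [Config.sum] using norm_sum_le _ _

lemma integral_exp_sum_range_poissonSeq {g : E → ℂ} (hgm : Measurable g)
    (hg : Integrable (fun x => Complex.exp (g x) - 1) (Measure.sum ρ)) (M : ℕ) :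
    Integrable (fun ω => Complex.exp (∑ n ∈ Finset.range M, (ω n).sum g)) (poissonSeq ρ) ∧
      ∫ ω, Complex.exp (∑ n ∈ Finset.range M, (ω n).sum g) ∂(poissonSeq ρ) =
        Complex.exp (∑ n ∈ Finset.range M, ∫ x, (Complex.exp (g x) - 1) ∂(ρ n)) := by
  have hgn (n : ℕ) := integral_exp_sum_poissonLaw (ρ n) hgm (hg.mono_measure (Measure.le_sum _ n))
  have hm : Measurable fun c : Config E => Complex.exp (c.sum g) := (Config.measurable_sum hgm).cexp
  have hind : iIndepFun (fun n (ω : ℕ → Config E) => Complex.exp ((ω n).sum g)) (poissonSeq ρ) :=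
    iIndepFun_infinitePi (P := fun n => poissonLaw (ρ n)) fun _ => hm
  have hmn (n : ℕ) : Measurable fun ω : ℕ → Config E => Complex.exp ((ω n).sum g) :=
    hm.comp (measurable_pi_apply n)
  have hintn (n : ℕ) : ∫ ω, Complex.exp ((ω n).sum g) ∂(poissonSeq ρ) =
      Complex.exp (∫ x, (Complex.exp (g x) - 1) ∂(ρ n)) := by
    rw [← (hgn n).2, ← Measure.infinitePi_map_eval (fun n => poissonLaw (ρ n)) n,
      integral_map (measurable_pi_apply n).aemeasurable hm.aestronglyMeasurable]
  have hI (n : ℕ) : Integrable (fun ω => Complex.exp ((ω n).sum g)) (poissonSeq ρ) := by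
    have := (hgn n).1
    rw [← Measure.infinitePi_map_eval (fun n => poissonLaw (ρ n)) n] at this
    exact this.comp_measurable (measurable_pi_apply n)
  simp only [Complex.exp_sum]
  have hfin : iIndepFun (fun (n : Fin M) (ω : ℕ → Config E) => Complex.exp ((ω n).sum g))
    (poissonSeq ρ) := hind.precomp Fin.val_injective
  constructor
  · clear hfin
    induction M with
    | zero => simp
    | succ M ih =>
      simp only [Finset.prod_range_succ]
      have h2 := hind.indepFun_finsetProd_of_notMem hmn (s := Finset.range M) (i := M) (by simp)
      have h3 := h2.integrable_mul (by simpa [Finset.prod_fn] using ih) (hI M)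
      simpa [Pi.mul_def] using h3
  · simp only [Finset.prod_range]
    rw [hfin.integral_fun_prod_eq_prod_integral fun n => (hmn n).aestronglyMeasurable]
    simp [hintn]

/-- One bound serves both regimes of Campbell's formula: integrability of the exponent controls the
small values, and only the exponential moment of a majorant of its real part is needed for the large
ones. -/
lemma norm_exp_sub_one_le_of_re_le {z : ℂ} {h : ℝ} (hz : z.re ≤ h) (h0 : 0 ≤ h) :
    ‖Complex.exp z - 1‖ ≤ (Real.exp h - 1) + 3 * ‖z‖ := by
  have h1 : 0 ≤ Real.exp h - 1 := by linarith [Real.one_le_exp h0]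
  rcases le_total ‖z‖ 1 with hz1 | hz1
  · have := Complex.norm_exp_sub_one_le hz1
    linarith [norm_nonneg z]
  · calc ‖Complex.exp z - 1‖ ≤ ‖Complex.exp z‖ + ‖(1 : ℂ)‖ := norm_sub_le _ _
      _ ≤ Real.exp h + 1 := by
        rw [Complex.norm_exp, norm_one]; gcongr
      _ ≤ _ := by linarith

lemma integrable_exp_sub_one {E : Type*} [MeasurableSpace E] {ρ : Measure E}
    {g : E → ℂ} {h : E → ℝ} (hgm : Measurable g)
    (hg : Integrable g ρ) (h0 : ∀ x, 0 ≤ h x) (hgh : ∀ x, (g x).re ≤ h x)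
    (hh : Integrable (fun x => Real.exp (h x) - 1) ρ) :
    Integrable (fun x => Complex.exp (g x) - 1) ρ :=
  (hh.add (hg.norm.const_mul 3)).mono' (hgm.cexp.sub_const 1).aestronglyMeasurable
    (ae_of_all _ fun x => norm_exp_sub_one_le_of_re_le (hgh x) (h0 x))

lemma integrable_of_exp_sub_one {E : Type*} [MeasurableSpace E] {ρ : Measure E}
    {h : E → ℝ} (hhm : Measurable h) (h0 : ∀ x, 0 ≤ h x)
    (hh : Integrable (fun x => Real.exp (h x) - 1) ρ) : Integrable h ρ :=
  hh.mono' hhm.aestronglyMeasurable (ae_of_all _ fun x => by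
    rw [Real.norm_of_nonneg (h0 x)]; linarith [Real.add_one_le_exp (h x)])

/-- Campbell's formula. -/
theorem integral_exp_tsum_poissonSeq {g : E → ℂ} {h : E → ℝ} (hgm : Measurable g)
    (hhm : Measurable h) (hg : Integrable g (Measure.sum ρ)) (h0 : ∀ x, 0 ≤ h x)
    (hgh : ∀ x, (g x).re ≤ h x) (hh : Integrable (fun x => Real.exp (h x) - 1) (Measure.sum ρ)) :
    Integrable (fun ω => Complex.exp (∑' n, (ω n).sum g)) (poissonSeq ρ) ∧
      ∫ ω, Complex.exp (∑' n, (ω n).sum g) ∂(poissonSeq ρ) =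
        Complex.exp (∫ x, (Complex.exp (g x) - 1) ∂(Measure.sum ρ)) := by
  have hge := integrable_exp_sub_one hgm hg h0 hgh hh
  have hhi := integrable_of_exp_sub_one hhm h0 hh
  have hhC : Integrable (fun x => Complex.exp (h x) - 1) (Measure.sum ρ) := by
    simpa using hh.ofReal (𝕜 := ℂ)
  have hsg := ae_summable_norm_poissonSeq ρ hgm hg
  have hsh := ae_summable_norm_poissonSeq ρ hhm hhi
  have hsum0 (c : Config E) : 0 ≤ c.sum h := Finset.sum_nonneg fun _ _ => h0 _
  have hmg (n : ℕ) : Measurable fun ω : ℕ → Config E => (ω n).sum g :=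
    (Config.measurable_sum hgm).comp (measurable_pi_apply n)
  have hmh (n : ℕ) : Measurable fun ω : ℕ → Config E => (ω n).sum h :=
    (Config.measurable_sum hhm).comp (measurable_pi_apply n)
  have hmF (M : ℕ) : Measurable fun ω : ℕ → Config E =>
      Complex.exp (∑ n ∈ Finset.range M, (ω n).sum g) :=
    (Finset.measurable_fun_sum _ fun n _ => hmg n).cexp
  have hmH (M : ℕ) : Measurable fun ω : ℕ → Config E =>
      Real.exp (∑ n ∈ Finset.range M, (ω n).sum h) :=
    (Finset.measurable_fun_sum _ fun n _ => hmh n).exp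
  have hlimg : ∀ᵐ ω ∂(poissonSeq ρ), Tendsto (fun M => Complex.exp (∑ n ∈ Finset.range M, (ω n).sum g))
      atTop (𝓝 (Complex.exp (∑' n, (ω n).sum g))) := by
    filter_upwards [hsg] with ω hω
    exact (Complex.continuous_exp.tendsto _).comp hω.of_norm.hasSum.tendsto_sum_nat
  have hlimh : ∀ᵐ ω ∂(poissonSeq ρ), Tendsto (fun M => Real.exp (∑ n ∈ Finset.range M, (ω n).sum h))
      atTop (𝓝 (Real.exp (∑' n, (ω n).sum h))) := by
    filter_upwards [hsh] with ω hω
    exact (Real.continuous_exp.tendsto _).comp hω.of_norm.hasSum.tendsto_sum_nat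
  -- The dominating function: Fatou's lemma along the partial sums, whose real exponential moments
  -- are all bounded by that of the full intensity because the terms `e^h - 1` are nonnegative.
  have hB : Integrable (fun ω => Real.exp (∑' n, (ω n).sum h)) (poissonSeq ρ) := by
    refine ⟨aestronglyMeasurable_of_tendsto_ae atTop
      (fun M => (hmH M).aestronglyMeasurable) hlimh, ?_⟩
    have hle (M : ℕ) : ∫⁻ ω, ‖Real.exp (∑ n ∈ Finset.range M, (ω n).sum h)‖ₑ ∂(poissonSeq ρ) ≤
        ENNReal.ofReal (Real.exp (∫ x, (Real.exp (h x) - 1) ∂(Measure.sum ρ))) := by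
      have hC := integral_exp_sum_range_poissonSeq ρ (g := fun x => (h x : ℂ)) (by fun_prop) hhC M
      have hcast (ω : ℕ → Config E) :
          Complex.exp (∑ n ∈ Finset.range M, (ω n).sum fun x => (h x : ℂ)) =
          ((Real.exp (∑ n ∈ Finset.range M, (ω n).sum h) : ℝ) : ℂ) := by
        simp [Config.sum]
      simp_rw [hcast] at hC
      have hint := hC.1.re
      simp only [RCLike.re_to_complex, Complex.ofReal_re] at hint
      have hval : ∫ ω, Real.exp (∑ n ∈ Finset.range M, (ω n).sum h) ∂(poissonSeq ρ) =
          Real.exp (∑ n ∈ Finset.range M, ∫ x, (Real.exp (h x) - 1) ∂(ρ n)) := by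
        have h2 := hC.2
        have h3 (n : ℕ) : ∫ x, (Complex.exp (h x) - 1) ∂(ρ n) =
            ((∫ x, (Real.exp (h x) - 1) ∂(ρ n) : ℝ) : ℂ) := by
          rw [← integral_complex_ofReal]; simp
        simp_rw [h3] at h2
        rw [integral_complex_ofReal] at h2
        exact_mod_cast h2
      have h4 : ∫⁻ ω, ‖Real.exp (∑ n ∈ Finset.range M, (ω n).sum h)‖ₑ ∂(poissonSeq ρ) =
          ENNReal.ofReal (∫ ω, Real.exp (∑ n ∈ Finset.range M, (ω n).sum h) ∂(poissonSeq ρ)) := by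
        rw [ofReal_integral_eq_lintegral_ofReal hint (ae_of_all _ fun _ => (Real.exp_pos _).le)]
        refine lintegral_congr fun ω => ?_
        rw [Real.enorm_eq_ofReal (Real.exp_pos _).le]
      rw [h4, hval]
      gcongr
      have hs := hasSum_integral_measure hh
      exact sum_le_hasSum _ (fun n _ => integral_nonneg fun x => by
        simpa using h0 x) hs
    have h5 : ∫⁻ ω, ‖Real.exp (∑' n, (ω n).sum h)‖ₑ ∂(poissonSeq ρ) ≤ liminf (fun M => ∫⁻ ω,
        ‖Real.exp (∑ n ∈ Finset.range M, (ω n).sum h)‖ₑ ∂(poissonSeq ρ)) atTop := by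
      refine le_of_eq_of_le (lintegral_congr_ae ?_)
        (lintegral_liminf_le fun M => (hmH M).enorm)
      filter_upwards [hlimh] with ω hω using hω.enorm.liminf_eq.symm
    refine (h5.trans (liminf_le_of_le (by isBoundedDefault) fun b hb => ?_)).trans_lt
      (ENNReal.ofReal_lt_top (r := Real.exp (∫ x, (Real.exp (h x) - 1) ∂(Measure.sum ρ))))
    obtain ⟨M, hM⟩ := hb.exists
    exact hM.trans (hle M)
  have hbound (M : ℕ) : ∀ᵐ ω ∂(poissonSeq ρ),
      ‖Complex.exp (∑ n ∈ Finset.range M, (ω n).sum g)‖ ≤ Real.exp (∑' n, (ω n).sum h) := by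
    filter_upwards [hsh] with ω hω
    rw [Complex.norm_exp, Real.exp_le_exp]
    refine le_trans ?_ (hω.of_norm.sum_le_tsum (Finset.range M) fun n _ => hsum0 _)
    rw [Complex.re_sum]
    refine Finset.sum_le_sum fun n _ => ?_
    simp only [Config.sum, Complex.re_sum]
    exact Finset.sum_le_sum fun j _ => hgh _
  have hmeas := aestronglyMeasurable_of_tendsto_ae atTop
      (fun M => (hmF M).aestronglyMeasurable) hlimg
  refine ⟨hB.mono' hmeas ?_, ?_⟩
  · filter_upwards [hlimg, ae_all_iff.2 hbound] with ω h1 h2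
    exact le_of_tendsto h1.norm (Eventually.of_forall h2)
  · have ht := tendsto_integral_of_dominated_convergence _
      (fun M => (hmF M).aestronglyMeasurable) hB hbound hlimg
    refine tendsto_nhds_unique ht ?_
    simp_rw [fun M => (integral_exp_sum_range_poissonSeq ρ hgm hge M).2]
    exact (Complex.continuous_exp.tendsto _).comp (hasSum_integral_measure hge).tendsto_sum_nat

end Superposition

/-! ### Subordinators as sums over Poisson configurations -/

section Subordinator

/-- The jump recorded at time `t`. -/
noncomputable def jump (t : ℝ≥0) (p : ℝ × ℝ) : ℝ≥0 := if p.1 ≤ t then p.2.toNNReal else 0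

/-- The drift `a t` plus the sum of the jumps up to time `t`. -/
noncomputable def jumpPath (a : ℝ≥0) (t : ℝ≥0) (ω : ℕ → Config (ℝ × ℝ)) : ℝ≥0 :=
  a * t + ∑' n, (ω n).sum (jump t)

/-- The intensity `ds ν(dx)` on `s > 0`. -/
noncomputable def jumpIntensity (ν : Measure ℝ) : Measure (ℝ × ℝ) :=
  (volume.restrict (Ioi 0)).prod ν

instance (ν : Measure ℝ) [SFinite ν] : SFinite (jumpIntensity ν) := by
  unfold jumpIntensity; infer_instance

/-- The law of the Poisson configurations of times and sizes of jumps. -/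
noncomputable abbrev jumpLaw (ν : Measure ℝ) [SFinite ν] : Measure (ℕ → Config (ℝ × ℝ)) :=
  poissonSeq (sfiniteSeq (jumpIntensity ν))

lemma measurable_jump (t : ℝ≥0) : Measurable (jump t) :=
  Measurable.ite (measurableSet_le measurable_fst measurable_const)
    measurable_snd.real_toNNReal measurable_const

lemma jump_mono (p : ℝ × ℝ) : Monotone fun t => jump t p := by
  intro s t hst
  have : (s : ℝ) ≤ t := hst
  simp only [jump]
  split_ifs with h1 h2
  · exact le_rfl
  · exact absurd (h1.trans this) h2
  · exact zero_le
  · exact le_rfl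

lemma measurable_jumpPath (a t : ℝ≥0) : Measurable (jumpPath a t) :=
  (Measurable.tsum fun n => (Config.measurable_sum (measurable_jump t)).comp
    (measurable_pi_apply n)).const_add _

lemma integral_indicator_mul_jumpIntensity {ν : Measure ℝ} [SFinite ν] {S : Set ℝ}
    (hS : MeasurableSet S) (hS' : volume (S ∩ Ioi 0) ≠ ∞) {f : ℝ → ℂ} (hf : Integrable f ν) :
    Integrable (fun p : ℝ × ℝ => S.indicator (fun _ => (1 : ℂ)) p.1 * f p.2) (jumpIntensity ν) ∧
      ∫ p, S.indicator (fun _ => (1 : ℂ)) p.1 * f p.2 ∂(jumpIntensity ν) =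
        volume.real (S ∩ Ioi 0) * ∫ x, f x ∂ν := by
  constructor
  · refine Integrable.mul_prod ?_ hf
    rw [integrable_indicator_iff hS]
    exact integrableOn_const (by rwa [Measure.restrict_apply hS])
  · rw [jumpIntensity, integral_prod_mul, integral_indicator hS, integral_const]
    simp [measureReal_def, Measure.restrict_apply, hS]

/-- The weight of a jump in the linear combination `∑ c_k (Z_{t_{k+1}} - Z_{t_k})`. -/
noncomputable def jumpWeight (c : ℕ → ℂ) (t : ℕ → ℝ≥0) (n : ℕ) (p : ℝ × ℝ) : ℂ :=
  ∑ k ∈ Finset.range n, c k * ((jump (t (k + 1)) p : ℂ) - (jump (t k) p : ℂ))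

lemma jump_eq (t : ℝ≥0) (p : ℝ × ℝ) :
    (jump t p : ℂ) = (Iic (t : ℝ)).indicator (fun _ => (1 : ℂ)) p.1 * (p.2.toNNReal : ℂ) := by
  by_cases h : p.1 ≤ t <;> simp [jump, h]

lemma jumpWeight_of_lt {c : ℕ → ℂ} {t : ℕ → ℝ≥0} (ht : Monotone t) {n : ℕ} {p : ℝ × ℝ}
    (h : (t n : ℝ) < p.1) : jumpWeight c t n p = 0 := by
  refine Finset.sum_eq_zero fun k hk => ?_
  have hk' := Finset.mem_range.1 hk
  have h1 : (t (k + 1) : ℝ) < p.1 := lt_of_le_of_lt (by exact_mod_cast ht hk') h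
  have h2 : (t k : ℝ) < p.1 := lt_of_le_of_lt (by exact_mod_cast ht hk'.le) h
  simp [jump, not_le.2 h1, not_le.2 h2]

lemma jumpWeight_succ_of_le {c : ℕ → ℂ} {t : ℕ → ℝ≥0} (ht : Monotone t) {n : ℕ} {p : ℝ × ℝ}
    (h : p.1 ≤ t n) : jumpWeight c t (n + 1) p = jumpWeight c t n p := by
  have h1 : p.1 ≤ t (n + 1) := h.trans (by exact_mod_cast ht n.le_succ)
  simp [jumpWeight, Finset.sum_range_succ, jump, h, h1]

lemma jumpWeight_succ_of_lt {c : ℕ → ℂ} {t : ℕ → ℝ≥0} (ht : Monotone t) {n : ℕ} {p : ℝ × ℝ}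
    (h : (t n : ℝ) < p.1) : jumpWeight c t (n + 1) p = c n * jump (t (n + 1)) p := by
  have h1 := jumpWeight_of_lt (c := c) ht h
  rw [jumpWeight] at h1 ⊢
  rw [Finset.sum_range_succ, h1]
  simp [jump, not_le.2 h]

/-- The intervals `(t k, t (k+1)]` are disjoint, so a jump lies in at most one of them and its
weight is then `c k` times its size. The exponential therefore splits additively, which is what
makes the increments independent. -/
lemma exp_jumpWeight_sub_one (c : ℕ → ℂ) {t : ℕ → ℝ≥0} (ht : Monotone t) (n : ℕ) (p : ℝ × ℝ) :
    Complex.exp (jumpWeight c t n p) - 1 = ∑ k ∈ Finset.range n,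
      (Ioc (t k : ℝ) (t (k + 1))).indicator (fun _ => (1 : ℂ)) p.1 *
        (Complex.exp (c k * (p.2.toNNReal : ℝ)) - 1) := by
  induction n with
  | zero => simp [jumpWeight]
  | succ n ih =>
    rw [Finset.sum_range_succ, ← ih]
    rcases le_or_gt p.1 (t n) with h | h
    · rw [jumpWeight_succ_of_le ht h]
      simp [not_lt.2 h]
    · rw [jumpWeight_succ_of_lt ht h, jumpWeight_of_lt ht h]
      by_cases h1 : p.1 ≤ t (n + 1) <;> simp [jump, h, h1]

lemma re_jumpWeight_le {c : ℕ → ℂ} {C : ℝ} (hC : 0 ≤ C) (hc : ∀ k, (c k).re ≤ C)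
    {t : ℕ → ℝ≥0} (ht : Monotone t) (n : ℕ) (p : ℝ × ℝ) :
    (jumpWeight c t n p).re ≤ C * jump (t n) p := by
  induction n with
  | zero => simp only [jumpWeight, Finset.range_zero, Finset.sum_empty, Complex.zero_re]; positivity
  | succ n ih =>
    rcases le_or_gt p.1 (t n) with h | h
    · rw [jumpWeight_succ_of_le ht h]
      refine ih.trans ?_
      gcongr
      exact_mod_cast jump_mono p (ht n.le_succ)
    · rw [jumpWeight_succ_of_lt ht h, Complex.re_mul_ofReal]
      gcongr
      exact hc n

variable {ν : Measure ℝ}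

lemma volume_Iic_inter_Ioi_ne_top (t : ℝ≥0) : volume (Iic (t : ℝ) ∩ Ioi 0) ≠ ∞ := by
  rw [inter_comm, Ioi_inter_Iic]; simp

lemma integrable_toNNReal (hν : Integrable (fun x => x) ν) :
    Integrable (fun x : ℝ => ((x.toNNReal : ℝ) : ℂ)) ν := by
  refine hν.mono (by fun_prop) (ae_of_all _ fun x => ?_)
  simp only [Complex.norm_real, Real.coe_toNNReal', Real.norm_eq_abs]
  rcases le_total x 0 with h | h <;> simp [h]

variable [SFinite ν]

lemma integrable_jump (hν : Integrable (fun x => x) ν) (t : ℝ≥0) :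
    Integrable (fun p => (jump t p : ℂ)) (jumpIntensity ν) := by
  simp_rw [jump_eq]
  exact (integral_indicator_mul_jumpIntensity measurableSet_Iic (volume_Iic_inter_Ioi_ne_top t)
    (integrable_toNNReal hν)).1

/-- Jumps accumulate monotonically in time, so the integer times suffice and a single null set
serves all `t`. -/
lemma ae_summable_jump (hν : Integrable (fun x => x) ν) :
    ∀ᵐ ω ∂(jumpLaw ν), ∀ t, Summable fun n => (ω n).sum (jump t) := by
  have h1 (N : ℕ) : ∀ᵐ ω ∂(jumpLaw ν), Summable fun n => (ω n).sum (jump N) := by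
    refine ae_summable_poissonSeq _ (measurable_jump _) ?_
    rw [sum_sfiniteSeq]
    have := (integrable_jump hν N).2
    refine lt_of_le_of_lt (lintegral_mono fun p => ?_) this
    rw [enorm_eq_nnnorm, Complex.nnnorm_real, Real.nnnorm_of_nonneg (NNReal.coe_nonneg _)]
    rfl
  filter_upwards [ae_all_iff.2 h1] with ω hω t
  obtain ⟨N, hN⟩ := exists_nat_ge t
  exact NNReal.summable_of_le (fun n => Finset.sum_le_sum fun j _ => jump_mono _ hN) (hω N)

lemma sum_jumpPath {ω : ℕ → Config (ℝ × ℝ)} (hω : ∀ t, Summable fun n => (ω n).sum (jump t))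
    (a : ℝ≥0) (c : ℕ → ℂ) (t : ℕ → ℝ≥0) (n : ℕ) :
    ∑ k ∈ Finset.range n, c k * ((jumpPath a (t (k + 1)) ω : ℂ) - (jumpPath a (t k) ω : ℂ)) =
      (∑ k ∈ Finset.range n, c k * (a * ((t (k + 1) : ℂ) - t k))) +
        ∑' i, (ω i).sum (jumpWeight c t n) := by
  have h1 (s : ℝ≥0) : HasSum (fun i => (ω i).sum fun p => (jump s p : ℂ))
      ((jumpPath a s ω : ℂ) - a * s) := by
    have h2 := (hω s).hasSum
    have h3 := (Complex.hasSum_ofReal (L := .unconditional ℕ)).2 (NNReal.hasSum_coe.2 h2)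
    convert h3 using 1
    · ext i
      simp [Config.sum]
    · simp [jumpPath]
  have h4 := hasSum_sum (s := Finset.range n) fun k _ =>
    ((h1 (t (k + 1))).sub (h1 (t k))).mul_left (c k)
  have h5 : (fun i => (ω i).sum (jumpWeight c t n)) = fun i => ∑ k ∈ Finset.range n,
      c k * (((ω i).sum fun p => (jump (t (k + 1)) p : ℂ)) - (ω i).sum fun p => (jump (t k) p : ℂ)) := by
    ext i
    simp only [Config.sum, jumpWeight]
    rw [Finset.sum_comm]
    refine Finset.sum_congr rfl fun k _ => ?_
    rw [← Finset.mul_sum, Finset.sum_sub_distrib]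
  rw [h5, h4.tsum_eq, ← Finset.sum_add_distrib]
  exact Finset.sum_congr rfl fun k _ => by ring

/-- The joint exponential moments of the increments of a subordinator. -/
theorem integral_exp_sum_jumpPath (hν0 : ν (Iic 0) = 0) (hν : Integrable (fun x => x) ν)
    (a : ℝ≥0) {C : ℝ} (hC : 0 ≤ C) (hνC : Integrable (fun x => Real.exp (C * x) - 1) ν)
    {c : ℕ → ℂ} (hc : ∀ k, (c k).re ≤ C) {t : ℕ → ℝ≥0} (ht : Monotone t) (n : ℕ) :
    Integrable (fun ω => Complex.exp (∑ k ∈ Finset.range n,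
      c k * ((jumpPath a (t (k + 1)) ω : ℂ) - (jumpPath a (t k) ω : ℂ)))) (jumpLaw ν) ∧
    ∫ ω, Complex.exp (∑ k ∈ Finset.range n,
      c k * ((jumpPath a (t (k + 1)) ω : ℂ) - (jumpPath a (t k) ω : ℂ))) ∂(jumpLaw ν) =
      Complex.exp (∑ k ∈ Finset.range n, ((t (k + 1) : ℂ) - t k) *
        (a * c k + ∫ x, (Complex.exp (c k * x) - 1) ∂ν)) := by
  have hae : ∀ᵐ x ∂ν, ((x.toNNReal : ℝ≥0) : ℝ) = x := by
    have : ∀ᵐ x ∂ν, x ∉ Iic 0 := measure_eq_zero_iff_ae_notMem.1 hν0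
    filter_upwards [this] with x hx
    exact Real.coe_toNNReal x (not_le.1 hx).le
  have hνC' : Integrable (fun x : ℝ => Real.exp (C * (x.toNNReal : ℝ)) - 1) ν :=
    hνC.congr (by filter_upwards [hae] with x hx; rw [hx])
  have hexpc (k : ℕ) : Integrable (fun x : ℝ => Complex.exp (c k * (x.toNNReal : ℝ)) - 1) ν :=
    integrable_exp_sub_one (h := fun x => C * (x.toNNReal : ℝ)) (by fun_prop)
      ((integrable_toNNReal hν).const_mul _) (fun x => by positivity)
      (fun x => by rw [Complex.re_mul_ofReal]; gcongr; exact hc k) hνC'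
  have hmj (s : ℝ≥0) : Measurable fun p => (jump s p : ℂ) := by
    have := measurable_jump s
    fun_prop
  have hgm : Measurable (jumpWeight c t n) :=
    Finset.measurable_fun_sum _ fun k _ => ((hmj _).sub (hmj _)).const_mul _
  have hhm : Measurable fun p => C * (jump (t n) p : ℝ) := by
    have := measurable_jump (t n)
    fun_prop
  have hgi : Integrable (jumpWeight c t n) (jumpIntensity ν) :=
    integrable_finsetSum _ fun k _ =>
      ((integrable_jump hν _).sub (integrable_jump hν _)).const_mul _
  have hhi : Integrable (fun p => Real.exp (C * (jump (t n) p : ℝ)) - 1) (jumpIntensity ν) := by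
    have h1 := (integral_indicator_mul_jumpIntensity measurableSet_Iic
      (volume_Iic_inter_Ioi_ne_top (t n)) hνC'.ofReal).1.re
    refine h1.congr (ae_of_all _ fun p => ?_)
    by_cases h : p.1 ≤ t n
    · simp only [jump, h, mem_Iic, indicator_of_mem, if_true, one_mul]
      simp [-Complex.ofReal_exp, -Complex.ofReal_mul, -Complex.ofReal_sub]
    · simp [jump, h]
  have hcamp := integral_exp_tsum_poissonSeq (sfiniteSeq (jumpIntensity ν)) hgm hhm
    (by rwa [sum_sfiniteSeq]) (fun p => by positivity) (re_jumpWeight_le hC hc ht n)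
    (by rwa [sum_sfiniteSeq])
  rw [sum_sfiniteSeq] at hcamp
  have hIoc (k : ℕ) : Ioc (t k : ℝ) (t (k + 1)) ∩ Ioi 0 = Ioc (t k : ℝ) (t (k + 1)) :=
    inter_eq_left.2 fun x hx => lt_of_le_of_lt (t k).2 hx.1
  have hterm (k : ℕ) := integral_indicator_mul_jumpIntensity (ν := ν)
    (S := Ioc (t k : ℝ) (t (k + 1))) measurableSet_Ioc (by rw [hIoc]; simp) (hexpc k)
  have hval : ∫ p, (Complex.exp (jumpWeight c t n p) - 1) ∂(jumpIntensity ν) =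
      ∑ k ∈ Finset.range n, ((t (k + 1) : ℂ) - t k) * ∫ x, (Complex.exp (c k * x) - 1) ∂ν := by
    simp_rw [exp_jumpWeight_sub_one c ht]
    rw [integral_finsetSum _ fun k _ => (hterm k).1]
    refine Finset.sum_congr rfl fun k _ => ?_
    rw [(hterm k).2, hIoc, Real.volume_real_Ioc_of_le (by exact_mod_cast ht k.le_succ)]
    push_cast
    congr 1
    refine integral_congr_ae ?_
    filter_upwards [hae] with x hx
    rw [hx]
  have hcongr : (fun ω => Complex.exp (∑ k ∈ Finset.range n,
      c k * ((jumpPath a (t (k + 1)) ω : ℂ) - (jumpPath a (t k) ω : ℂ)))) =ᵐ[jumpLaw ν]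
      fun ω => Complex.exp (∑ k ∈ Finset.range n, c k * (a * ((t (k + 1) : ℂ) - t k))) *
        Complex.exp (∑' i, (ω i).sum (jumpWeight c t n)) := by
    filter_upwards [ae_summable_jump hν] with ω hω
    rw [sum_jumpPath hω, Complex.exp_add]
  refine ⟨(hcamp.1.const_mul _).congr hcongr.symm, ?_⟩
  rw [integral_congr_ae hcongr, integral_const_mul, hcamp.2, hval, ← Complex.exp_add,
    ← Finset.sum_add_distrib]
  congr 1
  exact Finset.sum_congr rfl fun k _ => by ring

end Subordinator

/-! ### Processes with prescribed characteristic functions of the increments -/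

section Increments

variable {Ω : Type*} [MeasurableSpace Ω] {P : Measure Ω} [IsProbabilityMeasure P]

/-- The product form of the joint characteristic function yields independence and the marginal laws
at once. -/
lemma map_eq_pi_of_integral_exp {n : ℕ} {V : Fin n → Ω → ℝ} (hV : ∀ k, AEMeasurable (V k) P)
    (μ : Fin n → Measure ℝ) [∀ k, IsProbabilityMeasure (μ k)]
    (h : ∀ θ : Fin n → ℝ, ∫ ω, Complex.exp (∑ k, Complex.I * θ k * V k ω) ∂P =
      ∏ k, charFun (μ k) (θ k)) :
    P.map (fun ω k => V k ω) = Measure.pi μ := by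
  have hm : AEMeasurable (fun ω k => V k ω) P := aemeasurable_pi_lambda _ hV
  have := Measure.isProbabilityMeasure_map (μ := P) hm
  rw [← charFun_eq_pi_iff]
  intro t
  rw [← h, charFun_apply, integral_map (by fun_prop) (by fun_prop), integral_map hm (by fun_prop)]
  refine integral_congr_ae (ae_of_all _ fun ω => ?_)
  simp only [PiLp.inner_apply]
  congr 1
  push_cast
  rw [Finset.sum_mul]
  refine Finset.sum_congr rfl fun k _ => ?_
  simp
  ring

/-- The increments of `X` have the characteristic exponent `κ` and are independent, in terms of
the joint characteristic functions. -/
def HasIncrementExponent (X : ℝ≥0 → Ω → ℝ) (P : Measure Ω) (κ : ℝ → ℂ) : Prop :=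
  ∀ (n : ℕ) (t : ℕ → ℝ≥0), Monotone t → ∀ θ : ℕ → ℝ,
    ∫ ω, Complex.exp (∑ k ∈ Finset.range n,
      Complex.I * θ k * ((X (t (k + 1)) ω : ℂ) - (X (t k) ω : ℂ))) ∂P =
    ∏ k ∈ Finset.range n, Complex.exp (-(((t (k + 1) : ℂ) - t k) * κ (θ k)))

variable {X : ℝ≥0 → Ω → ℝ} {κ : ℝ → ℂ}

omit [IsProbabilityMeasure P] in
lemma aemeasurable_increment (hX : ∀ t, AEMeasurable (X t) P) (s t : ℝ≥0) :
    AEMeasurable (fun ω => X t ω - X s ω) P := (hX t).sub (hX s)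

omit [IsProbabilityMeasure P] in
lemma HasIncrementExponent.charFun_sub (h : HasIncrementExponent X P κ)
    (hX : ∀ t, AEMeasurable (X t) P) {s t : ℝ≥0} (hst : s ≤ t) (θ : ℝ) :
    charFun (P.map fun ω => X t ω - X s ω) θ = Complex.exp (-(((t : ℂ) - s) * κ θ)) := by
  have := h 1 (fun k => if k = 0 then s else t) (monotone_nat_of_le_succ fun k => by
    by_cases hk : k = 0 <;> simp [hk, hst]) fun _ => θ
  simp only [Finset.range_one, Finset.sum_singleton, Finset.prod_singleton, zero_add, one_ne_zero,
    if_false, if_true] at this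
  rw [← this, charFun_apply, integral_map (aemeasurable_increment hX s t) (by fun_prop)]
  refine integral_congr_ae (ae_of_all _ fun ω => ?_)
  simp only [RCLike.inner_apply, conj_trivial]
  push_cast
  ring_nf

lemma HasIncrementExponent.map_eq_pi (h : HasIncrementExponent X P κ)
    (hX : ∀ t, AEMeasurable (X t) P) {n : ℕ} {t : ℕ → ℝ≥0} (ht : Monotone t)
    (μ : Fin n → Measure ℝ) [∀ k, IsProbabilityMeasure (μ k)]
    (hμ : ∀ (k : Fin n) (θ : ℝ), charFun (μ k) θ =
      Complex.exp (-(((t (k + 1) : ℂ) - t k) * κ θ))) :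
    P.map (fun ω (k : Fin n) => X (t (k + 1)) ω - X (t k) ω) = Measure.pi μ := by
  refine map_eq_pi_of_integral_exp (fun k => (hX _).sub (hX _)) μ fun θ => ?_
  simp_rw [hμ]
  have := h n t ht fun k => if hk : k < n then θ ⟨k, hk⟩ else 0
  simp only [Finset.sum_range, Finset.prod_range, Fin.is_lt, dite_true] at this
  simpa using this

lemma HasIncrementExponent.hasIndepIncrements (h : HasIncrementExponent X P κ)
    (hX : ∀ t, AEMeasurable (X t) P) : HasIndepIncrements X P := by
  intro n t ht
  rw [iIndepFun_iff_map_fun_eq_pi_map fun k => aemeasurable_increment hX _ _]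
  -- The finite chain of times is continued by its last value to a monotone sequence on `ℕ`.
  let t' : ℕ → ℝ≥0 := fun k => t ⟨min n k, by omega⟩
  have ht' : Monotone t' := fun a b hab => ht (Fin.mk_le_mk.2 (by omega))
  have hcs (k : Fin n) : t' k = t k.castSucc := congrArg t (Fin.ext (by simp))
  have hs (k : Fin n) : t' (k + 1) = t k.succ := congrArg t (Fin.ext (by simp))
  have hprob (k : Fin n) : IsProbabilityMeasure
      (P.map fun ω => X (t k.succ) ω - X (t k.castSucc) ω) :=
    Measure.isProbabilityMeasure_map ((hX _).sub (hX _))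
  have := h.map_eq_pi hX ht' (fun k : Fin n => P.map fun ω => X (t k.succ) ω - X (t k.castSucc) ω)
    fun k θ => by
      rw [h.charFun_sub hX (ht (Fin.castSucc_lt_succ (i := k)).le), hcs, hs]
  simp_rw [hcs, hs] at this
  exact this

lemma HasIncrementExponent.identDistrib (h : HasIncrementExponent X P κ)
    (hX : ∀ t, AEMeasurable (X t) P) (h0 : ∀ᵐ ω ∂P, X 0 ω = 0) (s t : ℝ≥0) :
    IdentDistrib (fun ω => X (s + t) ω - X s ω) (X t) P P := by
  refine ⟨(hX _).sub (hX _), hX _, ?_⟩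
  have h1 : P.map (X t) = P.map fun ω => X t ω - X 0 ω := by
    refine Measure.map_congr ?_
    filter_upwards [h0] with ω hω
    simp [hω]
  have hp1 : IsProbabilityMeasure (P.map fun ω => X t ω - X 0 ω) :=
    Measure.isProbabilityMeasure_map ((hX _).sub (hX _))
  have hp2 : IsProbabilityMeasure (P.map fun ω => X (s + t) ω - X s ω) :=
    Measure.isProbabilityMeasure_map ((hX _).sub (hX _))
  rw [h1]
  refine Measure.ext_of_charFun (funext fun θ => ?_)
  rw [h.charFun_sub hX zero_le, h.charFun_sub hX le_self_add]
  congr 2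
  push_cast
  ring

end Increments

/-! ### Existence of subordinators -/

section Existence

/-- A single configuration has finitely many points, so its contribution is constant just to the
right of `t`. The sum over the configurations is dominated by its value at time `t + 1`. Left limits
come from monotonicity. -/
lemma cadlag_jumpPath {ω : ℕ → Config (ℝ × ℝ)} (hω : ∀ t, Summable fun n => (ω n).sum (jump t))
    (a t : ℝ≥0) :
    ContinuousWithinAt (fun s => (jumpPath a s ω : ℝ)) (Ioi t) t ∧
      ∃ l : ℝ, Tendsto (fun s => (jumpPath a s ω : ℝ)) (𝓝[<] t) (𝓝 l) := by
  have hmono : Monotone fun s => (jumpPath a s ω : ℝ) := by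
    intro s s' hs
    simp only [NNReal.coe_le_coe]
    unfold jumpPath
    gcongr
    · exact hω s
    · exact hω s'
    · exact Finset.sum_le_sum fun j _ => jump_mono _ hs
  have hstep (c : Config (ℝ × ℝ)) :
      Tendsto (fun s => ((c.sum (jump s) : ℝ≥0) : ℝ)) (𝓝[>] t) (𝓝 (c.sum (jump t) : ℝ≥0)) := by
    simp only [Config.sum, NNReal.coe_sum]
    refine tendsto_finsetSum _ fun j _ => ?_
    by_cases h : (c.2 j).1 ≤ t
    · refine tendsto_const_nhds.congr' ?_
      filter_upwards [self_mem_nhdsWithin] with s hs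
      have : (c.2 j).1 ≤ s := h.trans (by exact_mod_cast (le_of_lt hs))
      simp [jump, h, this]
    · refine tendsto_const_nhds.congr' ?_
      have hlt : ∀ᶠ s : ℝ≥0 in 𝓝 t, (s : ℝ) < (c.2 j).1 :=
        (NNReal.continuous_coe.tendsto t).eventually_lt_const (not_le.1 h)
      filter_upwards [nhdsWithin_le_nhds hlt] with s hs
      simp [jump, h, not_le.2 hs]
  constructor
  · unfold ContinuousWithinAt jumpPath
    simp only [NNReal.coe_add, NNReal.coe_mul, NNReal.coe_tsum]
    refine Tendsto.add ?_ ?_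
    · refine Tendsto.mono_left (Continuous.tendsto ?_ t) nhdsWithin_le_nhds
      fun_prop
    · have hs := NNReal.summable_coe.2 (hω (t + 1))
      refine tendsto_tsum_of_dominated_convergence hs (fun n => hstep (ω n)) ?_
      have hlt : ∀ᶠ s : ℝ≥0 in 𝓝 t, s < t + 1 := eventually_lt_nhds (by simp)
      filter_upwards [nhdsWithin_le_nhds hlt] with s hs n
      rw [Real.norm_of_nonneg (NNReal.coe_nonneg _), NNReal.coe_le_coe]
      exact Finset.sum_le_sum fun j _ => jump_mono _ hs.le
  · exact ⟨_, hmono.tendsto_nhdsLT t⟩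

variable {ν : Measure ℝ} [SFinite ν]

theorem integral_exp_jumpPath (hν0 : ν (Iic 0) = 0) (hν : Integrable (fun x => x) ν)
    (a : ℝ≥0) {C : ℝ} (hC : 0 ≤ C) (hνC : Integrable (fun x => Real.exp (C * x) - 1) ν)
    {c : ℂ} (hc : c.re ≤ C) (t : ℝ≥0) :
    Integrable (fun ω => Complex.exp (c * ((jumpPath a t ω : ℂ) - (jumpPath a 0 ω : ℂ))))
      (jumpLaw ν) ∧
    ∫ ω, Complex.exp (c * ((jumpPath a t ω : ℂ) - (jumpPath a 0 ω : ℂ))) ∂(jumpLaw ν) =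
      Complex.exp (t * (a * c + ∫ x, (Complex.exp (c * x) - 1) ∂ν)) := by
  simpa using integral_exp_sum_jumpPath hν0 hν a hC hνC (c := fun _ => c) (fun _ => hc)
    (t := fun k => if k = 0 then 0 else t) (monotone_nat_of_le_succ fun k => by
      by_cases hk : k = 0 <;> simp [hk]) 1

/-- A subordinator with drift `a` and Lévy measure `ν`, `∫ x ν(dx) < ∞`, and its exponential
moments. -/
theorem exists_subordinator (hν0 : ν (Iic 0) = 0) (hν : Integrable (fun x => x) ν) (a : ℝ≥0) :
    ∃ (Ω' : Type) (_ : MeasurableSpace Ω') (P' : Measure Ω') (Z : ℝ≥0 → Ω' → ℝ≥0),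
      IsProbabilityMeasure P' ∧ (∀ t, Measurable (Z t)) ∧ IsSubordinator Z P' ∧
      ∀ C : ℝ, 0 ≤ C → Integrable (fun x => Real.exp (C * x) - 1) ν → ∀ c : ℂ, c.re ≤ C →
        ∀ t : ℝ≥0, Integrable (fun ω => Complex.exp (c * (Z t ω : ℝ))) P' ∧
          ∫ ω, Complex.exp (c * (Z t ω : ℝ)) ∂P' =
            Complex.exp (t * (a * c + ∫ x, (Complex.exp (c * x) - 1) ∂ν)) := by
  have hm (t : ℝ≥0) : Measurable (jumpPath a t) := measurable_jumpPath a t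
  have hmr (t : ℝ≥0) : Measurable fun ω => (jumpPath a t ω : ℝ) := (hm t).coe_nnreal_real
  -- The intensity charges only strictly positive times, so almost surely no jump is recorded at
  -- time `0`.
  have hzero : ∀ᵐ ω ∂(jumpLaw ν), (jumpPath a 0 ω : ℝ) = 0 := by
    have h1 := lintegral_tsum_poissonSeq (sfiniteSeq (jumpIntensity ν))
      (measurable_jump 0).coe_nnreal_ennreal
    have h2 : ∫⁻ p, jump 0 p ∂(jumpIntensity ν) = 0 := by
      rw [lintegral_eq_zero_iff (measurable_jump 0).coe_nnreal_ennreal, Filter.EventuallyEq,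
        ae_iff]
      refine measure_mono_null (t := Iic 0 ×ˢ univ) (fun p hp => ?_) (by
        rw [jumpIntensity, Measure.prod_prod, Measure.restrict_apply measurableSet_Iic, inter_comm,
          Ioi_inter_Iic]
        simp)
      rw [mem_prod]
      refine ⟨?_, mem_univ _⟩
      by_contra h
      have h' : ¬ p.1 ≤ 0 := h
      simp [jump, h'] at hp
    have hmt : Measurable fun ω : ℕ → Config (ℝ × ℝ) =>
        ∑' n, (ω n).sum fun x => (jump 0 x : ℝ≥0∞) :=
      Measurable.tsum fun n => (Config.measurable_sum
        (measurable_jump 0).coe_nnreal_ennreal).comp (measurable_pi_apply n)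
    rw [sum_sfiniteSeq, h2, lintegral_eq_zero_iff hmt] at h1
    filter_upwards [h1, ae_summable_jump hν] with ω hω hs
    have h3 : ∀ n, (ω n).sum (jump 0) = 0 := fun n => by
      have := ENNReal.tsum_eq_zero.1 hω n
      simpa [Config.sum] using this
    simp [jumpPath, h3]
  have hinc : HasIncrementExponent (fun t ω => (jumpPath a t ω : ℝ)) (jumpLaw ν)
      fun θ => -(a * (Complex.I * θ) + ∫ x, (Complex.exp (Complex.I * θ * x) - 1) ∂ν) := by
    intro n t ht θ
    have := (integral_exp_sum_jumpPath hν0 hν a (C := 0) le_rfl (by simp)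
      (c := fun k => Complex.I * θ k) (fun k => by simp) ht n).2
    rw [this, Complex.exp_sum]
    exact Finset.prod_congr rfl fun k _ => by ring_nf
  refine ⟨_, _, jumpLaw ν, jumpPath a, inferInstance, hm, ⟨hmr, hzero,
    hinc.hasIndepIncrements fun t => (hmr t).aemeasurable,
    hinc.identDistrib (fun t => (hmr t).aemeasurable) hzero, ?_⟩, fun C hC hνC c hc t => ?_⟩
  · filter_upwards [ae_summable_jump hν] with ω hω t using cadlag_jumpPath hω a t
  · obtain ⟨h1, h2⟩ := integral_exp_jumpPath hν0 hν a hC hνC hc t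
    have hcongr : (fun ω => Complex.exp (c * ((jumpPath a t ω : ℂ) - (jumpPath a 0 ω : ℂ))))
        =ᵐ[jumpLaw ν] fun ω => Complex.exp (c * (jumpPath a t ω : ℝ)) := by
      filter_upwards [hzero] with ω hω
      rw [hω]; simp
    exact ⟨h1.congr hcongr, by rw [← h2, integral_congr_ae hcongr]⟩

end Existence

/-! ### Lévy measures with completely monotone densities -/

section LevyMeasure

lemma slDensity_zero_left (G : Measure ℝ) (x : ℝ) : slDensity 0 G x =
    (Ioi 0).indicator (fun x => ∫⁻ t, ENNReal.ofReal (Real.exp (-(t * x))) ∂G) x := by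
  by_cases h : 0 < x
  · simp [slDensity, h]
  · simp [slDensity, h]

lemma measurable_exp_neg_mul :
    Measurable fun p : ℝ × ℝ => ENNReal.ofReal (Real.exp (-(p.1 * p.2))) := by fun_prop

variable (G : Measure ℝ)

lemma measurable_slDensity_zero_left [SFinite G] : Measurable (slDensity 0 G) := by
  have h : slDensity 0 G = _ := funext (slDensity_zero_left G)
  rw [h]
  exact measurable_exp_neg_mul.lintegral_prod_left.indicator measurableSet_Ioi

/-- Writing the Lévy measure as the `x`-marginal of `e^{-tx} G(dt) dx` makes it s-finite and reduces
its integrals to Fubini's theorem. -/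
lemma slLevyMeasure_zero_left [SFinite G] :
    slLevyMeasure 0 G = ((G.prod (volume.restrict (Ioi 0))).withDensity
      fun p => ENNReal.ofReal (Real.exp (-(p.1 * p.2)))).map Prod.snd := by
  ext A hA
  have hA' : MeasurableSet (Prod.snd ⁻¹' A : Set (ℝ × ℝ)) := measurable_snd hA
  rw [Measure.map_apply measurable_snd hA, withDensity_apply _ hA', slLevyMeasure,
    withDensity_apply _ hA, ← lintegral_indicator hA', lintegral_prod_symm' _
    (measurable_exp_neg_mul.indicator hA'), ← lintegral_indicator hA,
    ← lintegral_indicator measurableSet_Ioi]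
  refine lintegral_congr fun x => ?_
  by_cases hx : x ∈ A <;> by_cases hx0 : x ∈ Ioi (0 : ℝ) <;>
    simp_all [slDensity_zero_left, indicator]

lemma slLevyMeasure_zero_left_Iic : slLevyMeasure 0 G (Iic 0) = 0 := by
  rw [slLevyMeasure, withDensity_apply _ measurableSet_Iic,
    setLIntegral_congr_fun (g := fun _ => 0) measurableSet_Iic fun x hx => by
      rw [slDensity_zero_left, indicator_of_notMem (by simpa using hx)]]
  simp

instance [SFinite G] : SFinite (slLevyMeasure 0 G) := by
  rw [slLevyMeasure_zero_left]; infer_instance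

variable {G} [SFinite G]

lemma integral_slLevyMeasure {f : ℝ → ℂ} (hfm : Measurable f)
    (hf : Integrable (fun p : ℝ × ℝ => f p.2 * Real.exp (-(p.1 * p.2)))
      (G.prod (volume.restrict (Ioi 0)))) :
    Integrable f (slLevyMeasure 0 G) ∧ ∫ x, f x ∂(slLevyMeasure 0 G) =
      ∫ t, (∫ x in Ioi 0, f x * Real.exp (-(t * x))) ∂G := by
  have hsmul (p : ℝ × ℝ) : (ENNReal.ofReal (Real.exp (-(p.1 * p.2)))).toReal • f p.2 =
      f p.2 * Real.exp (-(p.1 * p.2)) := by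
    rw [ENNReal.toReal_ofReal (Real.exp_pos _).le, Complex.real_smul, mul_comm]
  have hi : Integrable (fun p : ℝ × ℝ => f p.2) ((G.prod (volume.restrict (Ioi 0))).withDensity
      fun p => ENNReal.ofReal (Real.exp (-(p.1 * p.2)))) := by
    rw [integrable_withDensity_iff_integrable_smul' measurable_exp_neg_mul
      (ae_of_all _ fun _ => ENNReal.ofReal_lt_top)]
    simpa only [hsmul] using hf
  rw [slLevyMeasure_zero_left]
  constructor
  · rwa [integrable_map_measure hfm.aestronglyMeasurable measurable_snd.aemeasurable]
  · rw [integral_map measurable_snd.aemeasurable hfm.aestronglyMeasurable,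
      integral_withDensity_eq_integral_toReal_smul measurable_exp_neg_mul
      (ae_of_all _ fun _ => ENNReal.ofReal_lt_top)]
    simp only [hsmul]
    exact integral_prod _ hf

omit [SFinite G] in
-- Tonelli's theorem: it suffices to find a majorant of `f` whose Laplace transform `Λ` is explicit
-- and integrable against `G`.
lemma integrable_prod_of_laplace {f : ℝ → ℂ} {φ Λ : ℝ → ℝ} (hfm : Measurable f)
    (hfφ : ∀ x, 0 < x → ‖f x‖ ≤ φ x)
    (hφ : ∀ᵐ t ∂G, IntegrableOn (fun x => φ x * Real.exp (-(t * x))) (Ioi 0) ∧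
      ∫ x in Ioi 0, φ x * Real.exp (-(t * x)) = Λ t) (hΛ : Integrable Λ G) :
    Integrable (fun p : ℝ × ℝ => f p.2 * Real.exp (-(p.1 * p.2)))
      (G.prod (volume.restrict (Ioi 0))) := by
  have hm : Measurable fun p : ℝ × ℝ => f p.2 * Real.exp (-(p.1 * p.2)) :=
    (hfm.comp measurable_snd).mul (by fun_prop)
  have hle (t : ℝ) : ∀ᵐ x ∂(volume.restrict (Ioi (0 : ℝ))),
      ‖f x * Real.exp (-(t * x))‖ ≤ φ x * Real.exp (-(t * x)) := by
    refine (ae_restrict_iff' measurableSet_Ioi).2 (ae_of_all _ fun x hx => ?_)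
    rw [norm_mul, Complex.norm_real, Real.norm_of_nonneg (Real.exp_pos _).le]
    gcongr
    exact hfφ x hx
  rw [integrable_prod_iff hm.aestronglyMeasurable]
  constructor
  · filter_upwards [hφ] with t ht
    exact ht.1.mono' (hm.comp measurable_prodMk_left).aestronglyMeasurable (hle t)
  · refine hΛ.mono' hm.norm.stronglyMeasurable.integral_prod_right.aestronglyMeasurable ?_
    filter_upwards [hφ] with t ht
    rw [Real.norm_of_nonneg (integral_nonneg fun _ => norm_nonneg _), ← ht.2]
    exact integral_mono_of_nonneg (ae_of_all _ fun _ => norm_nonneg _) ht.1 (hle t)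

lemma laplace_exp {w : ℂ} {t : ℝ} (h : w.re < t) :
    IntegrableOn (fun x : ℝ => Complex.exp (w * x) * Real.exp (-(t * x))) (Ioi 0) ∧
      ∫ x : ℝ in Ioi 0, Complex.exp (w * x) * Real.exp (-(t * x)) = (t - w)⁻¹ := by
  have h1 (x : ℝ) : Complex.exp (w * x) * Real.exp (-(t * x)) = Complex.exp ((w - t) * x) := by
    push_cast
    rw [← Complex.exp_add]
    ring_nf
  simp_rw [h1]
  have hre : (w - t).re < 0 := by simpa using h
  refine ⟨integrableOn_exp_mul_complex_Ioi hre 0, ?_⟩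
  rw [integral_exp_mul_complex_Ioi hre]
  simp only [Complex.ofReal_zero, mul_zero, Complex.exp_zero]
  rw [← neg_sub (w : ℂ) t, inv_neg, neg_div, one_div]

lemma laplace_exp_real {b t : ℝ} (h : b < t) :
    IntegrableOn (fun x : ℝ => Real.exp (b * x) * Real.exp (-(t * x))) (Ioi 0) ∧
      ∫ x : ℝ in Ioi 0, Real.exp (b * x) * Real.exp (-(t * x)) = (t - b)⁻¹ := by
  obtain ⟨h1, h2⟩ := laplace_exp (w := b) (t := t) (by simpa using h)
  have hc (x : ℝ) : Complex.exp (b * x) * Real.exp (-(t * x)) =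
      ((Real.exp (b * x) * Real.exp (-(t * x)) : ℝ) : ℂ) := by push_cast; rfl
  simp_rw [hc] at h1 h2
  have h3 := h1.re
  simp only [RCLike.re_to_complex, Complex.ofReal_re] at h3
  refine ⟨h3, ?_⟩
  rw [integral_complex_ofReal] at h2
  exact_mod_cast h2

/-- The function `1 - e^{-x}` replaces `min(1, x)` in all majorants, because its Laplace transform
and that of its square are rational. -/
lemma half_le_one_sub_exp_neg {x : ℝ} (h0 : 0 ≤ x) (h1 : x ≤ 1) : x / 2 ≤ 1 - Real.exp (-x) := by
  have h2 : Real.exp (-x) ≤ (1 + x)⁻¹ := by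
    rw [Real.exp_neg]
    gcongr
    linarith [Real.add_one_le_exp x]
  have h3 : (1 + x)⁻¹ ≤ 1 - x / 2 := by
    rw [inv_le_iff_one_le_mul₀ (by linarith)]
    nlinarith
  linarith

lemma half_le_one_sub_exp_neg_of_one_le {x : ℝ} (h1 : 1 ≤ x) : 1 / 2 ≤ 1 - Real.exp (-x) := by
  have := half_le_one_sub_exp_neg zero_le_one le_rfl
  have h2 : Real.exp (-x) ≤ Real.exp (-1) := Real.exp_le_exp.2 (by linarith)
  linarith

/-- The integrand of the Lévy-Khintchine formula. -/
noncomputable def lkIntegrand (ξ x : ℝ) : ℂ :=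
  1 - Complex.exp (Complex.I * x * ξ) + (Ioo (-1 : ℝ) 1).indicator (fun x => Complex.I * x * ξ) x

lemma lkExponent_eq (σ2 b : ℝ) (F : Measure ℝ) (ξ : ℝ) : lkExponent σ2 b F ξ =
    (σ2 / 2 : ℝ) * (ξ : ℂ) ^ 2 - Complex.I * b * ξ + ∫ x, lkIntegrand ξ x ∂F := by
  unfold lkExponent lkIntegrand
  congr 2
  ext x
  congr 1
  by_cases h : x ∈ Ioo (-1 : ℝ) 1 <;> simp [h]

lemma measurable_lkIntegrand (ξ : ℝ) : Measurable (lkIntegrand ξ) :=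
  Measurable.add (by fun_prop) (Measurable.indicator (by fun_prop) measurableSet_Ioo)

/-- The comparison function has the Laplace transform `2 / (t (t+1) (t+2))`, which matches the
integrability of a Stieltjes-Lévy measure. For `x < 1` the second order Taylor remainder meets `x² ≤
4 (1 - e^{-x})²`; for `x ≥ 1` the trivial bound `2 = 8 · (1/2)²` is used. -/
lemma norm_lkIntegrand_le (ξ : ℝ) {x : ℝ} (hx : 0 < x) :
    ‖lkIntegrand ξ x‖ ≤ (4 * ξ ^ 2 * Real.exp |ξ| + 8) * (1 - Real.exp (-x)) ^ 2 := by
  have he : 0 < Real.exp |ξ| := Real.exp_pos _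
  rcases lt_or_ge x 1 with h1 | h1
  · have hmem : x ∈ Ioo (-1 : ℝ) 1 := ⟨by linarith, h1⟩
    have h2 := Complex.norm_exp_sub_sum_le_norm_mul_exp (Complex.I * x * ξ) 2
    have h3 : ‖Complex.I * x * ξ‖ = x * |ξ| := by
      simp [abs_of_pos hx]
    have h4 := half_le_one_sub_exp_neg hx.le h1.le
    have h5 : lkIntegrand ξ x = -(Complex.exp (Complex.I * x * ξ) -
        ∑ m ∈ Finset.range 2, (Complex.I * x * ξ) ^ m / m.factorial) := by
      simp [lkIntegrand, hmem, Finset.sum_range_succ]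
      ring
    rw [h5, norm_neg]
    refine h2.trans ?_
    rw [h3]
    calc (x * |ξ|) ^ 2 * Real.exp (x * |ξ|) ≤ (x * |ξ|) ^ 2 * Real.exp |ξ| := by
          gcongr
          nlinarith [abs_nonneg ξ]
      _ = 4 * ξ ^ 2 * Real.exp |ξ| * (x / 2) ^ 2 := by rw [mul_pow, sq_abs]; ring
      _ ≤ (4 * ξ ^ 2 * Real.exp |ξ| + 8) * (1 - Real.exp (-x)) ^ 2 := by
          gcongr
          linarith
  · have hmem : x ∉ Ioo (-1 : ℝ) 1 := fun h => by linarith [h.2]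
    have h4 := half_le_one_sub_exp_neg_of_one_le h1
    have h6 : ‖Complex.exp (Complex.I * x * ξ)‖ = 1 := by
      rw [Complex.norm_exp]; simp
    calc ‖lkIntegrand ξ x‖ = ‖1 - Complex.exp (Complex.I * x * ξ)‖ := by
          simp [lkIntegrand, hmem]
      _ ≤ ‖(1 : ℂ)‖ + ‖Complex.exp (Complex.I * x * ξ)‖ := norm_sub_le _ _
      _ = 8 * (1 / 2 : ℝ) ^ 2 := by rw [h6]; norm_num
      _ ≤ (4 * ξ ^ 2 * Real.exp |ξ| + 8) * (1 - Real.exp (-x)) ^ 2 := by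
          gcongr
          have : 0 ≤ 4 * ξ ^ 2 * Real.exp |ξ| := by positivity
          linarith

lemma slLevyMeasure_eq_add (Gm Gp : Measure ℝ) [SFinite Gm] [SFinite Gp] :
    slLevyMeasure Gm Gp = slLevyMeasure 0 Gp + (slLevyMeasure 0 Gm).map Neg.neg := by
  have h1 : slDensity Gm Gp = slDensity 0 Gp + fun x => slDensity 0 Gm (-x) := by
    ext x
    rcases lt_trichotomy x 0 with h | h | h
    · simp [slDensity, h, not_lt.2 h.le]
    · simp [slDensity, h]
    · simp [slDensity, h, not_lt.2 h.le]
  have h2 : (slLevyMeasure 0 Gm).map Neg.neg = volume.withDensity fun x => slDensity 0 Gm (-x) := by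
    ext A hA
    rw [Measure.map_apply measurable_neg hA, slLevyMeasure,
      withDensity_apply _ (measurable_neg hA), withDensity_apply _ hA,
      ← (Measure.measurePreserving_neg (volume : Measure ℝ)).setLIntegral_comp_preimage
        (s := Neg.neg ⁻¹' A) (measurable_neg hA) (measurable_slDensity_zero_left Gm)]
    simp
  rw [h2, slLevyMeasure, slLevyMeasure, h1,
    withDensity_add_left (measurable_slDensity_zero_left Gp)]

lemma lkIntegrand_neg (ξ x : ℝ) : lkIntegrand ξ (-x) = lkIntegrand (-ξ) x := by
  unfold lkIntegrand
  by_cases h : x ∈ Ioo (-1 : ℝ) 1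
  · have h' : -x ∈ Ioo (-1 : ℝ) 1 := ⟨by linarith [h.2], by linarith [h.1]⟩
    simp [h, h']
  · have h' : -x ∉ Ioo (-1 : ℝ) 1 := fun h' => h ⟨by linarith [h'.2], by linarith [h'.1]⟩
    simp [h, h']

end LevyMeasure

/-! ### Stieltjes-Lévy measures and their characteristic exponents -/

section SLM

variable {μ : ℝ} {G : Measure ℝ}

lemma IsSLM.ae_pos (h : IsSLM μ G) : ∀ᵐ t ∂G, 0 < t ∧ μ ≤ t := by
  filter_upwards [measure_eq_zero_iff_ae_notMem.1 h.pos, measure_eq_zero_iff_ae_notMem.1 h.supp]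
    with t h1 h2
  exact ⟨not_le.1 h1, not_lt.1 h2⟩

/-- Since `a₂ t² + a₁ t ≤ (a₂ + a₁) t (1 + t)`, this weight works whatever the coefficients are. -/
lemma IsSLM.integrable (h : IsSLM μ G) : Integrable (fun t => (t * (1 + t) ^ 2)⁻¹) G := by
  obtain ⟨a₂, a₁, h2, h1, h12, hsm⟩ := h.sm
  have hfin := hsm.finite
  rw [lintegral_withDensity_eq_lintegral_mul _ (by fun_prop) (by fun_prop)] at hfin
  refine ⟨Measurable.aestronglyMeasurable (by fun_prop), ?_⟩
  have hle : ∫⁻ t, ‖(t * (1 + t) ^ 2)⁻¹‖ₑ ∂G ≤ ∫⁻ t, ENNReal.ofReal (a₂ + a₁) *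
      (((fun t => ENNReal.ofReal ((a₂ * t ^ 2 + a₁ * t)⁻¹)) *
        fun t => ENNReal.ofReal ((1 + t)⁻¹)) t) ∂G := by
    refine lintegral_mono_ae ?_
    filter_upwards [h.ae_pos] with t ht
    have ht0 := ht.1
    have hden : 0 < a₂ * t ^ 2 + a₁ * t := by
      rcases h2.eq_or_lt with h | h
      · have : 0 < a₁ := by linarith
        rw [← h]; positivity
      · positivity
    rw [Pi.mul_apply, ← ENNReal.ofReal_mul (by positivity), ← ENNReal.ofReal_mul (by positivity),
      Real.enorm_eq_ofReal (by positivity)]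
    refine ENNReal.ofReal_le_ofReal ?_
    rw [← mul_inv, ← div_eq_mul_inv, le_div_iff₀ (by positivity), inv_mul_le_iff₀ (by positivity)]
    have : (a₂ * t ^ 2 + a₁ * t) ≤ t * (1 + t) * (a₂ + a₁) := by nlinarith
    nlinarith
  refine hle.trans_lt ?_
  rw [lintegral_const_mul _ (by fun_prop)]
  exact ENNReal.mul_lt_top ENNReal.ofReal_lt_top hfin

/-- The measure has the finite density `1/f` with respect to the finite measure `f G`. -/
lemma sigmaFinite_of_integrable_of_pos {α : Type*} [MeasurableSpace α] {G : Measure α} {f : α → ℝ}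
    (hfm : Measurable f) (hf : Integrable f G) (hpos : ∀ᵐ t ∂G, 0 < f t) : SigmaFinite G := by
  have hm : Measurable fun t => ENNReal.ofReal (f t) := hfm.ennreal_ofReal
  have hfin : IsFiniteMeasure (G.withDensity fun t => ENNReal.ofReal (f t)) :=
    isFiniteMeasure_withDensity_ofReal hf.2
  have hne : ∀ᵐ t ∂G, ENNReal.ofReal (f t) ≠ 0 := by
    filter_upwards [hpos] with t ht
    simpa using ht
  rw [← withDensity_inv_same hm hne (ae_of_all _ fun _ => ENNReal.ofReal_ne_top)]
  refine SigmaFinite.withDensity_of_ne_top ?_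
  rw [ae_withDensity_iff hm]
  exact ae_of_all _ fun t ht => by simpa using ht

lemma IsSLM.sigmaFinite (h : IsSLM μ G) : SigmaFinite G := by
  refine sigmaFinite_of_integrable_of_pos (by fun_prop) h.integrable ?_
  filter_upwards [h.ae_pos] with t ht
  have := ht.1
  positivity

/-- The Laplace transform of the truncation function `x 1_{(0,1)}(x)`. -/
noncomputable def truncLaplace (t : ℝ) : ℝ :=
  ∫ x in Ioi 0, (Ioo (-1 : ℝ) 1).indicator (fun x => x) x * Real.exp (-(t * x))

lemma integrable_indicator_mul_exp (t : ℝ) : IntegrableOn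
    (fun x => (Ioo (-1 : ℝ) 1).indicator (fun x => x) x * Real.exp (-(t * x))) (Ioi 0) := by
  have h1 : IntegrableOn (fun x => x * Real.exp (-(t * x))) (Ioo (-1 : ℝ) 1) :=
    (Continuous.integrableOn_Icc (by fun_prop)).mono_set Ioo_subset_Icc_self
  have h2 := (h1.integrable_indicator measurableSet_Ioo).integrableOn (s := Ioi 0)
  refine h2.congr (ae_of_all _ fun x => ?_)
  by_cases h : x ∈ Ioo (-1 : ℝ) 1 <;> simp [h]

lemma laplace_lkIntegrand (ξ : ℝ) {t : ℝ} (ht : 0 < t) :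
    ∫ x in Ioi 0, lkIntegrand ξ x * Real.exp (-(t * x)) =
      (t : ℂ)⁻¹ - (t - Complex.I * ξ)⁻¹ + Complex.I * ξ * truncLaplace t := by
  have h0 := laplace_exp (w := 0) (t := t) (by simpa using ht)
  have h1 := laplace_exp (w := Complex.I * ξ) (t := t) (by simpa using ht)
  have h2 : IntegrableOn (fun x => (((Ioo (-1 : ℝ) 1).indicator (fun x => x) x *
      Real.exp (-(t * x)) : ℝ) : ℂ)) (Ioi 0) := (integrable_indicator_mul_exp t).ofReal
  have h3 : ∫ x in Ioi 0, (((Ioo (-1 : ℝ) 1).indicator (fun x => x) x * Real.exp (-(t * x)) : ℝ) : ℂ)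
      = truncLaplace t := integral_complex_ofReal
  have hsplit (x : ℝ) : lkIntegrand ξ x * Real.exp (-(t * x)) =
      (Complex.exp (0 * x) * Real.exp (-(t * x)) -
        Complex.exp (Complex.I * ξ * x) * Real.exp (-(t * x))) + Complex.I * ξ *
        (((Ioo (-1 : ℝ) 1).indicator (fun x => x) x * Real.exp (-(t * x)) : ℝ) : ℂ) := by
    unfold lkIntegrand
    by_cases h : x ∈ Ioo (-1 : ℝ) 1 <;> simp [h] <;> ring_nf
  simp_rw [hsplit]
  have h01 : IntegrableOn (fun x : ℝ => Complex.exp (0 * x) * Real.exp (-(t * x)) -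
      Complex.exp (Complex.I * ξ * x) * Real.exp (-(t * x))) (Ioi 0) := h0.1.sub h1.1
  rw [integral_add h01 (h2.const_mul _), integral_sub h0.1 h1.1, h0.2, h1.2,
    integral_const_mul]
  rw [← h3]
  simp

/-- Only the combined kernel is claimed to be integrable against `G`: its three terms taken
separately need not be, and the cancellation between them is already contained in the bound on
`lkIntegrand`. -/
lemma IsSLM.integrable_lkIntegrand (h : IsSLM μ G) (ξ : ℝ) :
    Integrable (lkIntegrand ξ) (slLevyMeasure 0 G) ∧
    Integrable (fun t : ℝ => (t : ℂ)⁻¹ - (t - Complex.I * ξ)⁻¹ + Complex.I * ξ * truncLaplace t) G ∧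
      ∫ x, lkIntegrand ξ x ∂(slLevyMeasure 0 G) =
        ∫ t : ℝ, ((t : ℂ)⁻¹ - (t - Complex.I * ξ)⁻¹ + Complex.I * ξ * truncLaplace t) ∂G := by
  have := h.sigmaFinite
  set C : ℝ := 4 * ξ ^ 2 * Real.exp |ξ| + 8
  have hint : Integrable (fun p : ℝ × ℝ => lkIntegrand ξ p.2 * Real.exp (-(p.1 * p.2)))
      (G.prod (volume.restrict (Ioi 0))) := by
    refine integrable_prod_of_laplace (φ := fun x => C * (1 - Real.exp (-x)) ^ 2)
      (Λ := fun t => C * ((t - 0)⁻¹ - 2 * (t - -1)⁻¹ + (t - -2)⁻¹)) (measurable_lkIntegrand ξ)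
      (fun x hx => norm_lkIntegrand_le ξ hx) ?_ ?_
    · filter_upwards [h.ae_pos] with t ht
      have h0 := laplace_exp_real (b := 0) (t := t) ht.1
      have h1 := laplace_exp_real (b := -1) (t := t) (by linarith [ht.1])
      have h2 := laplace_exp_real (b := -2) (t := t) (by linarith [ht.1])
      have hs (x : ℝ) : C * (1 - Real.exp (-x)) ^ 2 * Real.exp (-(t * x)) =
          C * (Real.exp (0 * x) * Real.exp (-(t * x)) -
          2 * (Real.exp (-1 * x) * Real.exp (-(t * x))) +
          Real.exp (-2 * x) * Real.exp (-(t * x))) := by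
        have : Real.exp (-2 * x) = Real.exp (-x) ^ 2 := by
          rw [← Real.exp_nat_mul]; push_cast; ring_nf
        rw [this, zero_mul, Real.exp_zero, neg_one_mul]
        ring
      simp_rw [hs]
      have h01 : IntegrableOn (fun x => Real.exp (0 * x) * Real.exp (-(t * x)) -
          2 * (Real.exp (-1 * x) * Real.exp (-(t * x)))) (Ioi 0) := h0.1.sub (h1.1.const_mul 2)
      refine ⟨(h01.add h2.1).const_mul C, ?_⟩
      rw [integral_const_mul, integral_add h01 h2.1,
        integral_sub h0.1 (h1.1.const_mul 2), integral_const_mul, h0.2, h1.2, h2.2]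
    · refine Integrable.const_mul ?_ C
      refine (h.integrable.const_mul 2).mono' (Measurable.aestronglyMeasurable (by fun_prop)) ?_
      filter_upwards [h.ae_pos] with t ht
      have ht0 := ht.1
      have h3 : (t - 0)⁻¹ - 2 * (t - -1)⁻¹ + (t - -2)⁻¹ = 2 * (t * (1 + t) * (2 + t))⁻¹ := by
        simp only [sub_zero, sub_neg_eq_add]
        field_simp
        ring
      rw [h3, Real.norm_of_nonneg (by positivity)]
      refine mul_le_mul_of_nonneg_left (inv_anti₀ (by positivity) ?_) zero_le_two
      nlinarith [mul_pos ht0 (by linarith : 0 < 1 + t)]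
  obtain ⟨h1, h2⟩ := integral_slLevyMeasure (measurable_lkIntegrand ξ) hint
  have hcongr : (fun t : ℝ => ∫ x in Ioi 0, lkIntegrand ξ x * Real.exp (-(t * x))) =ᵐ[G]
      fun t : ℝ => (t : ℂ)⁻¹ - (t - Complex.I * ξ)⁻¹ + Complex.I * ξ * truncLaplace t := by
    filter_upwards [h.ae_pos] with t ht using laplace_lkIntegrand ξ ht.1
  refine ⟨h1, ?_, by rw [h2, integral_congr_ae hcongr]⟩
  exact hint.integral_prod_left.congr hcongr

/-- Measures on `[m, ∞)`, `m > 0`, with `∫ s⁻³ G(ds) < ∞`. -/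
structure IsTail (m : ℝ) (G : Measure ℝ) : Prop where
  pos : 0 < m
  ae_ge : ∀ᵐ s ∂G, m ≤ s
  integrable : Integrable (fun s => (s ^ 3)⁻¹) G

/-- The transform `ξ ↦ ∫ s⁻² (s - iξ)⁻¹ G(ds)`. -/
noncomputable def cubicTransform (G : Measure ℝ) (ξ : ℂ) : ℂ :=
  ∫ s : ℝ, ((s : ℂ) ^ 2 * (s - Complex.I * ξ))⁻¹ ∂G

/-- The shifted support stays away from `0`, and there `t (1+t)²` is at most a multiple of `s³` for
`s = t - β`. The constant `K` comes from `1 + t = s + (1 + β)` and `s ≥ μ - β`. -/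
lemma IsSLM.isTail (h : IsSLM μ G) {β : ℝ} (hβ : β < μ) :
    IsTail (μ - β) (G.map fun t => t - β) := by
  refine ⟨by linarith, ?_, ?_⟩
  · rw [ae_map_iff (by fun_prop) measurableSet_Ici]
    filter_upwards [h.ae_pos] with t ht
    simpa using ht.2
  · rw [integrable_map_measure (Measurable.aestronglyMeasurable (by fun_prop)) (by fun_prop)]
    set K : ℝ := 1 + (1 + |β|) / (μ - β)
    have hm : 0 < μ - β := by linarith
    refine (h.integrable.const_mul (K ^ 3)).mono' (Measurable.aestronglyMeasurable (by fun_prop)) ?_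
    filter_upwards [h.ae_pos] with t ht
    have ht0 := ht.1
    have hs : 0 < t - β := by linarith [ht.2]
    have hK : 1 + t ≤ K * (t - β) := by
      have h1 : 1 + |β| ≤ (1 + |β|) / (μ - β) * (t - β) := by
        rw [div_mul_eq_mul_div, le_div_iff₀ hm]
        gcongr
        exact ht.2
      have : K * (t - β) = (t - β) + (1 + |β|) / (μ - β) * (t - β) := by ring
      rw [this]
      linarith [le_abs_self β]
    have h0 : (0 : ℝ) ≤ K ^ 3 := by positivity
    rw [Function.comp_apply, Real.norm_of_nonneg (by positivity), ← div_eq_mul_inv, inv_eq_one_div,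
      div_le_div_iff₀ (by positivity) (by positivity), one_mul, ← mul_pow, mul_comm t]
    calc (1 + t) ^ 2 * t ≤ (1 + t) ^ 3 := by nlinarith [sq_nonneg (1 + t)]
      _ ≤ (K * (t - β)) ^ 3 := by gcongr

lemma IsTail.integrable_kernel {m : ℝ} (h : IsTail m G) {ξ : ℂ} {c : ℝ} (hc : 0 < c)
    (hξ : ∀ s : ℝ, m ≤ s → c * s ≤ ‖(s : ℂ) - Complex.I * ξ‖) :
    Integrable (fun s : ℝ => ((s : ℂ) ^ 2 * (s - Complex.I * ξ))⁻¹) G := by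
  refine (h.integrable.const_mul c⁻¹).mono' (Measurable.aestronglyMeasurable (by fun_prop)) ?_
  filter_upwards [h.ae_ge] with s hs
  have hs0 : 0 < s := h.pos.trans_le hs
  rw [← mul_inv, norm_inv, norm_mul, norm_pow, Complex.norm_real, Real.norm_of_nonneg hs0.le]
  refine inv_anti₀ (by positivity) ?_
  calc c * s ^ 3 = s ^ 2 * (c * s) := by ring
    _ ≤ s ^ 2 * ‖(s : ℂ) - Complex.I * ξ‖ := by gcongr; exact hξ s hs

/-- A locally uniform lower bound for `s - iξ` off the cut `-i [m, ∞)`. -/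
lemma exists_lower_bound {m : ℝ} (hm : 0 < m) {ξ₀ : ℂ} (hξ₀ : ξ₀.re ≠ 0 ∨ -m < ξ₀.im) :
    ∃ c δ : ℝ, 0 < c ∧ 0 < δ ∧ ∀ ξ ∈ Metric.ball ξ₀ δ, ∀ s : ℝ, m ≤ s →
      c * s ≤ ‖(s : ℂ) - Complex.I * ξ‖ := by
  -- With `u = 1/s` one has `s - iξ₀ = s (1 - iuξ₀)`, and `u` runs through the compact interval `[0,
  -- 1/m]`, where the factor has no zero.
  have hcont : ContinuousOn (fun u : ℝ => ‖1 - Complex.I * u * ξ₀‖) (Icc 0 m⁻¹) := by fun_prop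
  obtain ⟨u₀, hu₀, hmin⟩ := isCompact_Icc.exists_isMinOn
    (nonempty_Icc.2 (inv_pos.2 hm).le) hcont
  have hpos : 0 < ‖1 - Complex.I * u₀ * ξ₀‖ := by
    rw [norm_pos_iff]
    intro h0
    have hre := congrArg Complex.re h0
    have him := congrArg Complex.im h0
    simp at hre him
    rcases hξ₀ with h | h
    · rcases him with h' | h'
      · rw [h'] at hre; simp at hre
      · exact h h'
    · have h1 : u₀ * -ξ₀.im < u₀ * m ∨ u₀ = 0 := by
        rcases hu₀.1.eq_or_lt with h2 | h2
        · exact Or.inr h2.symm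
        · left; gcongr; linarith
      rcases h1 with h1 | h1
      · have h3 : u₀ * m ≤ 1 := by
          calc u₀ * m ≤ m⁻¹ * m := by gcongr; exact hu₀.2
            _ = 1 := inv_mul_cancel₀ hm.ne'
        linarith
      · rw [h1] at hre; simp at hre
  set c₀ := ‖1 - Complex.I * u₀ * ξ₀‖
  -- A displacement of `ξ₀` by less than `c₀ m / 2 ≤ c₀ s / 2` costs at most half of the bound `c₀
  -- s`.
  refine ⟨c₀ / 2, c₀ / 2 * m, by positivity, by positivity, fun ξ hξ s hs => ?_⟩
  have hs0 : 0 < s := hm.trans_le hs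
  have h1 : c₀ ≤ ‖1 - Complex.I * (s⁻¹ : ℝ) * ξ₀‖ :=
    hmin ⟨(inv_pos.2 hs0).le, by gcongr⟩
  have h2 : (s : ℂ) - Complex.I * ξ₀ = s * (1 - Complex.I * (s⁻¹ : ℝ) * ξ₀) := by
    have : (s : ℂ) ≠ 0 := by exact_mod_cast hs0.ne'
    push_cast
    field_simp
  have h3 : c₀ * s ≤ ‖(s : ℂ) - Complex.I * ξ₀‖ := by
    rw [h2, norm_mul, Complex.norm_real, Real.norm_of_nonneg hs0.le, mul_comm]
    gcongr
  have h4 : ‖(s : ℂ) - Complex.I * ξ₀‖ ≤ ‖(s : ℂ) - Complex.I * ξ‖ + ‖ξ - ξ₀‖ := by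
    have : (s : ℂ) - Complex.I * ξ₀ = (s - Complex.I * ξ) + Complex.I * (ξ - ξ₀) := by ring
    rw [this]
    refine (norm_add_le _ _).trans ?_
    simp
  have h5 : ‖ξ - ξ₀‖ < c₀ / 2 * m := by simpa [dist_eq_norm] using hξ
  have h6 : c₀ / 2 * m ≤ c₀ / 2 * s := by gcongr
  linarith

lemma IsTail.integrable_kernel_of_mem {m : ℝ} (h : IsTail m G) {ξ : ℂ}
    (hξ : ξ.re ≠ 0 ∨ -m < ξ.im) :
    Integrable (fun s : ℝ => ((s : ℂ) ^ 2 * (s - Complex.I * ξ))⁻¹) G := by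
  obtain ⟨c, δ, hc, hδ, hb⟩ := exists_lower_bound h.pos hξ
  exact h.integrable_kernel hc (hb ξ (Metric.mem_ball_self hδ))

lemma IsTail.differentiableAt {m : ℝ} (h : IsTail m G) {ξ₀ : ℂ} (hξ₀ : ξ₀.re ≠ 0 ∨ -m < ξ₀.im) :
    DifferentiableAt ℂ (cubicTransform G) ξ₀ := by
  obtain ⟨c, δ, hc, hδ, hb⟩ := exists_lower_bound h.pos hξ₀
  refine (hasDerivAt_integral_of_dominated_loc_of_deriv_le (μ := G)
    (F := fun (ξ : ℂ) (s : ℝ) => ((s : ℂ) ^ 2 * (s - Complex.I * ξ))⁻¹)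
    (F' := fun (ξ : ℂ) (s : ℝ) => Complex.I * ((s : ℂ) ^ 2 * (s - Complex.I * ξ) ^ 2)⁻¹)
    (bound := fun s => (c ^ 2 * m)⁻¹ * (s ^ 3)⁻¹) (Metric.ball_mem_nhds ξ₀ hδ)
    (Eventually.of_forall fun ξ => Measurable.aestronglyMeasurable (by fun_prop))
    (h.integrable_kernel hc (hb ξ₀ (Metric.mem_ball_self hδ)))
    (Measurable.aestronglyMeasurable (by fun_prop)) ?_ (h.integrable.const_mul _)
    ?_).2.differentiableAt
  · filter_upwards [h.ae_ge] with s hs ξ hξ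
    have hs0 : 0 < s := h.pos.trans_le hs
    have hm := h.pos
    have h1 := hb ξ hξ s hs
    rw [norm_mul, Complex.norm_I, one_mul, norm_inv, norm_mul, norm_pow, norm_pow,
      Complex.norm_real, Real.norm_of_nonneg hs0.le, ← mul_inv]
    refine inv_anti₀ (by positivity) ?_
    calc c ^ 2 * m * s ^ 3 ≤ c ^ 2 * s * s ^ 3 := by gcongr
      _ = s ^ 2 * (c * s) ^ 2 := by ring
      _ ≤ s ^ 2 * ‖(s : ℂ) - Complex.I * ξ‖ ^ 2 := by gcongr
  · filter_upwards [h.ae_ge] with s hs ξ hξ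
    have hs0 : 0 < s := h.pos.trans_le hs
    have h1 := hb ξ hξ s hs
    have hne : (s : ℂ) - Complex.I * ξ ≠ 0 := by
      rw [← norm_pos_iff]; exact lt_of_lt_of_le (by positivity) h1
    have hsne : (s : ℂ) ≠ 0 := by exact_mod_cast hs0.ne'
    have hd : HasDerivAt (fun ξ : ℂ => (s : ℂ) ^ 2 * (s - Complex.I * ξ))
        ((s : ℂ) ^ 2 * (-(Complex.I * 1))) ξ :=
      (((hasDerivAt_id ξ).const_mul Complex.I).const_sub (s : ℂ)).const_mul _
    refine (hd.inv (mul_ne_zero (pow_ne_zero 2 hsne) hne)).congr_deriv ?_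
    field_simp

/-- The exponent of a one-sided Stieltjes-Lévy measure in terms of the shifted measure. -/
theorem IsSLM.exists_integral_lkIntegrand (h : IsSLM μ G) {β : ℝ} (hβ : β < μ) :
    ∃ A B : ℝ, ∀ w : ℝ, (w ≠ 0 ∨ 0 < μ) → ∫ x, lkIntegrand w x ∂(slLevyMeasure 0 G) =
      Complex.I * w * A + B + (w + Complex.I * β) ^ 2 *
        cubicTransform (G.map fun t => t - β) (w + Complex.I * β) := by
  have htail := h.isTail hβ
  set k : ℝ → ℝ → ℂ := fun w t =>
    ((((t - β : ℝ) : ℂ)) ^ 2 * ((t - β : ℝ) - Complex.I * (w + Complex.I * β)))⁻¹ with hk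
  have hkm (w : ℝ) : Measurable fun s : ℝ => ((s : ℂ) ^ 2 * (s - Complex.I * (w + Complex.I * β)))⁻¹ := by
    fun_prop
  have hkint (w : ℝ) (hw : w ≠ 0 ∨ 0 < μ) : Integrable (k w) G := by
    have := htail.integrable_kernel_of_mem (ξ := w + Complex.I * β) (by
      rcases hw with hw | hw
      · left; simpa using hw
      · right; simp; linarith)
    rw [integrable_map_measure (hkm w).aestronglyMeasurable (by fun_prop)] at this
    exact this
  have hker (w : ℝ) : ∀ᵐ t : ℝ ∂G,
      (t : ℂ)⁻¹ - (t - Complex.I * w)⁻¹ + Complex.I * w * truncLaplace t =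
      Complex.I * w * ((truncLaplace t - ((t - β) ^ 2)⁻¹ : ℝ) : ℂ) +
        ((t⁻¹ - (t - β)⁻¹ + β * ((t - β) ^ 2)⁻¹ : ℝ) : ℂ) + (w + Complex.I * β) ^ 2 * k w t := by
    filter_upwards [h.ae_pos] with t ht
    have h1 : ((t : ℂ) - β) ≠ 0 := by
      have : t - β ≠ 0 := by linarith [ht.2]
      exact_mod_cast this
    have h2 : ((t : ℂ) - Complex.I * w) ≠ 0 := by
      intro h0
      have := congrArg Complex.re h0
      simp at this
      linarith [ht.1]
    have h3 : ((t : ℂ) - β - Complex.I * (w + Complex.I * β)) = t - Complex.I * w := by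
      linear_combination -β * Complex.I_sq
    have h4 : (w + Complex.I * β) ^ 2 = -(β - Complex.I * w) ^ 2 := by
      linear_combination (β ^ 2 + w ^ 2 : ℂ) * Complex.I_sq
    -- With `x = t - β` and `y = β - iw`, this is the expansion of `-1/(x + y)` to second order in
    -- `y`; the remainder is the kernel of `cubicTransform`.
    have h5 : -((t : ℂ) - Complex.I * w)⁻¹ = (β - Complex.I * w) * (((t : ℂ) - β) ^ 2)⁻¹ -
        ((t : ℂ) - β)⁻¹ - (β - Complex.I * w) ^ 2 *
          (((t : ℂ) - β) ^ 2 * ((t : ℂ) - Complex.I * w))⁻¹ := by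
      field_simp
      ring
    simp only [hk]
    push_cast
    rw [h3, h4]
    linear_combination h5
  set a : ℝ → ℝ := fun t => truncLaplace t - ((t - β) ^ 2)⁻¹ with ha
  set b : ℝ → ℝ := fun t => t⁻¹ - (t - β)⁻¹ + β * ((t - β) ^ 2)⁻¹ with hb
  -- At `w = 1` the first two terms combine to `i a + b`, and their sum is integrable as a
  -- difference of integrable functions. Since `a` and `b` are real, taking imaginary and real parts
  -- separates them.
  have hab : Integrable (fun t => Complex.I * (1 : ℝ) * (a t : ℂ) + (b t : ℂ)) G := by
    refine ((h.integrable_lkIntegrand 1).2.1.sub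
      ((hkint 1 (Or.inl one_ne_zero)).const_mul (((1 : ℝ) + Complex.I * β) ^ 2))).congr ?_
    filter_upwards [hker 1] with t ht
    simp only [Pi.sub_apply, ht]
    ring
  have hai : Integrable a G := by
    refine hab.im.congr (ae_of_all _ fun t => ?_)
    simp
  have hbi : Integrable b G := by
    refine hab.re.congr (ae_of_all _ fun t => ?_)
    simp
  refine ⟨∫ t, a t ∂G, ∫ t, b t ∂G, fun w hw => ?_⟩
  have h1 : Integrable (fun t => Complex.I * w * (a t : ℂ)) G := hai.ofReal.const_mul _
  have h2 : Integrable (fun t => (b t : ℂ)) G := hbi.ofReal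
  have h12 : Integrable (fun t => Complex.I * w * (a t : ℂ) + (b t : ℂ)) G := h1.add h2
  rw [(h.integrable_lkIntegrand w).2.2, integral_congr_ae (hker w),
    integral_add h12 ((hkint w hw).const_mul _), integral_add h1 h2, integral_const_mul,
    integral_const_mul, integral_complex_ofReal, integral_complex_ofReal, cubicTransform,
    integral_map (by fun_prop) (hkm w).aestronglyMeasurable]

end SLM

/-! ### Uniqueness of Stieltjes-type transforms -/

section Uniqueness

lemma integrable_of_ae_bounded {N : Measure ℝ} [IsFiniteMeasure N] {f : ℝ → ℝ} (hf : Measurable f)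
    {K : ℝ} (h : ∀ᵐ v ∂N, ‖f v‖ ≤ K) : Integrable f N :=
  (integrable_const K).mono' hf.aestronglyMeasurable h

/-- A finite measure on a bounded interval is determined by its moments. -/
lemma eq_of_moments_eq {N₁ N₂ : Measure ℝ} [IsFiniteMeasure N₁] [IsFiniteMeasure N₂] {M : ℝ}
    (h1 : ∀ᵐ v ∂N₁, |v| ≤ M) (h2 : ∀ᵐ v ∂N₂, |v| ≤ M)
    (h : ∀ k : ℕ, ∫ v, v ^ k ∂N₁ = ∫ v, v ^ k ∂N₂) : N₁ = N₂ := by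
  -- On a bounded interval the exponential series may be integrated term by term, so the
  -- characteristic function is a power series in the moments.
  have key (N : Measure ℝ) [IsFiniteMeasure N] (hN : ∀ᵐ v ∂N, |v| ≤ M) (t : ℝ) :
      charFun N t = ∑' k : ℕ, (t * Complex.I) ^ k / k.factorial * ((∫ v, v ^ k ∂N : ℝ) : ℂ) := by
    have hint (k : ℕ) : Integrable (fun v : ℝ => (t * Complex.I) ^ k / k.factorial * ((v ^ k : ℝ) : ℂ))
        N := by
      have h0 : Integrable (fun v : ℝ => v ^ k) N := by
        refine integrable_of_ae_bounded (K := M ^ k) (by fun_prop) ?_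
        filter_upwards [hN] with v hv
        rw [norm_pow, Real.norm_eq_abs]
        gcongr
      exact h0.ofReal.const_mul _
    have hs : Summable fun k : ℕ =>
        ∫ v : ℝ, ‖(t * Complex.I) ^ k / k.factorial * ((v ^ k : ℝ) : ℂ)‖ ∂N := by
      refine Summable.of_nonneg_of_le (fun k => integral_nonneg fun _ => norm_nonneg _)
        (fun k => ?_) ((Real.summable_pow_div_factorial (|t| * M)).mul_right (N.real univ))
      have : ∫ v : ℝ, ‖(t * Complex.I) ^ k / k.factorial * ((v ^ k : ℝ) : ℂ)‖ ∂N ≤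
          ∫ _ : ℝ, (|t| * M) ^ k / k.factorial ∂N := by
        refine integral_mono_ae (hint k).norm (integrable_const _) ?_
        filter_upwards [hN] with v hv
        simp only [norm_mul, norm_div, norm_pow, Complex.norm_real, Complex.norm_I, mul_one,
          Real.norm_eq_abs, Complex.norm_natCast, mul_pow, one_pow, div_mul_eq_mul_div]
        gcongr
      refine this.trans_eq ?_
      rw [integral_const, smul_eq_mul, mul_comm]
    have h3 := (hasSum_integral_of_summable_integral_norm hint hs).tsum_eq
    rw [charFun_apply]
    have h4 (v : ℝ) : Complex.exp ((inner ℝ v t : ℝ) * Complex.I) =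
        ∑' k : ℕ, (t * Complex.I) ^ k / k.factorial * ((v ^ k : ℝ) : ℂ) := by
      rw [Complex.exp_eq_exp_ℂ, NormedSpace.exp_eq_tsum_div]
      refine tsum_congr fun k => ?_
      simp
      ring
    simp_rw [h4]
    rw [← h3]
    refine tsum_congr fun k => ?_
    rw [integral_const_mul, integral_complex_ofReal]
  refine Measure.ext_of_charFun (funext fun t => ?_)
  rw [key N₁ h1, key N₂ h2]
  simp_rw [h]

/-- The moments are recovered by induction. Letting `z → 0+` in `∫ v^k / (1 + vz)` gives the `k`-th
moment, and `v^(k+1) / (1 + vz) = (v^k - v^k / (1 + vz)) / z` gives the next transform. -/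
lemma eq_of_integral_inv_one_add_mul_eq {N₁ N₂ : Measure ℝ} [IsFiniteMeasure N₁]
    [IsFiniteMeasure N₂] {M : ℝ} (h1 : ∀ᵐ v ∂N₁, v ∈ Icc 0 M) (h2 : ∀ᵐ v ∂N₂, v ∈ Icc 0 M)
    (h : ∀ z : ℝ, 0 < z → ∫ v, (1 + v * z)⁻¹ ∂N₁ = ∫ v, (1 + v * z)⁻¹ ∂N₂) : N₁ = N₂ := by
  have hpow (N : Measure ℝ) [IsFiniteMeasure N] (hN : ∀ᵐ v ∂N, v ∈ Icc 0 M) (k : ℕ) :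
      Integrable (fun v => v ^ k) N := by
    refine integrable_of_ae_bounded (K := M ^ k) (by fun_prop) ?_
    filter_upwards [hN] with v hv
    rw [norm_pow, Real.norm_of_nonneg hv.1]
    exact pow_le_pow_left₀ hv.1 hv.2 k
  have hle {v z : ℝ} (hv : v ∈ Icc 0 M) (hz : 0 < z) (k : ℕ) : ‖v ^ k * (1 + v * z)⁻¹‖ ≤ v ^ k := by
    have h0 := hv.1
    rw [Real.norm_of_nonneg (by positivity)]
    refine mul_le_of_le_one_right (by positivity) (inv_le_one_of_one_le₀ ?_)
    have : 0 ≤ v * z := by positivity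
    linarith
  have hint (N : Measure ℝ) [IsFiniteMeasure N] (hN : ∀ᵐ v ∂N, v ∈ Icc 0 M) (k : ℕ) {z : ℝ}
      (hz : 0 < z) : Integrable (fun v => v ^ k * (1 + v * z)⁻¹) N := by
    refine (hpow N hN k).mono' (Measurable.aestronglyMeasurable (by fun_prop)) ?_
    filter_upwards [hN] with v hv using hle hv hz k
  have hlim (N : Measure ℝ) [IsFiniteMeasure N] (hN : ∀ᵐ v ∂N, v ∈ Icc 0 M) (k : ℕ) :
      Tendsto (fun z => ∫ v, v ^ k * (1 + v * z)⁻¹ ∂N) (𝓝[>] 0) (𝓝 (∫ v, v ^ k ∂N)) := by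
    refine tendsto_integral_filter_of_dominated_convergence (fun v => v ^ k)
      (Eventually.of_forall fun z => Measurable.aestronglyMeasurable (by fun_prop)) ?_
      (hpow N hN k) ?_
    · filter_upwards [self_mem_nhdsWithin] with z hz
      filter_upwards [hN] with v hv using hle hv hz k
    · refine ae_of_all _ fun v => ?_
      have : ContinuousAt (fun z : ℝ => v ^ k * (1 + v * z)⁻¹) 0 := by
        refine ContinuousAt.mul continuousAt_const (ContinuousAt.inv₀ (by fun_prop) (by simp))
      have h := this.tendsto
      simp only [mul_zero, add_zero, inv_one, mul_one] at h
      exact h.mono_left nhdsWithin_le_nhds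
  have hmom (k : ℕ) (hk : ∀ z : ℝ, 0 < z → ∫ v, v ^ k * (1 + v * z)⁻¹ ∂N₁ =
      ∫ v, v ^ k * (1 + v * z)⁻¹ ∂N₂) : ∫ v, v ^ k ∂N₁ = ∫ v, v ^ k ∂N₂ := by
    refine tendsto_nhds_unique (hlim N₁ h1 k) ((hlim N₂ h2 k).congr' ?_)
    filter_upwards [self_mem_nhdsWithin] with z hz using (hk z hz).symm
  have hrec (N : Measure ℝ) [IsFiniteMeasure N] (hN : ∀ᵐ v ∂N, v ∈ Icc 0 M) (k : ℕ) {z : ℝ}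
      (hz : 0 < z) : ∫ v, v ^ (k + 1) * (1 + v * z)⁻¹ ∂N =
        z⁻¹ * (∫ v, v ^ k ∂N - ∫ v, v ^ k * (1 + v * z)⁻¹ ∂N) := by
    rw [← integral_sub (hpow N hN k) (hint N hN k hz), ← integral_const_mul]
    refine integral_congr_ae ?_
    filter_upwards [hN] with v hv
    have h0 := hv.1
    have : 1 + v * z ≠ 0 := by positivity
    field_simp
    ring
  have hall (k : ℕ) : ∀ z : ℝ, 0 < z → ∫ v, v ^ k * (1 + v * z)⁻¹ ∂N₁ =
      ∫ v, v ^ k * (1 + v * z)⁻¹ ∂N₂ := by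
    induction k with
    | zero => simpa using h
    | succ k ih =>
      intro z hz
      rw [hrec N₁ h1 k hz, hrec N₂ h2 k hz, hmom k ih, ih z hz]
  have habs {v : ℝ} (hv : v ∈ Icc 0 M) : |v| ≤ M := by rw [abs_of_nonneg hv.1]; exact hv.2
  exact eq_of_moments_eq (h1.mono fun _ => habs) (h2.mono fun _ => habs) fun k => hmom k (hall k)

/-- The finite measure `v⁻²`-image of `s⁻⁴ G(ds)`. -/
noncomputable def invSqMeasure (G : Measure ℝ) : Measure ℝ :=
  (G.withDensity fun s => ENNReal.ofReal ((s ^ 4)⁻¹)).map fun s => (s ^ 2)⁻¹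

variable {m : ℝ} {G : Measure ℝ}

lemma IsTail.integrable_four (h : IsTail m G) : Integrable (fun s => (s ^ 4)⁻¹) G := by
  refine (h.integrable.const_mul m⁻¹).mono' (Measurable.aestronglyMeasurable (by fun_prop)) ?_
  filter_upwards [h.ae_ge] with s hs
  have hm := h.pos
  have hs0 : 0 < s := hm.trans_le hs
  rw [Real.norm_of_nonneg (by positivity), ← mul_inv]
  refine inv_anti₀ (by positivity) ?_
  calc m * s ^ 3 ≤ s * s ^ 3 := by gcongr
    _ = s ^ 4 := by ring

lemma IsTail.isFiniteMeasure_invSqMeasure (h : IsTail m G) : IsFiniteMeasure (invSqMeasure G) := by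
  have : IsFiniteMeasure (G.withDensity fun s => ENNReal.ofReal ((s ^ 4)⁻¹)) :=
    isFiniteMeasure_withDensity_ofReal h.integrable_four.2
  unfold invSqMeasure
  infer_instance

lemma IsTail.ae_invSqMeasure (h : IsTail m G) :
    ∀ᵐ v ∂(invSqMeasure G), v ∈ Icc 0 (m ^ 2)⁻¹ := by
  rw [invSqMeasure]
  refine (ae_map_iff (p := fun v => v ∈ Icc 0 (m ^ 2)⁻¹) (by fun_prop) measurableSet_Icc).2 ?_
  rw [ae_withDensity_iff (by fun_prop)]
  filter_upwards [h.ae_ge] with s hs _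
  have hm := h.pos
  exact ⟨by positivity, by gcongr⟩

lemma lintegral_invSqMeasure {f : ℝ → ℝ≥0∞} (hf : Measurable f) :
    ∫⁻ v, f v ∂(invSqMeasure G) = ∫⁻ s, ENNReal.ofReal ((s ^ 4)⁻¹) * f ((s ^ 2)⁻¹) ∂G := by
  rw [invSqMeasure, lintegral_map hf (by fun_prop), lintegral_withDensity_eq_lintegral_mul _
    (by fun_prop) (by fun_prop)]
  rfl

/-- The substitution `v = s⁻²` is undone by `v ↦ v^(-1/2)`, and the density `s⁻⁴ = v²` by `v⁻²`; so
the finite measure determines `G`. -/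
lemma IsTail.apply_eq (h : IsTail m G) {A : Set ℝ} (hA : MeasurableSet A) :
    G A = ∫⁻ v, A.indicator 1 (√v)⁻¹ * ENNReal.ofReal ((v ^ 2)⁻¹) ∂(invSqMeasure G) := by
  have hm : Measurable fun v : ℝ => A.indicator (1 : ℝ → ℝ≥0∞) (√v)⁻¹ :=
    (measurable_one.indicator hA).comp (by fun_prop)
  rw [lintegral_invSqMeasure (by fun_prop), ← lintegral_indicator_one hA]
  refine lintegral_congr_ae ?_
  filter_upwards [h.ae_ge] with s hs
  have hs0 : 0 < s := h.pos.trans_le hs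
  have h1 : (√((s ^ 2)⁻¹))⁻¹ = s := by
    rw [Real.sqrt_inv, inv_inv, Real.sqrt_sq hs0.le]
  rw [h1, mul_left_comm, ← ENNReal.ofReal_mul (by positivity)]
  have h2 : (s ^ 4)⁻¹ * (((s ^ 2)⁻¹) ^ 2)⁻¹ = 1 := by field_simp
  rw [h2]
  simp

lemma integral_invSqMeasure (h : IsTail m G) {z : ℝ} (hz : 0 < z) :
    ∫ v, (1 + v * z)⁻¹ ∂(invSqMeasure G) = ∫ s, (s ^ 2 * (s ^ 2 + z))⁻¹ ∂G := by
  rw [invSqMeasure, integral_map (by fun_prop) (Measurable.aestronglyMeasurable (by fun_prop)),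
    integral_withDensity_eq_integral_toReal_smul (by fun_prop)
      (ae_of_all _ fun _ => ENNReal.ofReal_lt_top)]
  refine integral_congr_ae ?_
  filter_upwards [h.ae_ge] with s hs
  have hs0 : 0 < s := h.pos.trans_le hs
  rw [ENNReal.toReal_ofReal (by positivity), smul_eq_mul]
  field_simp

/-- In the variable `v = s⁻²` the kernel is `s⁻⁴ / (1 + vz)`, which leads to finite measures on a
bounded interval. -/
theorem IsTail.eq_of_integral_eq {m' : ℝ} {G' : Measure ℝ} (h : IsTail m G) (h' : IsTail m' G')
    (heq : ∀ z : ℝ, 0 < z → ∫ s, (s ^ 2 * (s ^ 2 + z))⁻¹ ∂G = ∫ s, (s ^ 2 * (s ^ 2 + z))⁻¹ ∂G') :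
    G = G' := by
  have := h.isFiniteMeasure_invSqMeasure
  have := h'.isFiniteMeasure_invSqMeasure
  have hN : invSqMeasure G = invSqMeasure G' := by
    refine eq_of_integral_inv_one_add_mul_eq (M := max (m ^ 2)⁻¹ (m' ^ 2)⁻¹)
      (h.ae_invSqMeasure.mono fun v hv => ⟨hv.1, hv.2.trans (le_max_left _ _)⟩)
      (h'.ae_invSqMeasure.mono fun v hv => ⟨hv.1, hv.2.trans (le_max_right _ _)⟩) fun z hz => ?_
    rw [integral_invSqMeasure h hz, integral_invSqMeasure h' hz, heq z hz]
  ext A hA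
  rw [h.apply_eq hA, h'.apply_eq hA, hN]

end Uniqueness

/-! ### The analytic continuation of the characteristic exponent -/

section Continuation

variable {μm μp : ℝ}

lemma isOpen_cutPlane : IsOpen (cutPlane μm μp) := by
  have : cutPlane μm μp = {ξ | ξ.re ≠ 0} ∪ ({ξ | μm < ξ.im} ∩ {ξ | ξ.im < μp}) := rfl
  rw [this]
  exact (isOpen_ne_fun Complex.continuous_re continuous_const).union
    ((isOpen_lt continuous_const Complex.continuous_im).inter
      (isOpen_lt Complex.continuous_im continuous_const))

/-- The domain is star-shaped about the midpoint of the gap: a segment from there to a point off the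
imaginary axis leaves the axis at once, and a segment to a point of the gap stays in the gap. -/
lemma isPreconnected_cutPlane (h : μm < μp) : IsPreconnected (cutPlane μm μp) := by
  have hmem : Complex.I * ((μm + μp) / 2 : ℝ) ∈ cutPlane μm μp := by
    right
    constructor <;> simp <;> linarith
  have hstar : StarConvex ℝ (Complex.I * ((μm + μp) / 2 : ℝ)) (cutPlane μm μp) := by
    refine (starConvex_iff_forall_pos hmem).2 ?_
    intro z hz a b ha hb hab
    rcases hz with hz | hz
    · left
      simp [hb.ne', hz]
    · right
      simp only [Complex.add_im, Complex.real_smul, Complex.mul_im, Complex.ofReal_re,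
        Complex.ofReal_im, Complex.I_re, Complex.I_im, zero_mul, one_mul, add_zero, zero_add,
        Complex.mul_re, mul_zero, sub_zero]
      constructor
      · have h1 : a * μm < a * ((μm + μp) / 2) := by gcongr; linarith
        have h2 : b * μm < b * z.im := by gcongr; exact hz.1
        have h3 : a * μm + b * μm = μm := by rw [← add_mul, hab, one_mul]
        linarith
      · have h1 : a * ((μm + μp) / 2) < a * μp := by gcongr; linarith
        have h2 : b * z.im < b * μp := by gcongr; exact hz.2
        have h3 : a * μp + b * μp = μp := by rw [← add_mul, hab, one_mul]
        linarith
  exact (hstar.isPathConnected hmem).isConnected.isPreconnected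

/-- The identity theorem, applied to real points accumulating at `1`. The origin cannot be used,
since it lies on a cut when `μ₋` or `μ₊` is `0`. -/
lemma analyticContinuation_eqOn (h : μm < μp) {f : ℝ → ℂ} {g : ℂ → ℂ}
    (hg : DifferentiableOn ℂ g (cutPlane μm μp))
    (hgf : ∀ x : ℝ, (x : ℂ) ∈ cutPlane μm μp → g x = f x) :
    EqOn (analyticContinuation (cutPlane μm μp) f) g (cutPlane μm μp) := by
  have hex : ∃ g : ℂ → ℂ, DifferentiableOn ℂ g (cutPlane μm μp) ∧
      ∀ x : ℝ, (x : ℂ) ∈ cutPlane μm μp → g x = f x := ⟨g, hg, hgf⟩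
  rw [analyticContinuation, dif_pos hex]
  have hspec := hex.choose_spec
  refine (hspec.1.analyticOnNhd isOpen_cutPlane).eqOn_of_preconnected_of_frequently_eq
    (hg.analyticOnNhd isOpen_cutPlane) (isPreconnected_cutPlane h) (z₀ := 1) (Or.inl (by simp)) ?_
  have hne {x : ℝ} (hx : 0 < x) : (x : ℂ) ∈ cutPlane μm μp := Or.inl (by simpa using hx.ne')
  have ht : Tendsto (fun x : ℝ => (x : ℂ)) (𝓝[>] 1) (𝓝[≠] 1) := by
    refine tendsto_nhdsWithin_of_tendsto_nhds_of_eventually_within _ ?_ ?_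
    · have := Complex.continuous_ofReal.tendsto 1
      rw [Complex.ofReal_one] at this
      exact this.mono_left nhdsWithin_le_nhds
    · filter_upwards [self_mem_nhdsWithin] with x hx
      have : x ≠ 1 := (ne_of_gt hx)
      simpa using this
  refine ht.frequently (Eventually.frequently ?_)
  filter_upwards [self_mem_nhdsWithin] with x hx
  have hx0 : 0 < x := zero_lt_one.trans hx
  rw [hspec.2 x (hne hx0), hgf x (hne hx0)]

variable {σ2 b β : ℝ} {Gm Gp : Measure ℝ}

/-- The midpoint of the gap is `-iβ`, so adding `iβ` makes the domain invariant under `ξ ↦ -ξ`. -/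
lemma mem_cutPlane_shift (hβ : β = -(μm + μp) / 2) {z : ℂ} (hz : z ∈ cutPlane μm μp) :
    ((z + Complex.I * β).re ≠ 0 ∨ -((μp - μm) / 2) < (z + Complex.I * β).im) ∧
      ((-(z + Complex.I * β)).re ≠ 0 ∨ -((μp - μm) / 2) < (-(z + Complex.I * β)).im) := by
  rcases hz with hz | hz
  · exact ⟨Or.inl (by simpa using hz), Or.inl (by simpa using hz)⟩
  · refine ⟨Or.inr ?_, Or.inr ?_⟩ <;> simp <;> linarith [hz.1, hz.2]

/-- The one-sided expansions about `-iβ` are added. The resulting formula is analytic on the whole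
domain and agrees with the Lévy-Khintchine exponent at its real points, so it is the continuation.
That `C` and `b'` are real is used later. -/
lemma exists_charExponent_eq (h : μm < μp) (hβ : β = -(μm + μp) / 2)
    (hm : IsSLM μp Gm) (hp : IsSLM (-μm) Gp) :
    ∃ C b' : ℝ, (∀ z ∈ cutPlane μm μp,
      charExponent μm μp σ2 b (slLevyMeasure Gm Gp) z = C + (σ2 / 2 : ℝ) * (z + Complex.I * β) ^ 2 -
        Complex.I * b' * (z + Complex.I * β) + (z + Complex.I * β) ^ 2 *
          (cubicTransform (Gp.map fun t => t - β) (z + Complex.I * β) +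
            cubicTransform (Gm.map fun t => t - -β) (-(z + Complex.I * β)))) ∧
      ∀ w : ℝ, (w : ℂ) ∈ cutPlane μm μp → charExponent μm μp σ2 b (slLevyMeasure Gm Gp) w =
        lkExponent σ2 b (slLevyMeasure Gm Gp) w := by
  obtain ⟨A₁, B₁, h1⟩ := hp.exists_integral_lkIntegrand (β := β) (by linarith)
  obtain ⟨A₂, B₂, h2⟩ := hm.exists_integral_lkIntegrand (β := -β) (by linarith)
  have hpt := hp.isTail (β := β) (by linarith)
  have hmt := hm.isTail (β := -β) (by linarith)
  have hme : -μm - β = (μp - μm) / 2 := by linarith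
  have hme' : μp - -β = (μp - μm) / 2 := by linarith
  rw [hme] at hpt
  rw [hme'] at hmt
  have := hp.sigmaFinite
  have := hm.sigmaFinite
  -- Both constants come from inserting `w = ξ - iβ` into `(σ²/2) w² - i (b - A₁ + A₂) w + B₁ + B₂`
  -- and collecting powers of `ξ`.
  set b' : ℝ := b - A₁ + A₂ + σ2 * β
  set C : ℝ := B₁ + B₂ - σ2 / 2 * β ^ 2 - (b - A₁ + A₂) * β
  set g : ℂ → ℂ := fun z => C + (σ2 / 2 : ℝ) * (z + Complex.I * β) ^ 2 -
        Complex.I * b' * (z + Complex.I * β) + (z + Complex.I * β) ^ 2 *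
          (cubicTransform (Gp.map fun t => t - β) (z + Complex.I * β) +
            cubicTransform (Gm.map fun t => t - -β) (-(z + Complex.I * β))) with hg
  have hgd : DifferentiableOn ℂ g (cutPlane μm μp) := by
    intro z hz
    obtain ⟨hz1, hz2⟩ := mem_cutPlane_shift hβ hz
    have d1 : DifferentiableAt ℂ (fun z => cubicTransform (Gp.map fun t => t - β)
        (z + Complex.I * β)) z :=
      DifferentiableAt.comp (g := cubicTransform _) (f := fun z => z + Complex.I * β) z
        (hpt.differentiableAt hz1) (by fun_prop)
    have d2 : DifferentiableAt ℂ (fun z => cubicTransform (Gm.map fun t => t - -β)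
        (-(z + Complex.I * β))) z :=
      DifferentiableAt.comp (g := cubicTransform _) (f := fun z => -(z + Complex.I * β)) z
        (hmt.differentiableAt hz2) (by fun_prop)
    have d3 : DifferentiableAt ℂ (fun z : ℂ => C + (σ2 / 2 : ℝ) * (z + Complex.I * β) ^ 2 -
        Complex.I * b' * (z + Complex.I * β)) z := by fun_prop
    have d4 : DifferentiableAt ℂ (fun z : ℂ => (z + Complex.I * β) ^ 2) z := by fun_prop
    exact (d3.add (d4.mul (d1.add d2))).differentiableWithinAt
  have hgf (w : ℝ) (hw : (w : ℂ) ∈ cutPlane μm μp) :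
      g w = lkExponent σ2 b (slLevyMeasure Gm Gp) w := by
    have hw1 : w ≠ 0 ∨ 0 < -μm := by
      rcases hw with hw | hw
      · left; simpa using hw
      · right; have := hw.1; simp at this; linarith
    have hw2 : -w ≠ 0 ∨ 0 < μp := by
      rcases hw with hw | hw
      · left; simpa using hw
      · right; simpa using hw.2
    have hneg : ∫ x, lkIntegrand w x ∂((slLevyMeasure 0 Gm).map Neg.neg) =
        ∫ x, lkIntegrand (-w) x ∂(slLevyMeasure 0 Gm) := by
      rw [integral_map measurable_neg.aemeasurable (measurable_lkIntegrand w).aestronglyMeasurable]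
      simp_rw [lkIntegrand_neg]
    have hint : Integrable (lkIntegrand w) ((slLevyMeasure 0 Gm).map Neg.neg) := by
      rw [integrable_map_measure (measurable_lkIntegrand w).aestronglyMeasurable
        measurable_neg.aemeasurable]
      have h5 : lkIntegrand w ∘ Neg.neg = lkIntegrand (-w) := funext fun x => lkIntegrand_neg w x
      rw [h5]
      exact (hm.integrable_lkIntegrand (-w)).1
    rw [lkExponent_eq, slLevyMeasure_eq_add, integral_add_measure (hp.integrable_lkIntegrand w).1
      hint, hneg, h1 w hw1, h2 (-w) hw2]
    have h6 : ((-w : ℝ) : ℂ) + Complex.I * ((-β : ℝ) : ℂ) = -(w + Complex.I * β) := by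
      push_cast; ring
    rw [h6]
    simp only [hg]
    push_cast [b', C]
    linear_combination (σ2 / 2 * β ^ 2 - σ2 * β ^ 2 - (b - A₁ + A₂ : ℂ) * β) * Complex.I_sq
  have heq := analyticContinuation_eqOn h hgd hgf
  exact ⟨C, b', fun z hz => heq hz, fun w hw => (heq hw).trans (hgf w hw)⟩

end Continuation

/-! ### The symmetric case -/

section Symmetric

variable {m : ℝ} {G : Measure ℝ}

/-- The transform `ξ ↦ ∫ 2 / (s (s² + ξ²)) G(ds)`. -/
noncomputable def evenTransform (G : Measure ℝ) (ξ : ℂ) : ℂ :=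
  ∫ s : ℝ, 2 * ((s : ℂ) * (s ^ 2 + ξ ^ 2))⁻¹ ∂G

lemma mem_shift_iff {μm μp β : ℝ} (hβ : β = -(μm + μp) / 2) {ξ : ℂ}
    (hξ : ξ - Complex.I * β ∈ cutPlane μm μp) :
    (ξ.re ≠ 0 ∨ -((μp - μm) / 2) < ξ.im) ∧ ((-ξ).re ≠ 0 ∨ -((μp - μm) / 2) < (-ξ).im) := by
  have := mem_cutPlane_shift hβ hξ
  rwa [sub_add_cancel] at this

lemma sub_I_mul_ne_zero {ξ : ℂ} (hξ : ξ.re ≠ 0 ∨ -m < ξ.im) {s : ℝ} (hs : m ≤ s) :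
    (s : ℂ) - Complex.I * ξ ≠ 0 := by
  intro h0
  have hre := congrArg Complex.re h0
  have him := congrArg Complex.im h0
  simp at hre him
  rcases hξ with h | h
  · exact h him
  · linarith

lemma IsTail.cubicTransform_add (h : IsTail m G) {ξ : ℂ} (h1 : ξ.re ≠ 0 ∨ -m < ξ.im)
    (h2 : (-ξ).re ≠ 0 ∨ -m < (-ξ).im) :
    Integrable (fun s : ℝ => 2 * ((s : ℂ) * (s ^ 2 + ξ ^ 2))⁻¹) G ∧
      cubicTransform G ξ + cubicTransform G (-ξ) = evenTransform G ξ := by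
  have i1 := h.integrable_kernel_of_mem h1
  have i2 := h.integrable_kernel_of_mem h2
  have heq : (fun s : ℝ => ((s : ℂ) ^ 2 * (s - Complex.I * ξ))⁻¹ +
      ((s : ℂ) ^ 2 * (s - Complex.I * -ξ))⁻¹) =ᵐ[G]
      fun s : ℝ => 2 * ((s : ℂ) * (s ^ 2 + ξ ^ 2))⁻¹ := by
    filter_upwards [h.ae_ge] with s hs
    have hs0 : (s : ℂ) ≠ 0 := by exact_mod_cast (h.pos.trans_le hs).ne'
    have n1 := sub_I_mul_ne_zero h1 hs
    have n2 := sub_I_mul_ne_zero h2 hs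
    have h3 : (s : ℂ) ^ 2 + ξ ^ 2 = (s - Complex.I * ξ) * (s - Complex.I * -ξ) := by
      linear_combination ξ ^ 2 * Complex.I_sq
    rw [h3]
    simp only [mul_neg, sub_neg_eq_add] at n2 ⊢
    field_simp
    ring
  refine ⟨(i1.add i2).congr heq, ?_⟩
  rw [evenTransform, ← integral_congr_ae heq, integral_add i1 i2]
  rfl

lemma IsTail.integrable_mul_add (h : IsTail m G) {z : ℝ} (hz : 0 < z) :
    Integrable (fun s => (s ^ 2 * (s ^ 2 + z))⁻¹) G ∧
      ‖∫ s, (s ^ 2 * (s ^ 2 + z))⁻¹ ∂G‖ ≤ ∫ s, (s ^ 4)⁻¹ ∂G := by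
  have hb : ∀ᵐ s ∂G, ‖(s ^ 2 * (s ^ 2 + z))⁻¹‖ ≤ (s ^ 4)⁻¹ := by
    filter_upwards [h.ae_ge] with s hs
    have hs0 : 0 < s := h.pos.trans_le hs
    rw [Real.norm_of_nonneg (by positivity)]
    refine inv_anti₀ (by positivity) ?_
    nlinarith [mul_pos (pow_pos hs0 2) hz]
  exact ⟨h.integrable_four.mono' (Measurable.aestronglyMeasurable (by fun_prop)) hb,
    norm_integral_le_of_norm_le h.integrable_four hb⟩

lemma IsTail.cubicTransform_sub (h : IsTail m G) {ξ : ℝ} (hξ : ξ ≠ 0) :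
    cubicTransform G ξ - cubicTransform G (-ξ) =
      2 * Complex.I * ξ * (∫ s, (s ^ 2 * (s ^ 2 + ξ ^ 2))⁻¹ ∂G : ℝ) := by
  have h1 : (ξ : ℂ).re ≠ 0 ∨ -m < (ξ : ℂ).im := Or.inl (by simpa using hξ)
  have h2 : (-(ξ : ℂ)).re ≠ 0 ∨ -m < (-(ξ : ℂ)).im := Or.inl (by simpa using hξ)
  have i1 := h.integrable_kernel_of_mem h1
  have i2 := h.integrable_kernel_of_mem h2
  rw [cubicTransform, cubicTransform, ← integral_sub i1 i2, ← integral_complex_ofReal,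
    ← integral_const_mul]
  refine integral_congr_ae ?_
  filter_upwards [h.ae_ge] with s hs
  have hs0 : (s : ℂ) ≠ 0 := by exact_mod_cast (h.pos.trans_le hs).ne'
  have n1 := sub_I_mul_ne_zero h1 hs
  have n2 := sub_I_mul_ne_zero h2 hs
  have h3 : (s : ℂ) ^ 2 + ξ ^ 2 = (s - Complex.I * ξ) * (s - Complex.I * -ξ) := by
    linear_combination (ξ : ℂ) ^ 2 * Complex.I_sq
  push_cast
  rw [h3]
  simp only [mul_neg, sub_neg_eq_add] at n2 ⊢
  field_simp
  ring

/-- Under the symmetry condition, both shifted Stieltjes-Lévy measures coincide. -/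
theorem exists_charExponent_eq_of_symm {μm μp σ2 b β : ℝ} {Gm Gp : Measure ℝ} (h : μm < μp)
    (hβ : β = -(μm + μp) / 2) (hm : IsSLM μp Gm) (hp : IsSLM (-μm) Gp)
    (hsym : ∀ ξ : ℂ, ξ - Complex.I * β ∈ cutPlane μm μp →
      charExponent μm μp σ2 b (slLevyMeasure Gm Gp) (ξ - Complex.I * β) =
        charExponent μm μp σ2 b (slLevyMeasure Gm Gp) (-ξ - Complex.I * β)) :
    ∃ C : ℝ, IsTail ((μp - μm) / 2) (Gp.map fun t => t - β) ∧
      (Gp.map fun t => t - β) = (Gm.map fun t => t - -β) ∧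
      (∀ ξ : ℂ, ξ - Complex.I * β ∈ cutPlane μm μp →
        Integrable (fun s : ℝ => 2 * ((s : ℂ) * (s ^ 2 + ξ ^ 2))⁻¹) (Gp.map fun t => t - β) ∧
        charExponent μm μp σ2 b (slLevyMeasure Gm Gp) (ξ - Complex.I * β) =
          C + (σ2 / 2 : ℝ) * ξ ^ 2 + ξ ^ 2 * evenTransform (Gp.map fun t => t - β) ξ) ∧
      ∀ w : ℝ, (w : ℂ) ∈ cutPlane μm μp → charExponent μm μp σ2 b (slLevyMeasure Gm Gp) w =
        lkExponent σ2 b (slLevyMeasure Gm Gp) w := by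
  obtain ⟨C, b', hψ, hreal⟩ := exists_charExponent_eq (σ2 := σ2) (b := b) h hβ hm hp
  have hpt := hp.isTail (β := β) (by linarith)
  have hmt := hm.isTail (β := -β) (by linarith)
  have hme : -μm - β = (μp - μm) / 2 := by linarith
  have hme' : μp - -β = (μp - μm) / 2 := by linarith
  rw [hme] at hpt
  rw [hme'] at hmt
  set G₁ := Gp.map fun t => t - β
  set G₂ := Gm.map fun t => t - -β
  have hψ' (ξ : ℂ) (hξ : ξ - Complex.I * β ∈ cutPlane μm μp) := hψ _ hξ
  simp only [sub_add_cancel] at hψ'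
  have hmem {ξ : ℝ} (hξ : ξ ≠ 0) : (ξ : ℂ) - Complex.I * β ∈ cutPlane μm μp :=
    Or.inl (by simpa using hξ)
  have hmem' {ξ : ℝ} (hξ : ξ ≠ 0) : -(ξ : ℂ) - Complex.I * β ∈ cutPlane μm μp :=
    Or.inl (by simpa using hξ)
  set R : Measure ℝ → ℝ → ℝ := fun G z => ∫ s, (s ^ 2 * (s ^ 2 + z))⁻¹ ∂G with hR
  -- The odd part of the expansion at the real point `ξ = √z`, divided by `2iξ`.
  have hb {z : ℝ} (hz : 0 < z) : b' = z * (R G₁ z - R G₂ z) := by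
    have hξ : √z ≠ 0 := (Real.sqrt_pos.2 hz).ne'
    have h0 := hsym (√z : ℝ) (hmem hξ)
    rw [hψ' _ (hmem hξ), hψ' _ (hmem' hξ)] at h0
    have h1 := hpt.cubicTransform_sub hξ
    have h2 := hmt.cubicTransform_sub hξ
    rw [Real.sq_sqrt hz.le] at h1 h2
    rw [neg_neg] at h0
    have h3 : 2 * Complex.I * (√z : ℝ) * ((z * (R G₁ z - R G₂ z) - b' : ℝ) : ℂ) = 0 := by
      have h4 : (z : ℂ) = (√z : ℝ) ^ 2 := by
        rw [← Complex.ofReal_pow, Real.sq_sqrt hz.le]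
      push_cast
      linear_combination h0 - ((√z : ℝ) : ℂ) ^ 2 * h1 + ((√z : ℝ) : ℂ) ^ 2 * h2 +
        2 * Complex.I * (√z : ℝ) * (R G₁ z - R G₂ z) * h4
    have h5 : ((z * (R G₁ z - R G₂ z) - b' : ℝ) : ℂ) = 0 := by
      refine (mul_eq_zero.1 h3).resolve_left ?_
      simp [hξ, Complex.I_ne_zero]
    have h6 : z * (R G₁ z - R G₂ z) - b' = 0 := by exact_mod_cast h5
    linarith
  -- Both transforms stay bounded by `∫ s⁻⁴` as `z → 0+`, so the right-hand side of `hb` tends to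
  -- `0`.
  have hb0 : b' = 0 := by
    set K := ∫ s, (s ^ 4)⁻¹ ∂G₁ + ∫ s, (s ^ 4)⁻¹ ∂G₂
    have hle : ∀ᶠ z : ℝ in 𝓝[>] 0, |b'| ≤ z * K := by
      filter_upwards [self_mem_nhdsWithin] with z hz
      have hz : 0 < z := hz
      rw [hb hz, abs_mul, abs_of_pos hz]
      refine mul_le_mul_of_nonneg_left ?_ hz.le
      exact (abs_sub _ _).trans (add_le_add (hpt.integrable_mul_add hz).2
        (hmt.integrable_mul_add hz).2)
    have hlim : Tendsto (fun z : ℝ => z * K) (𝓝[>] 0) (𝓝 0) := by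
      have : ContinuousAt (fun z : ℝ => z * K) 0 := by fun_prop
      have := this.tendsto
      rw [zero_mul] at this
      exact this.mono_left nhdsWithin_le_nhds
    have := ge_of_tendsto hlim hle
    exact abs_eq_zero.1 (le_antisymm this (abs_nonneg _))
  have hG : G₁ = G₂ := by
    refine hpt.eq_of_integral_eq hmt fun z hz => ?_
    have h1 := hb hz
    rw [hb0] at h1
    have h2 := (mul_eq_zero.1 h1.symm).resolve_left hz.ne'
    exact sub_eq_zero.1 h2
  refine ⟨C, hpt, hG, fun ξ hξ => ?_, hreal⟩
  obtain ⟨h1, h2⟩ := mem_shift_iff hβ hξ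
  refine ⟨(hpt.cubicTransform_add h1 h2).1, ?_⟩
  rw [hψ' ξ hξ, ← hG, (hpt.cubicTransform_add h1 h2).2, hb0]
  push_cast
  ring

end Symmetric

/-! ### Weighted images under squaring -/

section SqImage

/-- The image of `k(s) G(ds)` under `s ↦ s²`. -/
noncomputable def sqImage (k : ℝ → ℝ) (G : Measure ℝ) : Measure ℝ :=
  (G.withDensity fun s => ENNReal.ofReal (k s)).map fun s => s ^ 2

variable {k : ℝ → ℝ} {G : Measure ℝ} {m : ℝ}

lemma lintegral_sqImage (hk : Measurable k) {f : ℝ → ℝ≥0∞} (hf : Measurable f) :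
    ∫⁻ t, f t ∂(sqImage k G) = ∫⁻ s, ENNReal.ofReal (k s) * f (s ^ 2) ∂G := by
  rw [sqImage, lintegral_map hf (by fun_prop), lintegral_withDensity_eq_lintegral_mul _
    (by fun_prop) (by fun_prop)]
  rfl

lemma ae_sqImage (hk : Measurable k) {p : ℝ → Prop} (hp : MeasurableSet {t | p t})
    (h : ∀ᵐ s ∂G, p (s ^ 2)) : ∀ᵐ t ∂(sqImage k G), p t := by
  rw [sqImage, ae_map_iff (by fun_prop) hp, ae_withDensity_iff (by fun_prop)]
  filter_upwards [h] with s hs _ using hs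

lemma integral_sqImage (hk : Measurable k) (hk0 : ∀ᵐ s ∂G, 0 ≤ k s) {f : ℝ → ℂ}
    (hf : Measurable f) :
    (Integrable f (sqImage k G) ↔ Integrable (fun s => (k s : ℂ) * f (s ^ 2)) G) ∧
      ∫ t, f t ∂(sqImage k G) = ∫ s, (k s : ℂ) * f (s ^ 2) ∂G := by
  have hsm : (fun s => (ENNReal.ofReal (k s)).toReal • f (s ^ 2)) =ᵐ[G]
      fun s => (k s : ℂ) * f (s ^ 2) := by
    filter_upwards [hk0] with s hs
    rw [ENNReal.toReal_ofReal hs, Complex.real_smul]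
  constructor
  · rw [sqImage, integrable_map_measure hf.aestronglyMeasurable (by fun_prop),
      integrable_withDensity_iff_integrable_smul' (by fun_prop)
        (ae_of_all _ fun _ => ENNReal.ofReal_lt_top)]
    exact integrable_congr hsm
  · rw [sqImage, integral_map (by fun_prop) hf.aestronglyMeasurable,
      integral_withDensity_eq_integral_toReal_smul (by fun_prop)
        (ae_of_all _ fun _ => ENNReal.ofReal_lt_top)]
    exact integral_congr_ae hsm

lemma lintegral_lt_top_of_le_inv_cube (h : IsTail m G) {f : ℝ → ℝ≥0∞} {K : ℝ}
    (hf : ∀ s, m ≤ s → f s ≤ ENNReal.ofReal (K * (s ^ 3)⁻¹)) : ∫⁻ s, f s ∂G < ∞ := by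
  refine lt_of_le_of_lt (lintegral_mono_ae ?_) (h.integrable.const_mul K).lintegral_lt_top
  filter_upwards [h.ae_ge] with s hs using hf s hs

/-- The Stieltjes measure attached to the shifted Stieltjes-Lévy measure. -/
theorem IsTail.isSM (h : IsTail m G) : IsSM 0 (sqImage (fun s => 2 / s) G) := by
  have hk : Measurable fun s : ℝ => 2 / s := by fun_prop
  have h0 : ∀ᵐ t ∂(sqImage (fun s => 2 / s) G), 0 < t := by
    refine ae_sqImage hk measurableSet_Ioi ?_
    filter_upwards [h.ae_ge] with s hs
    have := h.pos.trans_le hs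
    positivity
  refine ⟨?_, ?_, ?_⟩
  · refine measure_eq_zero_iff_ae_notMem.2 (h0.mono fun t ht => by simpa using ht)
  · refine measure_eq_zero_iff_ae_notMem.2 (h0.mono fun t ht => by simpa using ht.le)
  · rw [lintegral_sqImage hk (by fun_prop)]
    refine lintegral_lt_top_of_le_inv_cube (K := 2) h fun s hs => ?_
    have hs0 := h.pos.trans_le hs
    rw [← ENNReal.ofReal_mul (by positivity)]
    refine ENNReal.ofReal_le_ofReal ?_
    rw [div_mul_eq_mul_div, div_eq_mul_inv, mul_assoc, ← mul_inv]
    gcongr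
    nlinarith

/-- This measure generates the Lévy density of the subordinator: `2s` times the Laplace transform of
`1 - e^{-qx}` at `s²` equals `2q / (s (s² + q))`. The coefficients `a₂ = 0`, `a₁ = 1` suffice
because `2s / (s² (1 + s²)) ≤ 2 s⁻³`. -/
theorem IsTail.isSLM (h : IsTail m G) : IsSLM (m ^ 2) (sqImage (fun s => 2 * s) G) := by
  have hk : Measurable fun s : ℝ => 2 * s := by fun_prop
  have h0 : ∀ᵐ t ∂(sqImage (fun s => 2 * s) G), m ^ 2 ≤ t := by
    refine ae_sqImage hk measurableSet_Ici ?_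
    filter_upwards [h.ae_ge] with s hs
    have := h.pos
    gcongr
  have hm2 : 0 < m ^ 2 := pow_pos h.pos 2
  have z1 : sqImage (fun s => 2 * s) G (Iic 0) = 0 :=
    measure_eq_zero_iff_ae_notMem.2 (h0.mono fun t ht => by simp only [mem_Iic]; linarith)
  have z2 : sqImage (fun s => 2 * s) G (Iio (m ^ 2)) = 0 :=
    measure_eq_zero_iff_ae_notMem.2 (h0.mono fun t ht => by simpa using ht)
  refine ⟨z1, z2, 0, 1, le_rfl, zero_le_one, by norm_num, ?_, ?_, ?_⟩
  · exact withDensity_absolutelyContinuous _ _ z1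
  · exact withDensity_absolutelyContinuous _ _ z2
  · rw [lintegral_withDensity_eq_lintegral_mul _ (by fun_prop) (by fun_prop),
      lintegral_sqImage hk (by fun_prop)]
    refine lintegral_lt_top_of_le_inv_cube (K := 2) h fun s hs => ?_
    have hs0 := h.pos.trans_le hs
    rw [Pi.mul_apply, ← ENNReal.ofReal_mul (by positivity), ← ENNReal.ofReal_mul (by positivity)]
    refine ENNReal.ofReal_le_ofReal ?_
    rw [zero_mul, zero_add, one_mul, mul_assoc]
    refine mul_le_mul_of_nonneg_left ?_ zero_le_two
    rw [← mul_inv, ← div_eq_mul_inv, div_le_iff₀ (by positivity), inv_mul_eq_div,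
      le_div_iff₀ (by positivity)]
    nlinarith [pow_pos hs0 2, pow_pos hs0 4]

lemma IsTail.stieltjesTransform_sqImage (h : IsTail m G) (q : ℂ) :
    stieltjesTransform (sqImage (fun s => 2 / s) G) q =
      ∫ s : ℝ, 2 * ((s : ℂ) * (s ^ 2 + q))⁻¹ ∂G := by
  have hk : Measurable fun s : ℝ => 2 / s := by fun_prop
  rw [stieltjesTransform, (integral_sqImage hk (by
    filter_upwards [h.ae_ge] with s hs
    have := h.pos.trans_le hs
    positivity) (by fun_prop)).2]
  congr 1
  ext s
  push_cast
  rw [mul_inv, add_comm q]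
  ring

end SqImage

/-! ### Exponential moments of Lévy measures with completely monotone densities -/

section ExpMoments

variable {H : Measure ℝ} {a : ℝ} {w : ℂ}

/-- The majorant is again a combination of exponentials. For `x ≤ 1`, `3 ‖w‖ x ≤ 6 ‖w‖ (1 -
e^{-x})`; for `x ≥ 1`, the excess `2` is at most `4 (1 - e^{-x})`. -/
lemma norm_exp_sub_one_le_add (ha : 0 ≤ a) (hw : w.re ≤ a) {x : ℝ} (hx : 0 < x) :
    ‖Complex.exp (w * x) - 1‖ ≤
      (Real.exp (a * x) - 1) + (4 + 6 * ‖w‖) * (1 - Real.exp (-x)) := by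
  have hre : (w * x).re ≤ a * x := by
    simp only [Complex.mul_re, Complex.ofReal_re, Complex.ofReal_im, mul_zero, sub_zero]
    gcongr
  rcases le_total x 1 with h1 | h1
  · have h2 := norm_exp_sub_one_le_of_re_le hre (by positivity)
    have h3 := half_le_one_sub_exp_neg hx.le h1
    rw [norm_mul, Complex.norm_real, Real.norm_of_nonneg hx.le] at h2
    nlinarith [norm_nonneg w]
  · have h3 := half_le_one_sub_exp_neg_of_one_le h1
    have h4 : ‖Complex.exp (w * x)‖ ≤ Real.exp (a * x) := by
      rw [Complex.norm_exp]; exact Real.exp_le_exp.2 hre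
    have h5 : ‖Complex.exp (w * x) - 1‖ ≤ ‖Complex.exp (w * x)‖ + 1 := by
      simpa using norm_sub_le (Complex.exp (w * x)) 1
    nlinarith [norm_nonneg w]

/-- The assumptions `h1` and `h2` are the Laplace transforms of `e^{ax} - 1` and `1 - e^{-x}`. The
boundary `Re w = a` is admitted, which is needed when `a` is the left end point of the support. -/
lemma integral_exp_sub_one_slLevyMeasure [SFinite H] (ha : 0 ≤ a)
    (hpos : ∀ᵐ t ∂H, 0 < t ∧ a < t) (h1 : Integrable (fun t => (t - a)⁻¹ - t⁻¹) H)
    (h2 : Integrable (fun t => t⁻¹ - (t + 1)⁻¹) H) (hw : w.re ≤ a) :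
    Integrable (fun x : ℝ => Complex.exp (w * x) - 1) (slLevyMeasure 0 H) ∧
      ∫ x : ℝ, (Complex.exp (w * x) - 1) ∂(slLevyMeasure 0 H) =
        ∫ t : ℝ, ((t - w)⁻¹ - (t : ℂ)⁻¹) ∂H := by
  set K := 4 + 6 * ‖w‖
  have hint : Integrable (fun p : ℝ × ℝ => (Complex.exp (w * p.2) - 1) * Real.exp (-(p.1 * p.2)))
      (H.prod (volume.restrict (Ioi 0))) := by
    refine integrable_prod_of_laplace (f := fun x => Complex.exp (w * x) - 1)
      (φ := fun x => (Real.exp (a * x) - 1) + K * (1 - Real.exp (-x)))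
      (Λ := fun t => ((t - a)⁻¹ - t⁻¹) + K * (t⁻¹ - (t + 1)⁻¹)) (by fun_prop)
      (fun x hx => norm_exp_sub_one_le_add ha hw hx) ?_ (h1.add (h2.const_mul K))
    filter_upwards [hpos] with t ht
    have e0 := laplace_exp_real (b := 0) (t := t) ht.1
    have e1 := laplace_exp_real (b := a) (t := t) ht.2
    have e2 := laplace_exp_real (b := -1) (t := t) (by linarith [ht.1])
    have hs (x : ℝ) : (Real.exp (a * x) - 1 + K * (1 - Real.exp (-x))) * Real.exp (-(t * x)) =
        (Real.exp (a * x) * Real.exp (-(t * x)) - Real.exp (0 * x) * Real.exp (-(t * x))) +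
        K * (Real.exp (0 * x) * Real.exp (-(t * x)) - Real.exp (-1 * x) * Real.exp (-(t * x))) := by
      rw [zero_mul, Real.exp_zero, neg_one_mul]
      ring
    simp_rw [hs]
    have i1 : IntegrableOn (fun x => Real.exp (a * x) * Real.exp (-(t * x)) -
        Real.exp (0 * x) * Real.exp (-(t * x))) (Ioi 0) := e1.1.sub e0.1
    have i2 : IntegrableOn (fun x => K * (Real.exp (0 * x) * Real.exp (-(t * x)) -
        Real.exp (-1 * x) * Real.exp (-(t * x)))) (Ioi 0) := (e0.1.sub e2.1).const_mul K
    refine ⟨i1.add i2, ?_⟩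
    rw [integral_add i1 i2, integral_const_mul, integral_sub e1.1 e0.1, integral_sub e0.1 e2.1,
      e0.2, e1.2, e2.2]
    simp
  obtain ⟨j1, j2⟩ := integral_slLevyMeasure (f := fun x => Complex.exp (w * x) - 1)
    (by fun_prop) hint
  refine ⟨j1, j2.trans (integral_congr_ae ?_)⟩
  filter_upwards [hpos] with t ht
  have e0 := laplace_exp (w := 0) (t := t) (by simpa using ht.1)
  have e1 := laplace_exp (w := w) (t := t) (hw.trans_lt ht.2)
  have hs (x : ℝ) : (Complex.exp (w * x) - 1) * Real.exp (-(t * x)) =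
      Complex.exp (w * x) * Real.exp (-(t * x)) - Complex.exp (0 * x) * Real.exp (-(t * x)) := by
    rw [zero_mul, Complex.exp_zero]
    ring
  simp_rw [hs]
  rw [integral_sub e1.1 e0.1, e1.2, e0.2, sub_zero]

end ExpMoments

/-! ### The subordinator -/

section Subordinator

variable {m σ2 β : ℝ} {G : Measure ℝ}

lemma IsTail.sigmaFinite (h : IsTail m G) : SigmaFinite G := by
  refine sigmaFinite_of_integrable_of_pos (by fun_prop) h.integrable ?_
  filter_upwards [h.ae_ge] with s hs
  have := h.pos.trans_le hs
  positivity

/-- The kernel identity is `2s (1/(s² - w) - 1/s²) = 2w / (s (s² - w))`. -/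
lemma IsTail.integral_slLevyMeasure_sqImage (h : IsTail m G) {a : ℝ} (ha : 0 ≤ a)
    (hlt : ∀ᵐ s ∂G, a < s ^ 2) (hi : Integrable (fun s => (s * (s ^ 2 - a))⁻¹) G) {w : ℂ}
    (hw : w.re ≤ a) :
    Integrable (fun x : ℝ => Complex.exp (w * x) - 1)
        (slLevyMeasure 0 (sqImage (fun s => 2 * s) G)) ∧
      ∫ x : ℝ, (Complex.exp (w * x) - 1) ∂(slLevyMeasure 0 (sqImage (fun s => 2 * s) G)) =
        w * ∫ s : ℝ, 2 * ((s : ℂ) * (s ^ 2 - w))⁻¹ ∂G := by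
  have := h.isSLM.sigmaFinite
  have hk : Measurable fun s : ℝ => 2 * s := by fun_prop
  have hk0 : ∀ᵐ s ∂G, 0 ≤ 2 * s := by
    filter_upwards [h.ae_ge] with s hs
    have := h.pos.trans_le hs
    positivity
  have hreal {f : ℝ → ℝ} (hf : Measurable f) (hi : Integrable (fun s => 2 * s * f (s ^ 2)) G) :
      Integrable f (sqImage (fun s => 2 * s) G) := by
    have h1 : Integrable (fun t => (f t : ℂ)) (sqImage (fun s => 2 * s) G) := by
      rw [(integral_sqImage hk hk0 (by fun_prop)).1]
      refine hi.ofReal.congr (ae_of_all _ fun s => ?_)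
      push_cast
      rfl
    simpa using h1.re
  have hpos : ∀ᵐ t ∂(sqImage (fun s => 2 * s) G), 0 < t ∧ a < t := by
    refine ae_sqImage hk (measurableSet_Ioi.inter measurableSet_Ioi) ?_
    filter_upwards [hlt] with s hs using ⟨ha.trans_lt hs, hs⟩
  obtain ⟨h1, h2⟩ := integral_exp_sub_one_slLevyMeasure (w := w) ha hpos (by
    refine hreal (by fun_prop) ((hi.const_mul (2 * a)).congr ?_)
    filter_upwards [h.ae_ge, hlt] with s hs hs'
    have hs0 := h.pos.trans_le hs
    have : s ^ 2 - a ≠ 0 := by linarith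
    field_simp
    ring) (by
    refine hreal (by fun_prop) ((h.integrable.const_mul 2).mono'
      (Measurable.aestronglyMeasurable (by fun_prop)) ?_)
    filter_upwards [h.ae_ge] with s hs
    have hs0 := h.pos.trans_le hs
    have h3 : 2 * s * ((s ^ 2)⁻¹ - (s ^ 2 + 1)⁻¹) = 2 * (s * (s ^ 2 + 1))⁻¹ := by
      field_simp
      ring
    rw [h3, Real.norm_of_nonneg (by positivity)]
    gcongr
    nlinarith) hw
  refine ⟨h1, h2.trans ?_⟩
  rw [(integral_sqImage hk hk0 (by fun_prop)).2, ← integral_const_mul]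
  refine integral_congr_ae ?_
  filter_upwards [h.ae_ge, hlt] with s hs hs'
  have hs0 : (s : ℂ) ≠ 0 := by exact_mod_cast (h.pos.trans_le hs).ne'
  have hne : (s : ℂ) ^ 2 - w ≠ 0 := by
    intro h0
    have := congrArg Complex.re h0
    rw [← Complex.ofReal_pow, Complex.sub_re, Complex.ofReal_re, Complex.zero_re] at this
    linarith
  push_cast
  field_simp
  ring

/-- The support starts at `m²`, so there is an exponential moment of the order `c = m²/2`, and `c x
≤ e^{cx} - 1`. Hence the jumps are summable without compensation. -/
lemma IsTail.integrable_id_slLevyMeasure_sqImage (h : IsTail m G) :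
    Integrable (fun x => x) (slLevyMeasure 0 (sqImage (fun s => 2 * s) G)) := by
  have := h.isSLM.sigmaFinite
  have hm := h.pos
  set c := m ^ 2 / 2 with hc
  have hc0 : 0 < c := by positivity
  have hlt : ∀ᵐ s ∂G, c < s ^ 2 := by
    filter_upwards [h.ae_ge] with s hs
    nlinarith
  have hi : Integrable (fun s => (s * (s ^ 2 - c))⁻¹) G := by
    refine (h.integrable.const_mul 2).mono' (Measurable.aestronglyMeasurable (by fun_prop)) ?_
    filter_upwards [h.ae_ge] with s hs
    have hs0 := hm.trans_le hs
    have h1 : s ^ 2 / 2 ≤ s ^ 2 - c := by nlinarith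
    rw [Real.norm_of_nonneg (by have : 0 < s ^ 2 / 2 := by positivity
                                have : 0 < s ^ 2 - c := by linarith
                                positivity)]
    calc (s * (s ^ 2 - c))⁻¹ ≤ (s * (s ^ 2 / 2))⁻¹ := by gcongr
      _ = 2 * (s ^ 3)⁻¹ := by field_simp
  have h1 := (h.integral_slLevyMeasure_sqImage hc0.le hlt hi (w := c) (by simp)).1
  refine (h1.norm.const_mul c⁻¹).mono' measurable_id.aestronglyMeasurable ?_
  filter_upwards [measure_eq_zero_iff_ae_notMem.1
    (slLevyMeasure_zero_left_Iic (sqImage (fun s => 2 * s) G))] with x hx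
  have hx0 : 0 < x := not_le.1 hx
  rw [Real.norm_of_nonneg hx0.le]
  have h2 : Complex.exp (c * x) - 1 = ((Real.exp (c * x) - 1 : ℝ) : ℂ) := by push_cast; rfl
  rw [h2, Complex.norm_real, inv_mul_eq_div, le_div_iff₀ hc0]
  refine le_trans ?_ (Real.le_norm_self _)
  linarith [Real.add_one_le_exp (c * x)]

/-- The subordinator with Lévy density the Laplace transform of `sqImage (2 s) G`. -/
theorem IsTail.exists_subordinator (h : IsTail m G) (hσ : 0 ≤ σ2) (hlt : ∀ᵐ s ∂G, β ^ 2 < s ^ 2)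
    (hi : Integrable (fun s => (s * (s ^ 2 - β ^ 2))⁻¹) G) :
    ∃ (Ω' : Type) (_ : MeasurableSpace Ω') (P' : Measure Ω') (Z : ℝ≥0 → Ω' → ℝ≥0),
      IsProbabilityMeasure P' ∧ (∀ t, Measurable (Z t)) ∧ IsSubordinator Z P' ∧
      IsSLPlus (m ^ 2) (fun t ω => (Z t ω : ℝ)) P' ∧
      ∀ c : ℂ, c.re ≤ β ^ 2 → ∀ t : ℝ≥0,
        Integrable (fun ω => Complex.exp (c * (Z t ω : ℝ))) P' ∧
          ∫ ω, Complex.exp (c * (Z t ω : ℝ)) ∂P' =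
            Complex.exp (t * ((σ2 / 2 : ℝ) * c +
              c * ∫ s : ℝ, 2 * ((s : ℂ) * (s ^ 2 - c))⁻¹ ∂G)) := by
  have := h.isSLM.sigmaFinite
  set ν := slLevyMeasure 0 (sqImage (fun s => 2 * s) G)
  have hid : Integrable (fun x => x) ν := h.integrable_id_slLevyMeasure_sqImage
  have hν0 : ν (Iic 0) = 0 := slLevyMeasure_zero_left_Iic _
  obtain ⟨a, ha⟩ : ∃ a : ℝ≥0, (a : ℝ) = σ2 / 2 := ⟨⟨σ2 / 2, by positivity⟩, rfl⟩
  obtain ⟨Ω', mΩ', P', Z, hP', hZm, hZ, hexp⟩ := StieltjesLevy.exists_subordinator hν0 hid a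
  rw [ha] at hexp
  have hC : Integrable (fun x => Real.exp (β ^ 2 * x) - 1) ν := by
    have h1 := (h.integral_slLevyMeasure_sqImage (sq_nonneg β) hlt hi
      (w := ((β ^ 2 : ℝ) : ℂ)) (by rw [Complex.ofReal_re])).1.re
    refine h1.congr (ae_of_all _ fun x => ?_)
    have h2 : Complex.exp ((β ^ 2 : ℝ) * x) - 1 = ((Real.exp (β ^ 2 * x) - 1 : ℝ) : ℂ) := by
      push_cast; rfl
    simp only [h2]
    exact Complex.ofReal_re _
  have hexp' := hexp (β ^ 2) (sq_nonneg β) hC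
  refine ⟨Ω', mΩ', P', Z, hP', hZm, hZ, ⟨hZ, ?_⟩, fun c hc t => ?_⟩
  -- The truncation term of the Lévy-Khintchine formula has the finite mean `B`; in that
  -- normalisation the drift `σ²/2` becomes `σ²/2 + B`.
  · set B : ℝ := ∫ x, (Ioo (-1 : ℝ) 1).indicator (fun x => x) x ∂ν
    refine ⟨σ2 / 2 + B, _, h.isSLM, fun t ξ => ?_⟩
    have h1 := (hexp' (Complex.I * ξ) (by simpa using sq_nonneg β) t).2
    rw [h1, lkExponent_eq]
    congr 1
    have i1 : Integrable (fun x : ℝ => Complex.exp (Complex.I * ξ * x) - 1) ν :=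
      (h.integral_slLevyMeasure_sqImage (sq_nonneg β) hlt hi (by simpa using sq_nonneg β)).1
    have i2 : Integrable (fun x => (((Ioo (-1 : ℝ) 1).indicator (fun x => x) x : ℝ) : ℂ)) ν :=
      (hid.indicator measurableSet_Ioo).ofReal
    have h2 : ∫ x, lkIntegrand ξ x ∂ν = -∫ x : ℝ, (Complex.exp (Complex.I * ξ * x) - 1) ∂ν +
        Complex.I * ξ * B := by
      rw [← integral_complex_ofReal, ← integral_const_mul, ← integral_neg,
        ← integral_add i1.fun_neg (i2.const_mul _)]
      congr 1
      ext x
      unfold lkIntegrand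
      by_cases hx : x ∈ Ioo (-1 : ℝ) 1 <;> simp [hx] <;> ring_nf
    rw [h2]
    simp only [zero_div, Complex.ofReal_zero, zero_mul, Complex.ofReal_add]
    ring
  · refine ⟨(hexp' c hc t).1, ?_⟩
    rw [(hexp' c hc t).2, (h.integral_slLevyMeasure_sqImage (sq_nonneg β) hlt hi hc).2]

end Subordinator

/-! ### Inversion of the Stieltjes transform -/

section Inversion

/-- The difference of the Poisson kernels of the half plane at `s - y` and `s + y`. -/
noncomputable def poissonDiff (ε s y : ℝ) : ℝ :=
  ε / ((s - y) ^ 2 + ε ^ 2) - ε / ((s + y) ^ 2 + ε ^ 2)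

lemma measurable_poissonDiff (ε : ℝ) : Measurable fun p : ℝ × ℝ => poissonDiff ε p.1 p.2 := by
  unfold poissonDiff
  fun_prop

lemma poissonDiff_eq {ε s y : ℝ} (hε : 0 < ε) : poissonDiff ε s y =
    4 * s * y * ε / (((s - y) ^ 2 + ε ^ 2) * ((s + y) ^ 2 + ε ^ 2)) := by
  have h1 : (s - y) ^ 2 + ε ^ 2 ≠ 0 := by positivity
  have h2 : (s + y) ^ 2 + ε ^ 2 ≠ 0 := by positivity
  unfold poissonDiff
  field_simp
  ring

lemma poissonDiff_nonneg {ε s y : ℝ} (hε : 0 < ε) (hs : 0 < s) (hy : 0 < y) :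
    0 ≤ poissonDiff ε s y := by
  rw [poissonDiff_eq hε]
  positivity

/-- For `ξ = iy + ε` the factorisation `s² + ξ² = (s + y - iε)(s - y + iε)` splits the kernel into
the real constant `2/s` and two simple fractions, whose imaginary parts are Poisson kernels. -/
lemma im_kernel_eq {ε s y : ℝ} (hε : 0 < ε) (hs : 0 < s) :
    ((Complex.I * y + ε) ^ 2 * (2 * ((s : ℂ) * (s ^ 2 + (Complex.I * y + ε) ^ 2))⁻¹)).im =
      poissonDiff ε s y := by
  have hs0 : (s : ℂ) ≠ 0 := by exact_mod_cast hs.ne'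
  have n1 : (s : ℂ) + y - Complex.I * ε ≠ 0 := by
    intro h
    have := congrArg Complex.im h
    simp at this
    exact hε.ne' this
  have n2 : (s : ℂ) - y + Complex.I * ε ≠ 0 := by
    intro h
    have := congrArg Complex.im h
    simp at this
    exact hε.ne' this
  have h3 : (s : ℂ) ^ 2 + (Complex.I * y + ε) ^ 2 =
      (s + y - Complex.I * ε) * (s - y + Complex.I * ε) := by
    linear_combination (y ^ 2 + ε ^ 2 : ℂ) * Complex.I_sq
  have h4 : (Complex.I * y + ε) ^ 2 * (2 * ((s : ℂ) * (s ^ 2 + (Complex.I * y + ε) ^ 2))⁻¹) =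
      ((2 / s : ℝ) : ℂ) - ((s : ℂ) + y - Complex.I * ε)⁻¹ - ((s : ℂ) - y + Complex.I * ε)⁻¹ := by
    have h5 : (Complex.I * y + ε) ^ 2 = (s + y - Complex.I * ε) * (s - y + Complex.I * ε) -
      (s : ℂ) ^ 2 := by rw [← h3]; ring
    rw [h3, h5]
    push_cast
    field_simp
    ring
  rw [h4, Complex.sub_im, Complex.sub_im, Complex.ofReal_im, Complex.inv_im, Complex.inv_im,
    Complex.normSq_apply, Complex.normSq_apply]
  simp only [Complex.sub_im, Complex.add_im, Complex.ofReal_im, Complex.mul_im, Complex.I_re,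
    Complex.I_im, Complex.ofReal_re, Complex.sub_re, Complex.add_re, Complex.mul_re]
  unfold poissonDiff
  ring_nf

variable {a b : ℝ}

lemma integral_poisson {ε s : ℝ} (hε : 0 < ε) (hab : a ≤ b) :
    IntegrableOn (fun y => ε / ((s - y) ^ 2 + ε ^ 2)) (Ioc a b) ∧
    ∫ y in Ioc a b, ε / ((s - y) ^ 2 + ε ^ 2) =
      Real.arctan ((b - s) / ε) - Real.arctan ((a - s) / ε) := by
  have hc : Continuous fun y : ℝ => ε / ((s - y) ^ 2 + ε ^ 2) := by
    refine Continuous.div (by fun_prop) (by fun_prop) fun y => by positivity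
  refine ⟨hc.integrableOn_Ioc, ?_⟩
  rw [← intervalIntegral.integral_of_le hab]
  refine intervalIntegral.integral_eq_sub_of_hasDerivAt
    (f := fun y => Real.arctan ((y - s) / ε)) (fun y _ => ?_) (hc.intervalIntegrable _ _)
  refine ((((hasDerivAt_id y).sub_const s).div_const ε).arctan).congr_deriv ?_
  simp only [id]
  field_simp
  ring

lemma tendsto_arctan_div_of_pos {c : ℝ} (hc : 0 < c) :
    Tendsto (fun ε => Real.arctan (c / ε)) (𝓝[>] 0) (𝓝 (Real.pi / 2)) := by
  have h1 : Tendsto (fun ε : ℝ => c / ε) (𝓝[>] 0) atTop := by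
    simp only [div_eq_mul_inv]
    exact tendsto_inv_nhdsGT_zero.const_mul_atTop hc
  exact (Real.tendsto_arctan_atTop.mono_right nhdsWithin_le_nhds).comp h1

lemma tendsto_arctan_div_of_neg {c : ℝ} (hc : c < 0) :
    Tendsto (fun ε => Real.arctan (c / ε)) (𝓝[>] 0) (𝓝 (-(Real.pi / 2))) := by
  have h1 := (tendsto_arctan_div_of_pos (neg_pos.2 hc)).neg
  refine h1.congr fun ε => ?_
  rw [neg_div, Real.arctan_neg, neg_neg]

/-- A domination uniform in `ε`. For `s ≤ 2b` the Poisson kernel has mass at most `π`, and `(2b)³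
s⁻³ ≥ 1`. For `s ≥ 2b` the two kernels nearly cancel: in the product form the denominator is at
least `s⁴/4`. -/
lemma integral_poissonDiff_le {ε s : ℝ} (hε : 0 < ε) (hε1 : ε ≤ 1) (ha : 0 < a) (hab : a < b)
    (hs : 0 < s) :
    ‖∫ y in Ioc a b, 2 / y * poissonDiff ε s y‖ ≤
      (2 * Real.pi * (2 * b) ^ 3 / a + 32 * b / a * (b - a)) * (s ^ 3)⁻¹ := by
  have hb : 0 < b := ha.trans hab
  have hba : 0 < b - a := by linarith
  rcases le_total s (2 * b) with h | h
  · have h1 : ‖∫ y in Ioc a b, 2 / y * poissonDiff ε s y‖ ≤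
        ∫ y in Ioc a b, 2 / a * (ε / ((s - y) ^ 2 + ε ^ 2)) := by
      refine norm_integral_le_of_norm_le ((integral_poisson hε hab.le).1.const_mul _) ?_
      refine (ae_restrict_iff' measurableSet_Ioc).2 (ae_of_all _ fun y hy => ?_)
      have hy0 : 0 < y := ha.trans hy.1
      rw [Real.norm_of_nonneg (mul_nonneg (by positivity) (poissonDiff_nonneg hε hs hy0))]
      have h2 : poissonDiff ε s y ≤ ε / ((s - y) ^ 2 + ε ^ 2) := by
        have : 0 ≤ ε / ((s + y) ^ 2 + ε ^ 2) := by positivity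
        unfold poissonDiff
        linarith
      have h3 := poissonDiff_nonneg hε hs hy0
      have := hy.1
      gcongr
    refine h1.trans ?_
    rw [integral_const_mul, (integral_poisson hε hab.le).2]
    have h4 := Real.arctan_lt_pi_div_two ((b - s) / ε)
    have h5 := Real.neg_pi_div_two_lt_arctan ((a - s) / ε)
    have h6 : 1 ≤ (2 * b) ^ 3 * (s ^ 3)⁻¹ := by
      rw [← div_eq_mul_inv, le_div_iff₀ (by positivity), one_mul]
      gcongr
    have hpi := Real.pi_pos
    calc 2 / a * (Real.arctan ((b - s) / ε) - Real.arctan ((a - s) / ε))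
        ≤ 2 / a * Real.pi := by gcongr; linarith
      _ ≤ 2 / a * Real.pi * ((2 * b) ^ 3 * (s ^ 3)⁻¹) := le_mul_of_one_le_right (by positivity) h6
      _ = (2 * Real.pi * (2 * b) ^ 3 / a + 0) * (s ^ 3)⁻¹ := by ring
      _ ≤ _ := by gcongr; positivity
  · have h1 : ‖∫ y in Ioc a b, 2 / y * poissonDiff ε s y‖ ≤
        (32 * b / a * (s ^ 3)⁻¹) * (volume.real (Ioc a b)) := by
      refine norm_setIntegral_le_of_norm_le_const (by simp) fun y hy => ?_
      have hy0 : 0 < y := ha.trans hy.1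
      rw [Real.norm_of_nonneg (mul_nonneg (by positivity) (poissonDiff_nonneg hε hs hy0)),
        poissonDiff_eq hε]
      have h2 : s ^ 2 / 4 ≤ (s - y) ^ 2 + ε ^ 2 := by nlinarith [hy.2]
      have h3 : s ^ 2 ≤ (s + y) ^ 2 + ε ^ 2 := by nlinarith
      calc 2 / y * (4 * s * y * ε / (((s - y) ^ 2 + ε ^ 2) * ((s + y) ^ 2 + ε ^ 2)))
          ≤ 2 / a * (4 * s * b * 1 / ((s ^ 2 / 4) * s ^ 2)) := by
            gcongr
            · exact hy.1.le
            · exact hy.2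
        _ = 32 * b / a * (s ^ 3)⁻¹ := by field_simp; ring
    refine h1.trans ?_
    rw [Real.volume_real_Ioc_of_le hab.le]
    have hpi := Real.pi_pos
    calc 32 * b / a * (s ^ 3)⁻¹ * (b - a) = (0 + 32 * b / a * (b - a)) * (s ^ 3)⁻¹ := by ring
      _ ≤ _ := by gcongr; positivity

lemma tendsto_integral_poissonDiff {s : ℝ} (ha : 0 < a) (hab : a < b) (hs : 0 < s) (hsa : s ≠ a)
    (hsb : s ≠ b) :
    Tendsto (fun ε => ∫ y in Ioc a b, 2 / y * poissonDiff ε s y) (𝓝[>] 0)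
      (𝓝 (Real.pi * (Ioc a b).indicator (fun s => 2 / s) s)) := by
  -- The weight `2/y` is replaced by the constant `2/s`, using `2/y = 2/s + 2(s - y)/(sy)`; the main
  -- term then integrates to arctangents. The remainder `r` is bounded, since `|s - y| ε ≤ (s - y)²
  -- + ε²`, and tends to `0` pointwise.
  set r : ℝ → ℝ → ℝ := fun ε y => 2 * (s - y) / (s * y) * (ε / ((s - y) ^ 2 + ε ^ 2)) -
    2 / y * (ε / ((s + y) ^ 2 + ε ^ 2)) with hr
  have hev : ∀ᶠ ε : ℝ in 𝓝[>] 0, 0 < ε ∧ ε ≤ 1 := by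
    filter_upwards [Ioc_mem_nhdsGT (zero_lt_one (α := ℝ))] with ε hε using hε
  have hrb : ∀ ε : ℝ, 0 < ε ∧ ε ≤ 1 → ∀ y ∈ Ioc a b, ‖r ε y‖ ≤ 2 / (s * a) + 2 / a * (1 / a ^ 2) := by
    intro ε hε y hy
    have hε0 := hε.1
    have hy0 : 0 < y := ha.trans hy.1
    have hya := hy.1.le
    refine (norm_sub_le _ _).trans (add_le_add ?_ ?_)
    · rw [norm_mul, norm_div, norm_div, norm_mul, norm_mul, Real.norm_of_nonneg hs.le,
        Real.norm_of_nonneg hy0.le, Real.norm_of_nonneg hε0.le, Real.norm_of_nonneg zero_le_two,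
        Real.norm_of_nonneg (by positivity : 0 ≤ (s - y) ^ 2 + ε ^ 2), Real.norm_eq_abs]
      have h1 : |s - y| * ε / ((s - y) ^ 2 + ε ^ 2) ≤ 1 := by
        rw [div_le_one (by positivity), ← sq_abs (s - y)]
        nlinarith [sq_nonneg (|s - y| - ε), sq_nonneg (|s - y|), sq_nonneg ε]
      calc 2 * |s - y| / (s * y) * (ε / ((s - y) ^ 2 + ε ^ 2))
          = 2 / (s * y) * (|s - y| * ε / ((s - y) ^ 2 + ε ^ 2)) := by ring
        _ ≤ 2 / (s * y) * 1 := by gcongr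
        _ ≤ 2 / (s * a) := by rw [mul_one]; gcongr
    · rw [Real.norm_of_nonneg (by positivity)]
      have h2 : a ^ 2 ≤ (s + y) ^ 2 + ε ^ 2 := by nlinarith
      have h3 := hε.2
      gcongr
  have hrm (ε : ℝ) : Measurable (r ε) := by
    simp only [hr]
    fun_prop
  have hri (ε : ℝ) (hε : 0 < ε ∧ ε ≤ 1) : IntegrableOn (r ε) (Ioc a b) :=
    Integrable.of_bound (hrm ε).aestronglyMeasurable _
      ((ae_restrict_iff' measurableSet_Ioc).2 (ae_of_all _ (hrb ε hε)))
  have hr0 : Tendsto (fun ε => ∫ y in Ioc a b, r ε y) (𝓝[>] 0) (𝓝 (∫ _ in Ioc a b, (0 : ℝ))) := by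
    refine tendsto_integral_filter_of_dominated_convergence
      (fun _ => 2 / (s * a) + 2 / a * (1 / a ^ 2))
      (Eventually.of_forall fun ε => (hrm ε).aestronglyMeasurable) ?_ (integrable_const _) ?_
    · filter_upwards [hev] with ε hε
      exact (ae_restrict_iff' measurableSet_Ioc).2 (ae_of_all _ (hrb ε hε))
    · refine (ae_restrict_iff' measurableSet_Ioc).2 (ae_of_all _ fun y hy => ?_)
      have hy0 : 0 < y := ha.trans hy.1
      have h1 : ContinuousAt (fun ε : ℝ => 2 / y * (ε / ((s + y) ^ 2 + ε ^ 2))) 0 := by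
        refine ContinuousAt.mul continuousAt_const (ContinuousAt.div (by fun_prop) (by fun_prop) ?_)
        have : 0 < s + y := by positivity
        positivity
      have h2 : ContinuousAt (fun ε : ℝ => r ε y) 0 := by
        by_cases hsy : s = y
        · simp only [hr, hsy, sub_self, mul_zero, zero_div, zero_mul, zero_sub]
          rw [← hsy] at h1 ⊢
          exact h1.neg
        · refine ContinuousAt.sub ?_ h1
          refine ContinuousAt.mul continuousAt_const
            (ContinuousAt.div (by fun_prop) (by fun_prop) ?_)
          have : s - y ≠ 0 := sub_ne_zero.2 hsy
          positivity
      have h3 := h2.tendsto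
      simp only [hr, zero_div, mul_zero, sub_zero] at h3
      exact h3.mono_left nhdsWithin_le_nhds
  have hsplit : ∀ᶠ ε : ℝ in 𝓝[>] 0, 2 / s * (Real.arctan ((b - s) / ε) -
      Real.arctan ((a - s) / ε)) + ∫ y in Ioc a b, r ε y =
      ∫ y in Ioc a b, 2 / y * poissonDiff ε s y := by
    filter_upwards [hev] with ε hε
    rw [← (integral_poisson hε.1 hab.le).2, ← integral_const_mul, ← integral_add
      ((integral_poisson hε.1 hab.le).1.const_mul _) (hri ε hε)]
    refine setIntegral_congr_fun measurableSet_Ioc fun y hy => ?_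
    have hy0 : y ≠ 0 := (ha.trans hy.1).ne'
    simp only [hr, poissonDiff]
    have : 2 / y = 2 / s + 2 * (s - y) / (s * y) := by field_simp; ring
    rw [mul_sub, this]
    ring
  have hlim : Tendsto (fun ε => 2 / s * (Real.arctan ((b - s) / ε) - Real.arctan ((a - s) / ε)))
      (𝓝[>] 0) (𝓝 (Real.pi * (Ioc a b).indicator (fun s => 2 / s) s)) := by
    rcases lt_or_gt_of_ne hsa with h1 | h1
    · have h := ((tendsto_arctan_div_of_pos (c := b - s) (by linarith)).sub
        (tendsto_arctan_div_of_pos (c := a - s) (by linarith))).const_mul (2 / s)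
      rw [indicator_of_notMem (fun h => by linarith [h.1])]
      convert h using 2
      ring
    rcases lt_or_gt_of_ne hsb with h2 | h2
    · have h := ((tendsto_arctan_div_of_pos (c := b - s) (by linarith)).sub
        (tendsto_arctan_div_of_neg (c := a - s) (by linarith))).const_mul (2 / s)
      rw [indicator_of_mem (show s ∈ Ioc a b from ⟨h1, h2.le⟩)]
      convert h using 2
      ring
    · have h := ((tendsto_arctan_div_of_neg (c := b - s) (by linarith)).sub
        (tendsto_arctan_div_of_neg (c := a - s) (by linarith))).const_mul (2 / s)
      rw [indicator_of_notMem (fun h => by linarith [h.2])]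
      convert h using 2
      ring
  have := hlim.add hr0
  rw [integral_zero, add_zero] at this
  exact this.congr' hsplit

variable {m : ℝ} {G : Measure ℝ}

/-- Here `ε` is fixed, so the constant `K` may blow up as `ε → 0`; only the decay `s⁻³` matters for
Fubini's theorem. -/
lemma IsTail.integral_poissonDiff_swap (h : IsTail m G) {ε : ℝ} (hε : 0 < ε) (ha : 0 < a)
    (hab : a < b) :
    IntegrableOn (fun y => ∫ s, 2 / y * poissonDiff ε s y ∂G) (Ioc a b) ∧
      ∫ y in Ioc a b, (∫ s, 2 / y * poissonDiff ε s y ∂G) =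
        ∫ s, (∫ y in Ioc a b, 2 / y * poissonDiff ε s y) ∂G := by
  have := h.sigmaFinite
  have hb : 0 < b := ha.trans hab
  obtain ⟨K, hK⟩ : ∃ K, K = 2 / a * (4 * b * ε * (2 + 2 * b ^ 2 / ε ^ 2)) := ⟨_, rfl⟩
  have hint : Integrable (fun p : ℝ × ℝ => 2 / p.1 * poissonDiff ε p.2 p.1)
      ((volume.restrict (Ioc a b)).prod G) := by
    have hm : Measurable fun p : ℝ × ℝ => 2 / p.1 * poissonDiff ε p.2 p.1 := by
      unfold poissonDiff
      fun_prop
    have hd := Integrable.mul_prod (μ := volume.restrict (Ioc a b)) (integrable_const (1 : ℝ))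
      (h.integrable.const_mul K)
    refine hd.mono' hm.aestronglyMeasurable ?_
    have e1 : ∀ᵐ p ∂((volume.restrict (Ioc a b)).prod G), p.1 ∈ Ioc a b :=
      Measure.quasiMeasurePreserving_fst.ae (ae_restrict_mem measurableSet_Ioc)
    have e2 : ∀ᵐ p ∂((volume.restrict (Ioc a b)).prod G), m ≤ p.2 :=
      Measure.quasiMeasurePreserving_snd.ae h.ae_ge
    filter_upwards [e1, e2] with p hp1 hp2
    obtain ⟨y, s⟩ := p
    have hy0 : 0 < y := ha.trans hp1.1
    have hs0 : 0 < s := h.pos.trans_le hp2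
    have hya : a ≤ y := hp1.1.le
    have hyb : y ≤ b := hp1.2
    simp only [one_mul]
    rw [Real.norm_of_nonneg (mul_nonneg (by positivity) (poissonDiff_nonneg hε hs0 hy0)),
      poissonDiff_eq hε]
    have h1 : s ^ 2 / (2 + 2 * b ^ 2 / ε ^ 2) ≤ (s - y) ^ 2 + ε ^ 2 := by
      rw [div_le_iff₀ (by positivity)]
      have h2 : 2 * b ^ 2 ≤ 2 * b ^ 2 / ε ^ 2 * ((s - y) ^ 2 + ε ^ 2) := by
        rw [mul_add, div_mul_cancel₀ _ (by positivity)]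
        have : 0 ≤ 2 * b ^ 2 / ε ^ 2 * (s - y) ^ 2 := by positivity
        linarith
      nlinarith [sq_nonneg (s - 2 * y), sq_nonneg ε]
    have h3 : s ^ 2 ≤ (s + y) ^ 2 + ε ^ 2 := by nlinarith [sq_nonneg ε]
    calc 2 / y * (4 * s * y * ε / (((s - y) ^ 2 + ε ^ 2) * ((s + y) ^ 2 + ε ^ 2)))
        ≤ 2 / a * (4 * s * b * ε / ((s ^ 2 / (2 + 2 * b ^ 2 / ε ^ 2)) * s ^ 2)) := by gcongr
      _ = K * (s ^ 3)⁻¹ := by rw [hK]; field_simp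
  exact ⟨hint.integral_prod_left, integral_integral_swap hint⟩

/-- Dominated convergence in `s`. At the end points `s = a` and `s = b` the kernels leave only half
of their mass in the interval, so these points must be null. -/
theorem IsTail.tendsto_integral_poissonDiff (h : IsTail m G) (ha : 0 < a) (hab : a < b)
    (hGa : G {a} = 0) (hGb : G {b} = 0) :
    Tendsto (fun ε => ∫ y in Ioc a b, (∫ s, 2 / y * poissonDiff ε s y ∂G)) (𝓝[>] 0)
      (𝓝 (Real.pi * ∫ s, (Ioc a b).indicator (fun s => 2 / s) s ∂G)) := by
  have := h.sigmaFinite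
  have h1 : Tendsto (fun ε => ∫ s, (∫ y in Ioc a b, 2 / y * poissonDiff ε s y) ∂G) (𝓝[>] 0)
      (𝓝 (∫ s, Real.pi * (Ioc a b).indicator (fun s => 2 / s) s ∂G)) := by
    refine tendsto_integral_filter_of_dominated_convergence
      (fun s => (2 * Real.pi * (2 * b) ^ 3 / a + 32 * b / a * (b - a)) * (s ^ 3)⁻¹)
      (Eventually.of_forall fun ε => ?_) ?_ (h.integrable.const_mul _) ?_
    · have hm : Measurable fun p : ℝ × ℝ => 2 / p.2 * poissonDiff ε p.1 p.2 :=
        Measurable.mul (by fun_prop) (measurable_poissonDiff ε)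
      exact hm.stronglyMeasurable.integral_prod_right.aestronglyMeasurable
    · filter_upwards [Ioc_mem_nhdsGT (zero_lt_one (α := ℝ))] with ε hε
      filter_upwards [h.ae_ge] with s hs
      exact integral_poissonDiff_le hε.1 hε.2 ha hab (h.pos.trans_le hs)
    · filter_upwards [h.ae_ge, measure_eq_zero_iff_ae_notMem.1 hGa,
        measure_eq_zero_iff_ae_notMem.1 hGb] with s hs h2 h3
      exact StieltjesLevy.tendsto_integral_poissonDiff ha hab (h.pos.trans_le hs) h2 h3
  rw [integral_const_mul] at h1
  refine h1.congr' ?_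
  filter_upwards [self_mem_nhdsWithin] with ε hε
  exact (h.integral_poissonDiff_swap hε ha hab).2.symm

/-- For `y < x` the mass of `(-∞, x]` is at least that of `(-∞, y]` plus the atom; letting `y`
increase to `x`, finiteness allows cancellation. -/
lemma measure_singleton_eq_zero_of_continuousAt {μ : Measure ℝ} {x : ℝ} (hfin : μ (Iic x) ≠ ∞)
    (hc : ContinuousAt (fun t => μ (Iic t)) x) : μ {x} = 0 := by
  have h1 : ∀ᶠ y in 𝓝[<] x, μ (Iic y) + μ {x} ≤ μ (Iic x) := by
    filter_upwards [self_mem_nhdsWithin] with y hy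
    have hy : y < x := hy
    rw [← measure_union (by simpa using hy) (measurableSet_singleton x)]
    refine measure_mono (union_subset (Iic_subset_Iic.2 hy.le) (by simp))
  have h2 : Tendsto (fun y => μ (Iic y) + μ {x}) (𝓝[<] x) (𝓝 (μ (Iic x) + μ {x})) :=
    (hc.tendsto.mono_left nhdsWithin_le_nhds).add tendsto_const_nhds
  have h3 := le_of_tendsto h2 h1
  by_contra hne
  exact absurd h3 (not_le.2 (ENNReal.lt_add_right hfin hne))

lemma IsSLM.measure_Iic_lt_top {μ : ℝ} (h : IsSLM μ G) (x : ℝ) : G (Iic x) < ∞ := by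
  have h1 : G (Iic x) ≤ ∫⁻ t, ENNReal.ofReal (|x| * (1 + |x|) ^ 2 * (t * (1 + t) ^ 2)⁻¹) ∂G := by
    rw [← lintegral_indicator_one measurableSet_Iic]
    refine lintegral_mono_ae ?_
    filter_upwards [h.ae_pos] with t ht
    have ht0 := ht.1
    by_cases hx : t ∈ Iic x
    · rw [indicator_of_mem hx, Pi.one_apply, ENNReal.one_le_ofReal, ← div_eq_mul_inv,
        le_div_iff₀ (by positivity), one_mul]
      have : t ≤ |x| := le_trans hx (le_abs_self x)
      gcongr
    · rw [indicator_of_notMem hx]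
      exact zero_le
  exact h1.trans_lt (h.integrable.const_mul _).lintegral_lt_top

lemma IsTail.measureReal_sqImage (h : IsTail m G) {u v : ℝ} (hu : 0 ≤ u) :
    (sqImage (fun s => 2 / s) G) (Ioc u v) < ∞ ∧
      (sqImage (fun s => 2 / s) G).real (Ioc u v) =
        ∫ s, (Ioc √u √v).indicator (fun s => 2 / s) s ∂G := by
  have hk : Measurable fun s : ℝ => 2 / s := by fun_prop
  constructor
  · have h1 : (sqImage (fun s => 2 / s) G) (Ioc u v) ≤
        ∫⁻ t, ENNReal.ofReal (1 + |v|) * ENNReal.ofReal ((1 + t)⁻¹) ∂(sqImage (fun s => 2 / s) G) := by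
      rw [← lintegral_indicator_one measurableSet_Ioc]
      refine lintegral_mono fun t => ?_
      by_cases ht : t ∈ Ioc u v
      · have ht0 : 0 < t := hu.trans_lt ht.1
        rw [indicator_of_mem ht, Pi.one_apply, ← ENNReal.ofReal_mul (by positivity),
          ENNReal.one_le_ofReal, ← div_eq_mul_inv, le_div_iff₀ (by positivity), one_mul]
        have := ht.2.trans (le_abs_self v)
        linarith
      · rw [indicator_of_notMem ht]
        exact zero_le
    refine h1.trans_lt ?_
    rw [lintegral_const_mul _ (by fun_prop)]
    exact ENNReal.mul_lt_top ENNReal.ofReal_lt_top h.isSM.finite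
  · have h2 : ∀ᵐ s ∂G, ENNReal.ofReal (2 / s) * (Ioc u v).indicator 1 (s ^ 2) =
        ENNReal.ofReal ((Ioc √u √v).indicator (fun s => 2 / s) s) := by
      filter_upwards [h.ae_ge] with s hs
      have hs0 := h.pos.trans_le hs
      have h3 : s ^ 2 ∈ Ioc u v ↔ s ∈ Ioc √u √v := by
        rw [mem_Ioc, mem_Ioc, Real.sqrt_lt' hs0, Real.le_sqrt' hs0]
      by_cases h4 : s ∈ Ioc √u √v
      · rw [indicator_of_mem h4, indicator_of_mem (h3.2 h4), Pi.one_apply, mul_one]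
      · rw [indicator_of_notMem h4, indicator_of_notMem (fun h => h4 (h3.1 h))]
        simp
    rw [Measure.real, ← lintegral_indicator_one measurableSet_Ioc, lintegral_sqImage hk
      (measurable_one.indicator measurableSet_Ioc), lintegral_congr_ae h2,
      integral_eq_lintegral_of_nonneg_ae]
    · filter_upwards [h.ae_ge] with s hs
      have hs0 := h.pos.trans_le hs
      exact indicator_nonneg (fun s hs => by
        have : 0 < s := (Real.sqrt_nonneg u).trans_lt hs.1
        positivity) s
    · exact (hk.indicator measurableSet_Ioc).aestronglyMeasurable

/-- Substitution `q = y²`. -/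
lemma setIntegral_comp_sqrt_div {u v : ℝ} (hu : 0 ≤ u) (F : ℝ → ℝ) :
    ∫ q in Ioc u v, F √q / q = ∫ y in Ioc √u √v, 2 / y * F y := by
  have himage : (fun y : ℝ => y ^ 2) '' Ioc √u √v = Ioc u v := by
    ext q
    constructor
    · rintro ⟨y, hy, rfl⟩
      have hy0 : 0 < y := (Real.sqrt_nonneg u).trans_lt hy.1
      exact ⟨(Real.sqrt_lt' hy0).1 hy.1, (Real.le_sqrt' hy0).1 hy.2⟩
    · intro hq
      exact ⟨√q, ⟨Real.sqrt_lt_sqrt hu hq.1, Real.sqrt_le_sqrt hq.2⟩,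
        Real.sq_sqrt (hu.trans hq.1.le)⟩
  have hpos {y : ℝ} (hy : y ∈ Ioc √u √v) : 0 < y := (Real.sqrt_nonneg u).trans_lt hy.1
  rw [← himage, integral_image_eq_integral_abs_deriv_smul (f' := fun y => 2 * y) measurableSet_Ioc
    (fun y _ => ((hasDerivAt_pow 2 y).congr_deriv (by simp)).hasDerivWithinAt)
    (fun y hy z hz hyz => (pow_left_inj₀ (hpos hy).le (hpos hz).le two_ne_zero).1 hyz)]
  refine setIntegral_congr_fun measurableSet_Ioc fun y hy => ?_
  have hy0 := hpos hy
  simp only [smul_eq_mul]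
  rw [Real.sqrt_sq hy0.le, abs_of_pos (by positivity)]
  field_simp

end Inversion

/-! ### Gaussian variance mixtures and exponential tilting -/

section Mixture

variable {Ω : Type*} [MeasurableSpace Ω] {P : Measure Ω}

lemma integral_exp_mul_gaussianReal (c : ℂ) :
    Integrable (fun y : ℝ => Complex.exp (c * y)) (gaussianReal 0 1) ∧
      ∫ y : ℝ, Complex.exp (c * y) ∂(gaussianReal 0 1) = Complex.exp (c ^ 2 / 2) := by
  constructor
  · refine (integrable_exp_mul_gaussianReal c.re).mono' (by fun_prop) (ae_of_all _ fun y => ?_)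
    rw [Complex.norm_exp]
    simp
  · have := complexMGF_id_gaussianReal (μ := 0) (v := 1) c
    simpa [complexMGF] using this

/-- The law of `√(2V) N` with a standard normal `N` independent of `V`. -/
noncomputable def mixtureLaw (P : Measure Ω) (V : Ω → ℝ≥0) : Measure ℝ :=
  (P.prod (gaussianReal 0 1)).map fun p => √(2 * V p.1) * p.2

variable {V : Ω → ℝ≥0}

lemma isProbabilityMeasure_mixtureLaw [IsProbabilityMeasure P] (hV : Measurable V) :
    IsProbabilityMeasure (mixtureLaw P V) :=
  Measure.isProbabilityMeasure_map (by fun_prop)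

/-- Given `V`, the variable is centred Gaussian with variance `2V`. The modulus of `e^{cy}` depends
only on `Re c`, so an exponential moment of `V` of the order `(Re c)²` is enough. -/
lemma integral_exp_mixtureLaw [IsProbabilityMeasure P] (hV : Measurable V) {c : ℂ}
    (hc : Integrable (fun ω => Complex.exp (((c.re ^ 2 : ℝ) : ℂ) * (V ω : ℝ))) P) :
    Integrable (fun y : ℝ => Complex.exp (c * y)) (mixtureLaw P V) ∧
      ∫ y, Complex.exp (c * y) ∂(mixtureLaw P V) =
        ∫ ω, Complex.exp (c ^ 2 * (V ω : ℝ)) ∂P := by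
  have hm : Measurable fun p : Ω × ℝ => √(2 * V p.1) * p.2 := by fun_prop
  have hsq (d : ℂ) (ω : Ω) : (d * (√(2 * V ω) : ℝ)) ^ 2 / 2 = d ^ 2 * (V ω : ℝ) := by
    rw [mul_pow, ← Complex.ofReal_pow, Real.sq_sqrt (by positivity)]
    push_cast
    ring
  have hassoc (d : ℂ) (p : Ω × ℝ) : Complex.exp (d * ((√(2 * V p.1) * p.2 : ℝ) : ℂ)) =
      Complex.exp (d * (√(2 * V p.1) : ℝ) * p.2) := by
    push_cast
    rw [mul_assoc]
  have hint : Integrable (fun p : Ω × ℝ => Complex.exp (c * (√(2 * V p.1) : ℝ) * p.2))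
      (P.prod (gaussianReal 0 1)) := by
    rw [integrable_prod_iff (by fun_prop)]
    refine ⟨ae_of_all _ fun ω => (integral_exp_mul_gaussianReal (c * (√(2 * V ω) : ℝ))).1, ?_⟩
    refine hc.norm.congr (ae_of_all _ fun ω => ?_)
    have h1 : ∀ y : ℝ, ‖Complex.exp (c * (√(2 * V ω) : ℝ) * y)‖ =
        (Complex.exp (((c.re : ℝ) : ℂ) * (√(2 * V ω) : ℝ) * y)).re := by
      intro y
      rw [Complex.norm_exp, ← Complex.ofReal_mul, ← Complex.ofReal_mul, Complex.exp_ofReal_re]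
      simp
    have h2 := integral_exp_mul_gaussianReal ((c.re : ℂ) * (√(2 * V ω) : ℝ))
    have h3 := integral_re h2.1
    simp only [RCLike.re_to_complex] at h3
    simp_rw [h1]
    rw [h3, h2.2, hsq, ← Complex.ofReal_pow, ← Complex.ofReal_mul, Complex.exp_ofReal_re,
      Complex.norm_exp, Complex.ofReal_re]
  constructor
  · rw [mixtureLaw, integrable_map_measure (by fun_prop) hm.aemeasurable]
    exact hint.congr (ae_of_all _ fun p => (hassoc c p).symm)
  · rw [mixtureLaw, integral_map hm.aemeasurable (by fun_prop)]
    simp_rw [hassoc c]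
    rw [integral_prod _ hint]
    refine integral_congr_ae (ae_of_all _ fun ω => ?_)
    simp only
    rw [(integral_exp_mul_gaussianReal _).2, hsq]

lemma integrable_exp_real_iff {μ : Measure ℝ} {a : ℝ} :
    Integrable (fun y => Real.exp (a * y)) μ ↔
      Integrable (fun y : ℝ => Complex.exp ((a : ℂ) * y)) μ := by
  have h : (fun y : ℝ => Complex.exp ((a : ℂ) * y)) = fun y => ((Real.exp (a * y) : ℝ) : ℂ) := by
    ext y
    push_cast
    rfl
  rw [h]
  refine ⟨fun h => h.ofReal, fun h => h.re.congr (ae_of_all _ fun y => ?_)⟩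
  exact Complex.ofReal_re _

lemma mul_charFun_tilted {ν : Measure ℝ} [NeZero ν] {a : ℝ}
    (hν : Integrable (fun y => Real.exp (a * y)) ν) (ξ : ℝ) :
    (∫ y, Real.exp (a * y) ∂ν : ℝ) * charFun (ν.tilted fun y => a * y) ξ =
      ∫ y : ℝ, Complex.exp ((Complex.I * ξ + a) * y) ∂ν := by
  set M := ∫ y, Real.exp (a * y) ∂ν
  have hM : 0 < M := integral_exp_pos hν
  rw [charFun_apply, integral_tilted, ← integral_const_mul]
  refine integral_congr_ae (ae_of_all _ fun y => ?_)
  have hM' : (M : ℂ) ≠ 0 := by exact_mod_cast hM.ne'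
  simp only [RCLike.inner_apply, conj_trivial, Complex.real_smul]
  change (M : ℂ) * (((Real.exp (a * y) / M : ℝ) : ℂ) * _) = _
  push_cast
  rw [div_mul_eq_mul_div, mul_div_cancel₀ _ hM', ← Complex.exp_add]
  ring_nf

/-- The tilted law is identified by its characteristic function off the origin, up to a constant. -/
lemma eq_tilted_of_charFun_eq {μ ν : Measure ℝ} [IsProbabilityMeasure μ] [IsProbabilityMeasure ν]
    {a : ℝ} {C : ℂ} (hν : Integrable (fun y => Real.exp (a * y)) ν)
    (h : ∀ ξ : ℝ, ξ ≠ 0 → charFun μ ξ = C * ∫ y : ℝ, Complex.exp ((Complex.I * ξ + a) * y) ∂ν) :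
    μ = ν.tilted fun y => a * y := by
  have hprob := isProbabilityMeasure_tilted hν
  set M := ∫ y, Real.exp (a * y) ∂ν
  have h1 (ξ : ℝ) : ∫ y : ℝ, Complex.exp ((Complex.I * ξ + a) * y) ∂ν =
      M * charFun (ν.tilted fun y => a * y) ξ := (mul_charFun_tilted hν ξ).symm
  have h2 (ξ : ℝ) (hξ : ξ ≠ 0) : charFun μ ξ = C * M * charFun (ν.tilted fun y => a * y) ξ := by
    rw [h ξ hξ, h1, mul_assoc]
  -- Characteristic functions are continuous with value one at the origin, so the constant is forced
  -- although the identity is assumed only for `ξ ≠ 0`.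
  have hCM : C * M = 1 := by
    have l1 : Tendsto (charFun μ) (𝓝[≠] 0) (𝓝 1) := by
      have := (continuous_charFun (μ := μ)).tendsto 0
      rw [charFun_zero, probReal_univ, Complex.ofReal_one] at this
      exact this.mono_left nhdsWithin_le_nhds
    have l2 : Tendsto (fun ξ => C * M * charFun (ν.tilted fun y => a * y) ξ) (𝓝[≠] 0)
        (𝓝 (C * M * 1)) := by
      have := (continuous_charFun (μ := ν.tilted fun y => a * y)).tendsto 0
      rw [charFun_zero, probReal_univ, Complex.ofReal_one] at this
      exact (this.const_mul _).mono_left nhdsWithin_le_nhds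
    have l3 : Tendsto (charFun μ) (𝓝[≠] 0) (𝓝 (C * M * 1)) := by
      refine l2.congr' ?_
      filter_upwards [self_mem_nhdsWithin] with ξ hξ using (h2 ξ hξ).symm
    have := tendsto_nhds_unique l3 l1
    rwa [mul_one] at this
  refine Measure.ext_of_charFun (funext fun ξ => ?_)
  by_cases hξ : ξ = 0
  · rw [hξ, charFun_zero, charFun_zero, probReal_univ, probReal_univ]
  · rw [h2 ξ hξ, hCM, one_mul]

end Mixture

/-! ### The Esscher transform of a Lévy process -/

section Esscher

variable {Ω : Type*} [MeasurableSpace Ω] {P : Measure Ω} [IsProbabilityMeasure P]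
  {X : ℝ≥0 → Ω → ℝ} {β : ℝ} {μ : ℝ≥0 → Measure ℝ} [∀ t, IsProbabilityMeasure (μ t)]

lemma IsLevyProcess.map_increments (h : IsLevyProcess X P) {n : ℕ} {τ : ℕ → ℝ≥0}
    (hτ : Monotone τ) :
    P.map (fun ω (k : Fin n) => X (τ (k + 1)) ω - X (τ k) ω) =
      Measure.pi fun k : Fin n => P.map (X (τ (k + 1) - τ k)) := by
  have h1 := h.indep n (fun k => τ k) (fun a b hab => hτ hab)
  rw [iIndepFun_iff_map_fun_eq_pi_map fun k =>
    aemeasurable_increment (fun t => (h.measurable t).aemeasurable) _ _] at h1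
  simp only [Fin.val_succ, Fin.val_castSucc] at h1
  rw [h1]
  congr 1
  ext1 k
  have h2 := (h.stationary (τ k) (τ (k + 1) - τ k)).map_eq
  rwa [add_tsub_cancel_of_le (hτ (Nat.le_succ k))] at h2

/-- This is how the Esscher transform is seen to be well defined: after tilting by `e^{-βy}`, the
function `e^{βy}` is integrable for free. -/
lemma integrable_exp_mul_tilted_neg {ν : Measure ℝ} [IsProbabilityMeasure ν]
    (hν : Integrable (fun y => Real.exp (-β * y)) ν) :
    Integrable (fun y => Real.exp (β * y)) (ν.tilted fun y => -β * y) ∧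
      (ν.tilted fun y => -β * y).tilted (fun y => β * y) = ν := by
  constructor
  · rw [integrable_tilted_iff hν]
    refine (integrable_const (1 : ℝ)).congr (ae_of_all _ fun y => ?_)
    simp only [smul_eq_mul]
    rw [← Real.exp_add]
    simp
  · have := tilted_neg_same hν
    have h2 : (-fun y : ℝ => -β * y) = fun y => β * y := by
      ext y
      simp
    rwa [h2] at this

variable (hX : IsLevyProcess X P) (hμ : ∀ t, Integrable (fun y => Real.exp (-β * y)) (μ t))
  (hlaw : ∀ t, P.map (X t) = (μ t).tilted fun y => -β * y)

include hX hμ hlaw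

omit [IsProbabilityMeasure P] in
lemma integrable_exp_mul_levy (t : ℝ≥0) : Integrable (fun ω => Real.exp (β * X t ω)) P := by
  have h1 := (integrable_exp_mul_tilted_neg (hμ t)).1
  rw [← hlaw t, integrable_map_measure (by fun_prop) (hX.measurable t).aemeasurable] at h1
  exact h1

/-- Since `X_T` with `T = τ n` is almost surely the sum of the increments, the density `e^{βX_T}`
factors along them. Each increment is tilted separately, which cancels the tilt in `hlaw`. -/
lemma integral_exp_increments_esscher {n : ℕ} {τ : ℕ → ℝ≥0} (hτ : Monotone τ) (h0 : τ 0 = 0)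
    (θ : Fin n → ℝ) :
    ∫ ω, Complex.exp (∑ k : Fin n, Complex.I * θ k *
        ((X (τ (k + 1)) ω - X (τ k) ω : ℝ) : ℂ)) ∂(esscher P X β (τ n)) =
      ∏ k : Fin n, charFun (μ (τ (k + 1) - τ k)) (θ k) := by
  set V : Ω → Fin n → ℝ := fun ω k => X (τ (k + 1)) ω - X (τ k) ω with hV
  have hVm : Measurable V :=
    measurable_pi_lambda _ fun k => (hX.measurable _).sub (hX.measurable _)
  set L : Fin n → Measure ℝ := fun k => P.map (X (τ (k + 1) - τ k)) with hL
  have hLprob (k : Fin n) : IsProbabilityMeasure (L k) :=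
    Measure.isProbabilityMeasure_map (hX.measurable _).aemeasurable
  have hmap : P.map V = Measure.pi L := hX.map_increments hτ
  have hLi (k : Fin n) : Integrable (fun y => Real.exp (β * y)) (L k) := by
    simp only [hL, hlaw]
    exact (integrable_exp_mul_tilted_neg (hμ _)).1
  have hsum : ∀ᵐ ω ∂P, X (τ n) ω = ∑ k, V ω k := by
    filter_upwards [hX.zero] with ω hω
    have h1 := Finset.sum_range_sub (fun k => X (τ k) ω) n
    rw [h0, hω, sub_zero, Finset.sum_range] at h1
    exact h1.symm
  have hM : ∫ ω, Real.exp (β * X (τ n) ω) ∂P = ∏ k, ∫ y, Real.exp (β * y) ∂(L k) := by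
    have h1 : ∫ ω, Real.exp (β * X (τ n) ω) ∂P = ∫ x, ∏ k, Real.exp (β * x k) ∂(P.map V) := by
      rw [integral_map hVm.aemeasurable (Measurable.aestronglyMeasurable
        (Finset.measurable_fun_prod _ fun k _ => by fun_prop))]
      refine integral_congr_ae ?_
      filter_upwards [hsum] with ω hω
      rw [hω, Finset.mul_sum, Real.exp_sum]
    rw [h1, hmap, integral_fintype_prod_eq_prod (f := fun _ y => Real.exp (β * y))]
  have hnum : ∫ ω, Complex.exp (β * X (τ n) ω) * Complex.exp (∑ k, Complex.I * θ k * V ω k) ∂P =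
      ∏ k, ∫ y : ℝ, Complex.exp ((Complex.I * θ k + β) * y) ∂(L k) := by
    have h1 : ∫ ω, Complex.exp (β * X (τ n) ω) * Complex.exp (∑ k, Complex.I * θ k * V ω k) ∂P =
        ∫ x, ∏ k, Complex.exp ((Complex.I * θ k + β) * x k) ∂(P.map V) := by
      rw [integral_map hVm.aemeasurable (Measurable.aestronglyMeasurable
        (Finset.measurable_fun_prod _ fun k _ => by fun_prop))]
      refine integral_congr_ae ?_
      filter_upwards [hsum] with ω hω
      rw [hω, ← Complex.exp_add, ← Complex.exp_sum]
      push_cast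
      rw [Finset.mul_sum, ← Finset.sum_add_distrib]
      congr 1
      refine Finset.sum_congr rfl fun k _ => ?_
      ring
    rw [h1, hmap, integral_fintype_prod_eq_prod
      (f := fun k (y : ℝ) => Complex.exp ((Complex.I * θ k + β) * y))]
  have hchar (k : Fin n) : ∫ y : ℝ, Complex.exp ((Complex.I * θ k + β) * y) ∂(L k) =
      (∫ y, Real.exp (β * y) ∂(L k) : ℝ) * charFun (μ (τ (k + 1) - τ k)) (θ k) := by
    rw [← mul_charFun_tilted (hLi k)]
    congr 2
    simp only [hL, hlaw]
    exact (integrable_exp_mul_tilted_neg (hμ _)).2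
  set M := ∫ ω, Real.exp (β * X (τ n) ω) ∂P with hMdef
  have hM0 : (M : ℂ) ≠ 0 := by
    exact_mod_cast (integral_exp_pos (integrable_exp_mul_levy hX hμ hlaw (τ n))).ne'
  simp_rw [hchar] at hnum
  rw [Finset.prod_mul_distrib, ← Complex.ofReal_prod, ← hM] at hnum
  rw [esscher, integral_tilted]
  have h2 : ∀ ω, (Real.exp (β * X (τ n) ω) / ∫ ω, Real.exp (β * X (τ n) ω) ∂P) •
      Complex.exp (∑ k, Complex.I * θ k * V ω k) = (M : ℂ)⁻¹ * (Complex.exp (β * X (τ n) ω) *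
        Complex.exp (∑ k, Complex.I * θ k * V ω k)) := by
    intro ω
    rw [Complex.real_smul, ← hMdef]
    push_cast
    ring
  change ∫ ω, (Real.exp (β * X (τ n) ω) / ∫ ω, Real.exp (β * X (τ n) ω) ∂P) •
      Complex.exp (∑ k, Complex.I * θ k * V ω k) ∂P = _
  simp_rw [h2]
  rw [integral_const_mul, hnum, inv_mul_cancel_left₀ hM0]

theorem isProbabilityMeasure_esscher (T : ℝ≥0) : IsProbabilityMeasure (esscher P X β T) :=
  isProbabilityMeasure_tilted (integrable_exp_mul_levy hX hμ hlaw T)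

theorem map_increments_esscher {n : ℕ} {τ : ℕ → ℝ≥0} (hτ : Monotone τ) (h0 : τ 0 = 0) :
    (esscher P X β (τ n)).map (fun ω (k : Fin n) => X (τ (k + 1)) ω - X (τ k) ω) =
      Measure.pi fun k : Fin n => μ (τ (k + 1) - τ k) := by
  have := isProbabilityMeasure_esscher hX hμ hlaw (τ n)
  exact map_eq_pi_of_integral_exp
    (fun k => ((hX.measurable _).sub (hX.measurable _)).aemeasurable) _
    fun θ => integral_exp_increments_esscher hX hμ hlaw hτ h0 θ

theorem integral_exp_esscher {t T : ℝ≥0} (htT : t ≤ T) (ξ : ℝ) :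
    ∫ ω, Complex.exp (Complex.I * ξ * X t ω) ∂(esscher P X β T) = charFun (μ t) ξ := by
  -- The partition `0, t, T`, with frequency `ξ` on the first interval and `0` on the second.
  set τ : ℕ → ℝ≥0 := fun k => if k = 0 then 0 else if k = 1 then t else T with hτ
  have hmono : Monotone τ := by
    refine monotone_nat_of_le_succ fun k => ?_
    rcases k with _ | _ | k <;> simp [hτ, htT]
  have h1 := integral_exp_increments_esscher hX hμ hlaw (n := 2) hmono (by simp [hτ]) ![ξ, 0]
  have hac : esscher P X β T ≪ P := tilted_absolutelyContinuous P _
  simp only [hτ, Fin.sum_univ_two, Fin.prod_univ_two] at h1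
  simp at h1
  rw [← h1]
  refine integral_congr_ae ?_
  filter_upwards [hac.ae_le hX.zero] with ω hω
  rw [hω]
  simp

end Esscher

/-! ### Finite-dimensional distributions from the increments -/

section FiniteDim

variable {Ω Ω' : Type*} [MeasurableSpace Ω] [MeasurableSpace Ω'] {P : Measure Ω} {P' : Measure Ω'}
  {X : ℝ≥0 → Ω → ℝ} {Y : ℝ≥0 → Ω' → ℝ}

/-- The density of the Esscher measure involves the horizon `T`, so the partition has to end at `T`
even if `T` is not in `I`. The point `0` is put in front, hence the index shift by one. -/
lemma exists_partition {T : ℝ≥0} {I : Finset ℝ≥0} (hI : ∀ t ∈ I, t ≤ T) :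
    ∃ τ : ℕ → ℝ≥0, Monotone τ ∧ τ 0 = 0 ∧ τ (I.card + 1) = T ∧
      ∃ idx : I → ℕ, ∀ t : I, idx t ≤ I.card ∧ τ (idx t) = t := by
  set e := I.orderIsoOfFin rfl
  set τ : ℕ → ℝ≥0 := fun k => if k = 0 then 0 else
    if h : k - 1 < I.card then (e ⟨k - 1, h⟩ : ℝ≥0) else T with hτ
  refine ⟨τ, ?_, by simp [hτ], by simp [hτ], fun t => e.symm t + 1, fun t => ⟨?_, ?_⟩⟩
  · refine monotone_nat_of_le_succ fun k => ?_
    rcases k with _ | k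
    · simp [hτ]
    · simp only [hτ, Nat.add_one_ne_zero, if_false, Nat.add_sub_cancel]
      by_cases h1 : k + 1 < I.card
      · have h2 : k < I.card := by omega
        rw [dif_pos h1, dif_pos h2, Subtype.coe_le_coe, e.le_iff_le, Fin.mk_le_mk]
        omega
      · rw [dif_neg h1]
        by_cases h2 : k < I.card
        · rw [dif_pos h2]
          exact hI _ (e ⟨k, h2⟩).2
        · rw [dif_neg h2]
  · exact Nat.succ_le_of_lt (e.symm t).2
  · simp [hτ]

theorem identDistrib_restrict (hX : ∀ t, AEMeasurable (X t) P) (hY : ∀ t, AEMeasurable (Y t) P')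
    (hX0 : ∀ᵐ ω ∂P, X 0 ω = 0) (hY0 : ∀ᵐ ω ∂P', Y 0 ω = 0) {T : ℝ≥0}
    (h : ∀ (n : ℕ) (τ : ℕ → ℝ≥0), Monotone τ → τ 0 = 0 → τ n = T →
      P.map (fun ω (k : Fin n) => X (τ (k + 1)) ω - X (τ k) ω) =
        P'.map (fun ω (k : Fin n) => Y (τ (k + 1)) ω - Y (τ k) ω))
    {I : Finset ℝ≥0} (hI : ∀ t ∈ I, t ≤ T) :
    IdentDistrib (fun ω => I.restrict fun t => X t ω) (fun ω => I.restrict fun t => Y t ω) P P' := by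
  obtain ⟨τ, hmono, h0, hT, idx, hidx⟩ := exists_partition hI
  -- Partial sums of the increments recover the values at the times of `I`.
  set g : (Fin (I.card + 1) → ℝ) → I → ℝ := fun v t =>
    ∑ j : Fin (I.card + 1), if (j : ℕ) < idx t then v j else 0 with hg
  have hgm : Measurable g := by
    refine measurable_pi_lambda _ fun t => Finset.measurable_fun_sum
      (f := fun (j : Fin (I.card + 1)) (v : Fin (I.card + 1) → ℝ) => if (j : ℕ) < idx t then v j else 0) _ fun j _ => ?_
    by_cases hj : (j : ℕ) < idx t
    · simp only [hj, if_true]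
      exact measurable_pi_apply j
    · simp only [hj, if_false]
      exact measurable_const
  have key (f : ℝ≥0 → ℝ) (hf : f 0 = 0) (t : I) :
      f t = g (fun k : Fin (I.card + 1) => f (τ (k + 1)) - f (τ k)) t := by
    have h1 := Finset.sum_range_sub (fun k => f (τ k)) (idx t)
    rw [h0, hf, sub_zero, (hidx t).2] at h1
    rw [← h1]
    simp only [hg]
    rw [← Finset.sum_range (fun k => if k < idx t then f (τ (k + 1)) - f (τ k) else 0),
      ← Finset.sum_filter]
    refine Finset.sum_congr ?_ fun _ _ => rfl
    ext k
    have := (hidx t).1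
    simp only [Finset.mem_range, Finset.mem_filter]
    omega
  have eX : (fun ω => I.restrict fun t => X t ω) =ᵐ[P]
      fun ω => g fun k : Fin (I.card + 1) => X (τ (k + 1)) ω - X (τ k) ω := by
    filter_upwards [hX0] with ω hω
    ext t
    exact key (fun t => X t ω) hω t
  have eY : (fun ω => I.restrict fun t => Y t ω) =ᵐ[P']
      fun ω => g fun k : Fin (I.card + 1) => Y (τ (k + 1)) ω - Y (τ k) ω := by
    filter_upwards [hY0] with ω hω
    ext t
    exact key (fun t => Y t ω) hω t
  have mX : AEMeasurable (fun ω (k : Fin (I.card + 1)) => X (τ (k + 1)) ω - X (τ k) ω) P :=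
    aemeasurable_pi_lambda _ fun k => (hX _).sub (hX _)
  have mY : AEMeasurable (fun ω (k : Fin (I.card + 1)) => Y (τ (k + 1)) ω - Y (τ k) ω) P' :=
    aemeasurable_pi_lambda _ fun k => (hY _).sub (hY _)
  have hid : IdentDistrib (fun ω (k : Fin (I.card + 1)) => X (τ (k + 1)) ω - X (τ k) ω)
      (fun ω (k : Fin (I.card + 1)) => Y (τ (k + 1)) ω - Y (τ k) ω) P P' :=
    ⟨mX, mY, h _ τ hmono h0 hT⟩
  have aX : AEMeasurable (fun ω => I.restrict fun t => X t ω) P :=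
    (hgm.comp_aemeasurable mX).congr eX.symm
  have aY : AEMeasurable (fun ω => I.restrict fun t => Y t ω) P' :=
    (hgm.comp_aemeasurable mY).congr eY.symm
  exact (IdentDistrib.of_ae_eq aX eX).trans
    ((hid.comp hgm).trans (IdentDistrib.of_ae_eq aY eY).symm)

end FiniteDim

/-! ### Subordinated Brownian motion -/

section Subordination

variable {Ω : Type*} [MeasurableSpace Ω] {P : Measure Ω} [IsProbabilityMeasure P]
  {Z : ℝ≥0 → Ω → ℝ≥0} {W : ℝ≥0 → Ω → ℝ} {Ψ : ℂ → ℂ}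

omit [IsProbabilityMeasure P] in
lemma HasIndepIncrements.integral_exp {X : ℝ≥0 → Ω → ℝ} (h : HasIndepIncrements X P)
    (hX : ∀ t, AEMeasurable (X t) P) {n : ℕ} {t : Fin (n + 1) → ℝ≥0} (ht : Monotone t)
    (c : Fin n → ℂ) :
    ∫ ω, Complex.exp (∑ k, c k * ((X (t k.succ) ω - X (t k.castSucc) ω : ℝ) : ℂ)) ∂P =
      ∏ k, ∫ ω, Complex.exp (c k * ((X (t k.succ) ω - X (t k.castSucc) ω : ℝ) : ℂ)) ∂P := by
  rw [← (h n t ht).integral_fun_prod_comp (fun k => aemeasurable_increment hX _ _)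
    (f := fun k (y : ℝ) => Complex.exp (c k * y)) fun k => by fun_prop]
  simp_rw [Complex.exp_sum]

omit [IsProbabilityMeasure P] in
lemma integral_exp_increment_brownian (hW : IsPreBrownianReal W P) {s t : ℝ≥0} (hst : s ≤ t)
    (θ : ℝ) : ∫ ω, Complex.exp (Complex.I * θ * (√2 : ℝ) * ((W t ω - W s ω : ℝ) : ℂ)) ∂P =
      Complex.exp (-(θ ^ 2 * ((t : ℝ) - (s : ℝ) : ℝ))) := by
  have h1 := hW.hasLaw_sub t s
  have h2 : ∫ ω, Complex.exp (Complex.I * θ * (√2 : ℝ) * ((W t ω - W s ω : ℝ) : ℂ)) ∂P =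
      ∫ y : ℝ, Complex.exp (Complex.I * θ * (√2 : ℝ) * y)
        ∂(gaussianReal 0 (nndist t.1 s.1)) := by
    rw [← h1.map_eq, integral_map h1.aemeasurable (by fun_prop)]
    rfl
  have h3 := complexMGF_id_gaussianReal (μ := 0) (v := nndist t.1 s.1)
    (Complex.I * θ * (√2 : ℝ))
  have h4 : ((nndist t.1 s.1 : ℝ≥0) : ℝ) = t - s := by
    rw [coe_nndist, Real.dist_eq, abs_of_nonneg]
    · rfl
    · exact sub_nonneg.2 hst
  rw [h2]
  refine h3.trans ?_
  have h5 : ((√2 : ℝ) : ℂ) ^ 2 = 2 := by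
    rw [← Complex.ofReal_pow, Real.sq_sqrt zero_le_two]
    norm_num
  rw [h4, mul_pow, mul_pow, h5, Complex.I_sq]
  congr 1
  push_cast
  ring

omit [IsProbabilityMeasure P] in
lemma IsSubordinator.measurable (h : IsSubordinator Z P) (t : ℝ≥0) : Measurable (Z t) := by
  have := (IsLevyProcess.measurable h t).real_toNNReal
  simpa using this

omit [IsProbabilityMeasure P] in
-- The increment has the law of `Z_{t-s}`, which is nonnegative. The null set depends on `s` and
-- `t`, so only finitely many times are compared at once.
lemma IsSubordinator.ae_le (h : IsSubordinator Z P) {s t : ℝ≥0} (hst : s ≤ t) :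
    ∀ᵐ ω ∂P, Z s ω ≤ Z t ω := by
  have h1 := h.stationary s (t - s)
  rw [add_tsub_cancel_of_le hst] at h1
  have h2 := h1.symm.ae_snd (p := fun y : ℝ => 0 ≤ y) measurableSet_Ici
    (ae_of_all _ fun ω => by simp)
  filter_upwards [h2] with ω hω
  exact_mod_cast sub_nonneg.1 hω

omit [IsProbabilityMeasure P] in
lemma integral_exp_increment_subordinator (hZ : IsSubordinator Z P)
    (hΨ : HasLaplaceExponent Z P Ψ) {s t : ℝ≥0} (hst : s ≤ t) {q : ℝ} (hq : 0 ≤ q) :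
    ∫ ω, Complex.exp (-(q : ℂ) * (((Z t ω : ℝ) - (Z s ω : ℝ) : ℝ) : ℂ)) ∂P =
      Complex.exp (-((t - s : ℝ≥0) * Ψ q)) := by
  have h1 := hZ.stationary s (t - s)
  rw [add_tsub_cancel_of_le hst] at h1
  have h2 := (h1.comp (u := fun y : ℝ => Complex.exp (-(q : ℂ) * y)) (by fun_prop)).integral_eq
  simp only [Function.comp_def] at h2
  rw [h2, ← hΨ _ q hq, ← integral_complex_ofReal]
  congr 1
  ext ω
  push_cast
  rw [neg_mul]

/-- Jointly measurable functionals of a discrete variable and an independent path, integrated in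
two steps. -/
lemma IndepFun.integral_eq_integral_integral {α β : Type*} [MeasurableSpace α] [MeasurableSpace β]
    {f : Ω → α} {g : Ω → β} (h : IndepFun f g P) (hf : AEMeasurable f P) (hg : AEMeasurable g P)
    {F : α × β → ℂ} (hF : Measurable F) {C : ℝ} (hC : ∀ p, ‖F p‖ ≤ C) :
    ∫ ω, F (f ω, g ω) ∂P = ∫ ω, (∫ ω', F (f ω, g ω') ∂P) ∂P := by
  have p1 := Measure.isProbabilityMeasure_map hf
  have p2 := Measure.isProbabilityMeasure_map hg
  rw [← integral_map (f := F) (hf.prodMk hg) hF.aestronglyMeasurable,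
    (indepFun_iff_map_prod_eq_prod_map_map hf hg).1 h,
    integral_prod _ (Integrable.of_bound hF.aestronglyMeasurable C (ae_of_all _ hC)),
    integral_map hf hF.stronglyMeasurable.integral_prod_right'.aestronglyMeasurable]
  refine integral_congr_ae (ae_of_all _ fun ω => ?_)
  exact integral_map hg (hF.comp measurable_prodMk_left).aestronglyMeasurable

/-- The time `z` rounded up to the grid of mesh `1 / r`. -/
noncomputable def gridIndex (r : ℕ) (z : ℝ≥0) : ℕ := ⌈(z : ℝ≥0) * r⌉₊

lemma gridIndex_mono (r : ℕ) : Monotone (gridIndex r) := fun a b hab => by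
  unfold gridIndex
  gcongr

lemma measurable_gridIndex (r : ℕ) : Measurable (gridIndex r) :=
  Nat.measurable_ceil.comp (by fun_prop)

lemma tendsto_gridIndex (z : ℝ≥0) :
    Tendsto (fun r : ℕ => (gridIndex r z : ℝ≥0) / r) atTop (𝓝 z) := by
  rw [← NNReal.tendsto_coe]
  have h := (tendsto_nat_ceil_mul_div_atTop (R := ℝ) z.2).comp tendsto_natCast_atTop_atTop
  refine h.congr fun r => ?_
  have h1 : ⌈((z * r : ℝ≥0) : ℝ)⌉₊ = ⌈z * (r : ℝ≥0)⌉₊ := by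
    refine eq_of_forall_ge_iff fun k => ?_
    rw [Nat.ceil_le, Nat.ceil_le]
    exact_mod_cast Iff.rfl
  simp only [Function.comp_apply, gridIndex]
  rw [← h1]
  push_cast
  rfl

variable (hZ : IsSubordinator Z P) (hW : IsBrownianReal W P)
  (hind : IndepFun (fun ω t => Z t ω) (fun ω t => W t ω) P)

include hZ hW

omit [IsProbabilityMeasure P] in
-- Evaluating a path at a random time is not measurable for the product σ-algebra over `ℝ≥0`, but it
-- is over a countable grid. Path continuity of `W` then passes to the limit.
lemma aemeasurable_grid (r : ℕ) (t : ℝ≥0) :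
    AEMeasurable (fun ω => W ((gridIndex r (Z t ω) : ℝ≥0) / r) ω) P := by
  have hg : AEMeasurable (fun ω (j : ℕ) => W ((j : ℝ≥0) / r) ω) P :=
    aemeasurable_pi_lambda _ fun j => hW.aemeasurable _
  have hf : Measurable fun ω => gridIndex r (Z t ω) :=
    (measurable_gridIndex r).comp (hZ.measurable t)
  have hF : Measurable fun p : ℕ × (ℕ → ℝ) => p.2 p.1 :=
    measurable_from_prod_countable_right fun j => measurable_pi_apply j
  exact hF.comp_aemeasurable (hf.aemeasurable.prodMk hg)

omit [IsProbabilityMeasure P] hZ in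
lemma tendsto_grid (t : ℝ≥0) : ∀ᵐ ω ∂P,
    Tendsto (fun r : ℕ => W ((gridIndex r (Z t ω) : ℝ≥0) / r) ω) atTop (𝓝 (W (Z t ω) ω)) := by
  filter_upwards [hW.cont] with ω hω
  exact (hω.tendsto _).comp (tendsto_gridIndex _)

omit [IsProbabilityMeasure P] in
lemma aemeasurable_subordinated (t : ℝ≥0) : AEMeasurable (fun ω => W (Z t ω) ω) P :=
  aemeasurable_of_tendsto_metrizable_ae atTop (fun r => aemeasurable_grid hZ hW r t)
    (tendsto_grid hW t)

include hind

/-- With the grid indices frozen, by independence of `Z` and `W`, the increments of `√2 W` are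
independent Gaussians with variance twice the grid time. -/
lemma integral_exp_grid (r : ℕ) {n : ℕ} {t : Fin (n + 1) → ℝ≥0} (ht : Monotone t)
    (θ : Fin n → ℝ) :
    ∫ ω, Complex.exp (∑ k : Fin n, Complex.I * θ k * (√2 : ℝ) *
        ((W ((gridIndex r (Z (t k.succ) ω) : ℝ≥0) / r) ω -
          W ((gridIndex r (Z (t k.castSucc) ω) : ℝ≥0) / r) ω : ℝ) : ℂ)) ∂P =
      ∫ ω, ∏ k : Fin n, Complex.exp (-(θ k ^ 2 *
        ((((gridIndex r (Z (t k.succ) ω) : ℝ≥0) / r : ℝ≥0) : ℝ) -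
          (((gridIndex r (Z (t k.castSucc) ω) : ℝ≥0) / r : ℝ≥0) : ℝ) : ℝ))) ∂P := by
  set f : Ω → Fin (n + 1) → ℕ := fun ω k => gridIndex r (Z (t k) ω) with hf
  set g : Ω → ℕ → ℝ := fun ω j => W ((j : ℝ≥0) / r) ω with hg
  set F : (Fin (n + 1) → ℕ) × (ℕ → ℝ) → ℂ := fun p =>
    Complex.exp (∑ k : Fin n, Complex.I * θ k * (√2 : ℝ) *
      ((p.2 (p.1 k.succ) - p.2 (p.1 k.castSucc) : ℝ) : ℂ)) with hF
  have hfm : Measurable f :=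
    measurable_pi_lambda _ fun k => (measurable_gridIndex r).comp (hZ.measurable (t k))
  have hgm : AEMeasurable g P := aemeasurable_pi_lambda _ fun j => hW.aemeasurable _
  have hFm : Measurable F := by
    refine measurable_from_prod_countable_right fun j => ?_
    simp only [hF]
    fun_prop
  have hFb (p : (Fin (n + 1) → ℕ) × (ℕ → ℝ)) : ‖F p‖ ≤ 1 := by
    simp only [hF]
    rw [Complex.norm_exp]
    refine (Real.exp_le_one_iff.2 (le_of_eq ?_))
    rw [Complex.re_sum]
    refine Finset.sum_eq_zero fun k _ => ?_
    simp
  have hfg : IndepFun f g P := hind.comp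
    (φ := fun (z : ℝ≥0 → ℝ≥0) (k : Fin (n + 1)) => gridIndex r (z (t k)))
    (ψ := fun (w : ℝ≥0 → ℝ) (j : ℕ) => w ((j : ℝ≥0) / r))
    (measurable_pi_lambda _ fun k => (measurable_gridIndex r).comp (measurable_pi_apply _))
    (measurable_pi_lambda _ fun j => measurable_pi_apply _)
  have h1 := IndepFun.integral_eq_integral_integral hfg hfm.aemeasurable hgm hFm hFb
  refine h1.trans (integral_congr_ae ?_)
  have hmono : ∀ᵐ ω ∂P, ∀ k : Fin n, Z (t k.castSucc) ω ≤ Z (t k.succ) ω :=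
    ae_all_iff.2 fun k => hZ.ae_le (ht (Fin.castSucc_lt_succ (i := k)).le)
  filter_upwards [hmono] with ω hω
  have hs : Monotone fun k : Fin (n + 1) => ((f ω k : ℝ≥0) / r) := by
    refine Fin.monotone_iff_le_succ.2 fun k => ?_
    have := gridIndex_mono r (hω k)
    simp only [hf]
    gcongr
  have h2 := HasIndepIncrements.integral_exp hW.hasIndepIncrements hW.aemeasurable hs
    fun k => Complex.I * θ k * (√2 : ℝ)
  simp only [hF, hg]
  rw [h2]
  refine Finset.prod_congr rfl fun k _ => ?_
  exact integral_exp_increment_brownian hW.toIsPreBrownianReal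
    (hs (Fin.castSucc_lt_succ (i := k)).le) (θ k)

/-- Both sides of the grid identity are bounded by one and converge as the mesh shrinks. The limit
on the right is a joint Laplace transform of the independent increments of `Z` at the points `θ k ^
2`. -/
theorem integral_exp_subordinated (hΨ : HasLaplaceExponent Z P Ψ) {n : ℕ}
    {t : Fin (n + 1) → ℝ≥0} (ht : Monotone t) (θ : Fin n → ℝ) :
    ∫ ω, Complex.exp (∑ k : Fin n, Complex.I * θ k * (√2 : ℝ) *
        ((W (Z (t k.succ) ω) ω - W (Z (t k.castSucc) ω) ω : ℝ) : ℂ)) ∂P =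
      ∏ k : Fin n, Complex.exp (-((t k.succ - t k.castSucc : ℝ≥0) * Ψ ((θ k ^ 2 : ℝ)))) := by
  have hmono : ∀ᵐ ω ∂P, ∀ k : Fin n, Z (t k.castSucc) ω ≤ Z (t k.succ) ω :=
    ae_all_iff.2 fun k => hZ.ae_le (ht (Fin.castSucc_lt_succ (i := k)).le)
  have hWt : ∀ᵐ ω ∂P, ∀ k : Fin (n + 1), Tendsto
      (fun r : ℕ => W ((gridIndex r (Z (t k) ω) : ℝ≥0) / r) ω) atTop (𝓝 (W (Z (t k) ω) ω)) :=
    ae_all_iff.2 fun k => tendsto_grid hW (t k)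
  have hL := tendsto_integral_of_dominated_convergence (μ := P) (fun _ => (1 : ℝ))
    (F := fun (r : ℕ) ω => Complex.exp (∑ k : Fin n, Complex.I * θ k * (√2 : ℝ) *
        ((W ((gridIndex r (Z (t k.succ) ω) : ℝ≥0) / r) ω -
          W ((gridIndex r (Z (t k.castSucc) ω) : ℝ≥0) / r) ω : ℝ) : ℂ)))
    (f := fun ω => Complex.exp (∑ k : Fin n, Complex.I * θ k * (√2 : ℝ) *
        ((W (Z (t k.succ) ω) ω - W (Z (t k.castSucc) ω) ω : ℝ) : ℂ)))
    (fun r => by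
      have h1 (k : Fin n) : AEMeasurable (fun ω =>
          W ((gridIndex r (Z (t k.succ) ω) : ℝ≥0) / r) ω -
          W ((gridIndex r (Z (t k.castSucc) ω) : ℝ≥0) / r) ω) P :=
        (aemeasurable_grid hZ hW r _).sub (aemeasurable_grid hZ hW r _)
      refine AEMeasurable.aestronglyMeasurable (Complex.measurable_exp.comp_aemeasurable ?_)
      refine Finset.aemeasurable_fun_sum _ fun k _ => ?_
      exact (Complex.measurable_ofReal.comp_aemeasurable (h1 k)).const_mul _)
    (integrable_const _)
    (fun r => ae_of_all _ fun ω => by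
      rw [Complex.norm_exp]
      refine (Real.exp_le_one_iff.2 (le_of_eq ?_))
      rw [Complex.re_sum]
      refine Finset.sum_eq_zero fun k _ => ?_
      simp)
    (by
      filter_upwards [hWt] with ω hω
      refine (Complex.continuous_exp.tendsto _).comp (tendsto_finsetSum _ fun k _ => ?_)
      refine Tendsto.const_mul _ ((Complex.continuous_ofReal.tendsto _).comp ?_)
      exact (hω k.succ).sub (hω k.castSucc))
  have hR := tendsto_integral_of_dominated_convergence (μ := P) (fun _ => (1 : ℝ))
    (F := fun (r : ℕ) ω => ∏ k : Fin n, Complex.exp (-(θ k ^ 2 *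
        ((((gridIndex r (Z (t k.succ) ω) : ℝ≥0) / r : ℝ≥0) : ℝ) -
          (((gridIndex r (Z (t k.castSucc) ω) : ℝ≥0) / r : ℝ≥0) : ℝ) : ℝ))))
    (f := fun ω => ∏ k : Fin n, Complex.exp (-(θ k ^ 2 *
        ((Z (t k.succ) ω : ℝ) - (Z (t k.castSucc) ω : ℝ) : ℝ))))
    (fun r => by
      have h1 (k : Fin (n + 1)) : Measurable fun ω =>
          (((gridIndex r (Z (t k) ω) : ℝ≥0) / r : ℝ≥0) : ℝ) :=
        (measurable_from_nat (f := fun j : ℕ => (((j : ℝ≥0) / r : ℝ≥0) : ℝ))).comp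
          ((measurable_gridIndex r).comp (hZ.measurable (t k)))
      refine (Finset.measurable_fun_prod _ fun k _ => ?_).aestronglyMeasurable
      exact Complex.measurable_exp.comp ((Complex.measurable_ofReal.comp
        ((h1 k.succ).sub (h1 k.castSucc))).const_mul _).neg)
    (integrable_const _)
    (fun r => by
      filter_upwards [hmono] with ω hω
      rw [norm_prod]
      refine Finset.prod_le_one (fun _ _ => norm_nonneg _) fun k _ => ?_
      rw [Complex.norm_exp, Real.exp_le_one_iff, ← Complex.ofReal_pow, ← Complex.ofReal_mul,
        ← Complex.ofReal_neg, Complex.ofReal_re, neg_nonpos]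
      refine mul_nonneg (sq_nonneg _) (sub_nonneg.2 ?_)
      have := gridIndex_mono r (hω k)
      rw [NNReal.coe_le_coe]
      gcongr)
    (by
      refine ae_of_all _ fun ω => tendsto_finsetProd _ fun k _ => ?_
      refine (Complex.continuous_exp.tendsto _).comp (Tendsto.neg (Tendsto.const_mul _ ?_))
      refine (Complex.continuous_ofReal.tendsto _).comp (Tendsto.sub ?_ ?_)
      · exact NNReal.tendsto_coe.2 (tendsto_gridIndex _)
      · exact NNReal.tendsto_coe.2 (tendsto_gridIndex _))
  have hLR := tendsto_nhds_unique hL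
    (hR.congr fun r => (integral_exp_grid hZ hW hind r ht θ).symm)
  rw [hLR]
  have h2 := HasIndepIncrements.integral_exp hZ.indep (fun t => (hZ.measurable t).coe_nnreal_real.aemeasurable)
    ht fun k => -((θ k ^ 2 : ℝ) : ℂ)
  simp_rw [integral_exp_increment_subordinator hZ hΨ (ht (Fin.castSucc_lt_succ).le)
    (sq_nonneg (θ _))] at h2
  rw [← h2]
  congr 1
  ext ω
  rw [← Complex.exp_sum]
  congr 1
  refine Finset.sum_congr rfl fun k _ => ?_
  push_cast
  ring

end Subordination

/-! ### The exponents in the symmetric case -/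

section SymmetricExponents

variable {m σ2 β : ℝ} {G : Measure ℝ}

/-- The principal square root lies in the right half plane, so `√q - iβ` avoids the cuts. -/
lemma cpow_half {q : ℂ} (hq : q ∈ Complex.slitPlane) : 0 < (q ^ (1 / 2 : ℂ)).re := by
  have h0 := Complex.slitPlane_ne_zero hq
  rw [Complex.cpow_def_of_ne_zero h0, Complex.exp_re]
  refine mul_pos (Real.exp_pos _) (Real.cos_pos_of_mem_Ioo ?_)
  have h1 : (Complex.log q * (1 / 2)).im = q.arg / 2 := by
    have h2 : (1 / 2 : ℂ) = ((1 / 2 : ℝ) : ℂ) := by push_cast; rfl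
    rw [h2, Complex.im_mul_ofReal, Complex.log_im]
    ring
  have h3 := Complex.neg_pi_lt_arg q
  have h4 := (Complex.arg_le_pi q).lt_of_ne (Complex.mem_slitPlane_iff_arg.1 hq).1
  rw [h1]
  constructor <;> linarith

lemma cpow_half_sq (q : ℂ) : (q ^ (1 / 2 : ℂ)) ^ 2 = q := by
  rw [one_div]
  exact Complex.cpow_ofNat_inv_pow q 2

/-- The cumulant function of the subordinator attached to `σ²` and `G`. -/
noncomputable def cumulant (σ2 : ℝ) (G : Measure ℝ) (c : ℂ) : ℂ :=
  (σ2 / 2 : ℝ) * c + c * ∫ s : ℝ, 2 * ((s : ℂ) * (s ^ 2 - c))⁻¹ ∂G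

lemma cumulant_zero : cumulant σ2 G 0 = 0 := by simp [cumulant]

lemma cumulant_neg_sq (ξ : ℂ) :
    cumulant σ2 G (-ξ ^ 2) = -((σ2 / 2 : ℝ) * ξ ^ 2 + ξ ^ 2 * evenTransform G ξ) := by
  unfold cumulant evenTransform
  simp only [sub_neg_eq_add]
  ring

lemma IsTail.cumulant_neg (h : IsTail m G) (q : ℂ) : -cumulant σ2 G (-q) =
    (σ2 / 2 : ℝ) * q + q * stieltjesTransform (sqImage (fun s => 2 / s) G) q := by
  rw [h.stieltjesTransform_sqImage, cumulant]
  simp only [sub_neg_eq_add]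
  ring

/-- Integrability at the left end point of the support. -/
lemma integrable_of_shift {H : Measure ℝ} {b : ℝ} (hb : 0 ≤ b) (hm : 0 < m)
    (hH : Integrable (fun t => (t * (1 + t) ^ 2)⁻¹) H) (hpos : ∀ᵐ t ∂H, 0 < t)
    (hge : ∀ᵐ s ∂(H.map fun t => t - -b), m ≤ s) :
    Integrable (fun s => (s * (s ^ 2 - b ^ 2))⁻¹) (H.map fun t => t - -b) := by
  rw [integrable_map_measure (Measurable.aestronglyMeasurable (by fun_prop)) (by fun_prop)]
  have hge' : ∀ᵐ t ∂H, m ≤ t - -b := ae_of_ae_map (by fun_prop) hge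
  set K : ℝ := 1 + 1 / m
  refine (hH.const_mul (K ^ 2)).mono' (Measurable.aestronglyMeasurable (by fun_prop)) ?_
  filter_upwards [hpos, hge'] with t ht hs
  rw [sub_neg_eq_add] at hs
  have hK : 1 + t ≤ K * (t + b) := by
    have h1 : 1 ≤ 1 / m * (t + b) := by
      rw [one_div, inv_mul_eq_div, le_div_iff₀ hm]
      linarith
    have h2 : K * (t + b) = (t + b) + 1 / m * (t + b) := by ring
    linarith
  have hK0 : 0 < K := by positivity
  -- For `s = t + b` one has `s² - b² = t (t + 2b)`. The factor `t` has no positive lower bound when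
  -- the support reaches `0`; it is absorbed by the weight `t (1+t)²`.
  have h3 : (t - -b) * ((t - -b) ^ 2 - b ^ 2) = (t + b) * (t * (t + 2 * b)) := by ring
  rw [Function.comp_apply, h3, Real.norm_of_nonneg (by positivity), ← div_eq_mul_inv,
    inv_eq_one_div, div_le_div_iff₀ (by positivity) (by positivity), one_mul]
  calc t * (1 + t) ^ 2 ≤ t * (K * (t + b)) ^ 2 := by gcongr
    _ = K ^ 2 * ((t + b) * (t * (t + b))) := by ring
    _ ≤ K ^ 2 * ((t + b) * (t * (t + 2 * b))) := by gcongr; linarith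

/-- Both unshifted measures charge only `t > 0`, and `G` is a shift of each, so `s > |β|` almost
everywhere even if `|β| = m`. Integrability near `|β|` is read off from `Gm` if `β ≥ 0` and from
`Gp` if `β ≤ 0`. -/
lemma sq_lt_and_integrable_of_shift {μ₁ μ₂ : ℝ} {Gm Gp : Measure ℝ} (h : IsTail m G)
    (hm : IsSLM μ₁ Gm) (hp : IsSLM μ₂ Gp) (hGp : G = Gp.map fun t => t - β)
    (hGm : G = Gm.map fun t => t - -β) :
    (∀ᵐ s ∂G, β ^ 2 < s ^ 2) ∧ Integrable (fun s => (s * (s ^ 2 - β ^ 2))⁻¹) G := by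
  constructor
  · have h1 : ∀ᵐ s ∂G, -β < s := by
      rw [hGp]
      refine (ae_map_iff (p := fun s => -β < s) (by fun_prop) measurableSet_Ioi).2 ?_
      filter_upwards [hp.ae_pos] with t ht
      linarith [ht.1]
    have h2 : ∀ᵐ s ∂G, β < s := by
      rw [hGm]
      refine (ae_map_iff (p := fun s => β < s) (by fun_prop) measurableSet_Ioi).2 ?_
      filter_upwards [hm.ae_pos] with t ht
      linarith [ht.1]
    filter_upwards [h1, h2] with s h1 h2
    exact sq_lt_sq' (by linarith) h2
  · rcases le_total 0 β with hβ | hβ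
    · have := h.ae_ge
      rw [hGm] at this ⊢
      exact integrable_of_shift hβ h.pos hm.integrable (hm.ae_pos.mono fun _ => And.left) this
    · have := h.ae_ge
      rw [hGp] at this ⊢
      have h3 := integrable_of_shift (b := -β) (by linarith) h.pos hp.integrable
        (hp.ae_pos.mono fun _ => And.left) (by simpa only [neg_neg] using this)
      simpa only [neg_neg, neg_sq] using h3

/-- The Stieltjes inversion formula. -/
theorem IsTail.tendsto_inversion (h : IsTail m G) {F : ℝ → ℝ → ℝ}
    (hF : ∀ ε y : ℝ, 0 < ε → F ε y = σ2 * ε * y + ∫ s, poissonDiff ε s y ∂G) {u v : ℝ}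
    (hu : 0 < u) (huv : u < v) (hGu : G {√u} = 0) (hGv : G {√v} = 0) :
    Tendsto (fun ε : ℝ => (1 / Real.pi) * ∫ q in Ioc u v, F ε √q / q) (𝓝[>] 0)
      (𝓝 ((sqImage (fun s => 2 / s) G).real (Ioc u v))) := by
  have ha : 0 < √u := Real.sqrt_pos.2 hu
  have hab : √u < √v := Real.sqrt_lt_sqrt hu.le huv
  -- After `q = y²`, the Gaussian term `σ² ε y` integrates to a multiple of `ε` and disappears in
  -- the limit.
  have h1 : ∀ᶠ ε : ℝ in 𝓝[>] 0, 2 * σ2 * (√v - √u) * ε +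
      ∫ y in Ioc √u √v, (∫ s, 2 / y * poissonDiff ε s y ∂G) = ∫ q in Ioc u v, F ε √q / q := by
    filter_upwards [self_mem_nhdsWithin] with ε hε
    have hε : 0 < ε := hε
    have h2 : ∫ _ in Ioc √u √v, 2 * σ2 * ε = 2 * σ2 * (√v - √u) * ε := by
      rw [setIntegral_const, Real.volume_real_Ioc_of_le hab.le, smul_eq_mul]
      ring
    rw [setIntegral_comp_sqrt_div hu.le, ← h2, ← integral_add (integrable_const _)
      (h.integral_poissonDiff_swap hε ha hab).1]
    refine setIntegral_congr_fun measurableSet_Ioc fun y hy => ?_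
    have hy0 : y ≠ 0 := (ha.trans hy.1).ne'
    rw [hF ε y hε, integral_const_mul, mul_add]
    congr 1
    field_simp
  have h3 : Tendsto (fun ε : ℝ => 2 * σ2 * (√v - √u) * ε) (𝓝[>] 0) (𝓝 0) := by
    have : ContinuousAt (fun ε : ℝ => 2 * σ2 * (√v - √u) * ε) 0 := by fun_prop
    have := this.tendsto
    rw [mul_zero] at this
    exact this.mono_left nhdsWithin_le_nhds
  have h4 := (h3.add (h.tendsto_integral_poissonDiff ha hab hGu hGv)).const_mul (1 / Real.pi)
  rw [zero_add, one_div, inv_mul_cancel_left₀ Real.pi_ne_zero,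
    ← (h.measureReal_sqImage hu.le).2] at h4
  rw [one_div]
  refine h4.congr' ?_
  filter_upwards [h1] with ε hε
  rw [hε]

lemma im_add_evenTransform {C ε y : ℝ} (h : IsTail m G) (hε : 0 < ε)
    (hi : Integrable (fun s : ℝ => 2 * ((s : ℂ) * (s ^ 2 + (Complex.I * y + ε) ^ 2))⁻¹) G) :
    (C + (σ2 / 2 : ℝ) * (Complex.I * y + ε) ^ 2 +
      (Complex.I * y + ε) ^ 2 * evenTransform G (Complex.I * y + ε)).im =
      σ2 * ε * y + ∫ s, poissonDiff ε s y ∂G := by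
  have h1 : ((Complex.I * y + ε) ^ 2 * evenTransform G (Complex.I * y + ε)).im =
      ∫ s, poissonDiff ε s y ∂G := by
    rw [evenTransform, ← integral_const_mul]
    have h2 := integral_im (hi.const_mul ((Complex.I * y + ε) ^ 2))
    refine (h2.symm).trans (integral_congr_ae ?_)
    filter_upwards [h.ae_ge] with s hs
    exact im_kernel_eq hε (h.pos.trans_le hs)
  rw [Complex.add_im, h1, Complex.add_im, Complex.ofReal_im, Complex.im_ofReal_mul]
  congr 1
  simp [sq]
  ring

end SymmetricExponents

/-! ### Mixture laws of the tilted process and of subordinated Brownian motion -/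

section Subordinate

variable {Ω : Type*} [MeasurableSpace Ω] {P : Measure Ω} [IsProbabilityMeasure P]
  {Ω' : Type*} [MeasurableSpace Ω'] {P' : Measure Ω'} [IsProbabilityMeasure P']
  {Z : ℝ≥0 → Ω' → ℝ≥0} {m σ2 β : ℝ} {G : Measure ℝ}

lemma charFun_mixtureLaw (hZm : ∀ t, Measurable (Z t)) (hexp : ∀ c : ℂ, c.re ≤ β ^ 2 →
      ∀ t : ℝ≥0, Integrable (fun ω => Complex.exp (c * (Z t ω : ℝ))) P' ∧
        ∫ ω, Complex.exp (c * (Z t ω : ℝ)) ∂P' = Complex.exp (t * cumulant σ2 G c))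
    (t : ℝ≥0) (θ : ℝ) :
    charFun (mixtureLaw P' (Z t)) θ = Complex.exp (t * cumulant σ2 G (-(θ : ℂ) ^ 2)) := by
  have hre : (Complex.I * (θ : ℂ)).re = 0 := by simp
  have h1 := integral_exp_mixtureLaw (hZm t) (c := Complex.I * θ)
    (hexp _ (by rw [Complex.ofReal_re, hre]; simpa using sq_nonneg β) t).1
  have hsq : (Complex.I * (θ : ℂ)) ^ 2 = -(θ : ℂ) ^ 2 := by
    rw [mul_pow, Complex.I_sq]
    ring
  rw [hsq, (hexp _ (by
    rw [← Complex.ofReal_pow, ← Complex.ofReal_neg, Complex.ofReal_re]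
    linarith [sq_nonneg β, sq_nonneg θ]) t).2] at h1
  rw [charFun_apply, ← h1.2]
  refine integral_congr_ae (ae_of_all _ fun y => ?_)
  simp only [RCLike.inner_apply, conj_trivial]
  push_cast
  ring_nf

/-- The tilted mixture has, up to normalisation, the characteristic function `E exp((iξ - β)² Z_t)`,
and `Re (iξ - β)² = β² - ξ²` stays within the available exponential moments. The point `ξ = 0` is
left out because it may lie on a cut. -/
lemma map_eq_tilted_mixtureLaw {X : ℝ≥0 → Ω → ℝ} (hX : ∀ t, Measurable (X t)) {κ : ℝ → ℂ}
    (hκ : HasCharExponent X P κ) (hZm : ∀ t, Measurable (Z t)) (hexp : ∀ c : ℂ, c.re ≤ β ^ 2 →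
      ∀ t : ℝ≥0, Integrable (fun ω => Complex.exp (c * (Z t ω : ℝ))) P' ∧
        ∫ ω, Complex.exp (c * (Z t ω : ℝ)) ∂P' = Complex.exp (t * cumulant σ2 G c)) {C : ℂ}
    (hC : ∀ ξ : ℝ, ξ ≠ 0 → κ ξ = C - cumulant σ2 G ((Complex.I * ξ - β) ^ 2)) (t : ℝ≥0) :
    Integrable (fun y => Real.exp (-β * y)) (mixtureLaw P' (Z t)) ∧
      P.map (X t) = (mixtureLaw P' (Z t)).tilted fun y => -β * y := by
  have := isProbabilityMeasure_mixtureLaw (P := P') (hZm t)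
  have := Measure.isProbabilityMeasure_map (μ := P) (hX t).aemeasurable
  have hi : Integrable (fun y => Real.exp (-β * y)) (mixtureLaw P' (Z t)) := by
    rw [integrable_exp_real_iff]
    refine (integral_exp_mixtureLaw (hZm t) (hexp _ ?_ t).1).1
    rw [Complex.ofReal_re, Complex.ofReal_re, neg_sq]
  refine ⟨hi, eq_tilted_of_charFun_eq (C := Complex.exp (-(t * C))) hi fun ξ hξ => ?_⟩
  have hre : (Complex.I * (ξ : ℂ) + ((-β : ℝ) : ℂ)).re = -β := by simp
  have h1 := (integral_exp_mixtureLaw (hZm t) (c := Complex.I * ξ + ((-β : ℝ) : ℂ))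
    (hexp _ (by rw [Complex.ofReal_re, hre, neg_sq]) t).1).2
  have hsq : Complex.I * (ξ : ℂ) + ((-β : ℝ) : ℂ) = Complex.I * ξ - β := by push_cast; ring
  rw [h1, hsq, (hexp _ (by
    have h2 : ((Complex.I * (ξ : ℂ) - β) ^ 2).re = β ^ 2 - ξ ^ 2 := by
      simp [sq]
    rw [h2]
    linarith [sq_nonneg ξ]) t).2, ← Complex.exp_add]
  have h3 : charFun (P.map (X t)) ξ = Complex.exp (-((t : ℝ) * κ ξ)) := by
    rw [← hκ t ξ, charFun_apply, integral_map (hX t).aemeasurable (by fun_prop)]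
    refine integral_congr_ae (ae_of_all _ fun ω => ?_)
    simp only [RCLike.inner_apply, conj_trivial]
    push_cast
    ring_nf
  rw [h3, hC ξ hξ]
  congr 1
  ring

lemma map_increments_subordinated {W : ℝ≥0 → Ω' → ℝ} {Ψ : ℂ → ℂ} {μ : ℝ≥0 → Measure ℝ}
    [∀ t, IsProbabilityMeasure (μ t)] (hZ : IsSubordinator Z P') (hΨ : HasLaplaceExponent Z P' Ψ)
    (hW : IsBrownianReal W P') (hind : IndepFun (fun ω t => Z t ω) (fun ω t => W t ω) P')
    (hμ : ∀ (t : ℝ≥0) (θ : ℝ), charFun (μ t) θ = Complex.exp (-(t * Ψ ((θ ^ 2 : ℝ)))))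
    {n : ℕ} {τ : ℕ → ℝ≥0} (hτ : Monotone τ) :
    P'.map (fun ω (k : Fin n) => √2 * W (Z (τ (k + 1)) ω) ω - √2 * W (Z (τ k) ω) ω) =
      Measure.pi fun k : Fin n => μ (τ (k + 1) - τ k) := by
  have hm (t : ℝ≥0) : AEMeasurable (fun ω => √2 * W (Z t ω) ω) P' :=
    (aemeasurable_subordinated hZ hW t).const_mul _
  refine map_eq_pi_of_integral_exp (fun k => (hm _).sub (hm _)) _ fun θ => ?_
  have h1 := integral_exp_subordinated hZ hW hind hΨ (t := fun k : Fin (n + 1) => τ k)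
    (fun a b hab => hτ hab) θ
  simp only [Fin.val_succ, Fin.val_castSucc] at h1
  simp_rw [hμ]
  rw [← h1]
  refine integral_congr_ae (ae_of_all _ fun ω => ?_)
  simp only [Pi.sub_apply]
  congr 1
  refine Finset.sum_congr rfl fun k _ => ?_
  push_cast
  ring

end Subordinate

end StieltjesLevy

/-! ### The main theorem -/

theorem mainTheorem5 {Ω : Type*} [MeasurableSpace Ω] (P : Measure Ω) [IsProbabilityMeasure P]
    (X : ℝ≥0 → Ω → ℝ) (μm μp : ℝ) (hμm : μm ≤ 0) (hμp : 0 ≤ μp) (hμ : μm < μp)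
    (σ2 b : ℝ) (Gm Gp : Measure ℝ)
    -- `X` is a Stieltjes-Lévy process of class `SL_{μ₋, μ₊}`
    (hX : StieltjesLevy.IsSLProcess μm μp σ2 b Gm Gp X P)
    (β : ℝ) (hβ : β = -(μm + μp) / 2)
    -- the characteristic exponents of `X` and of its pure jump component
    (ψ ψJ : ℂ → ℂ)
    (hψ : ψ = StieltjesLevy.charExponent μm μp σ2 b (StieltjesLevy.slLevyMeasure Gm Gp))
    (hψJ : ψJ = StieltjesLevy.charExponent μm μp 0 0 (StieltjesLevy.slLevyMeasure Gm Gp))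
    -- the symmetry condition
    (hsym : ∀ ξ : ℂ, ξ - Complex.I * β ∈ StieltjesLevy.cutPlane μm μp →
      ψ (ξ - Complex.I * β) = ψ (-ξ - Complex.I * β))
    -- the decay condition: integrals with respect to the arc length on the circles `|ξ| = A`
    (hdecay : Tendsto (fun A : ℝ => ∫⁻ φ in Ioc (-Real.pi) Real.pi \ {Real.pi / 2, -(Real.pi / 2)},
        ENNReal.ofReal (‖ψJ (A * Complex.exp (Complex.I * φ))‖ / A ^ 3 * A)) atTop (𝓝 0))
    (Ψ : ℂ → ℂ)
    (hΨ : Ψ = fun q => ψ (q ^ (1 / 2 : ℂ) - Complex.I * β) - ψ (-(Complex.I * β))) :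
    -- the Esscher transform is well defined, and under it `X` has the (even) characteristic
    -- exponent `ψ(ξ - iβ) - ψ(-iβ)`
    (∀ T : ℝ≥0, IsProbabilityMeasure (StieltjesLevy.esscher P X β T) ∧
      ∀ t ≤ T, ∀ ξ : ℝ,
        ∫ ω, Complex.exp (Complex.I * ξ * X t ω) ∂(StieltjesLevy.esscher P X β T) =
          Complex.exp (-((t : ℝ) * (ψ (ξ - Complex.I * β) - ψ (-(Complex.I * β)))))) ∧
    -- (a), (b)
    (∃ (Ω' : Type) (_ : MeasurableSpace Ω') (P' : Measure Ω') (Z : ℝ≥0 → Ω' → ℝ≥0),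
      IsProbabilityMeasure P' ∧
      StieltjesLevy.IsSubordinator Z P' ∧
      StieltjesLevy.HasLaplaceExponent Z P' Ψ ∧
      StieltjesLevy.IsSLPlus ((μp - μm) ^ 2 / 4) (fun t ω => (Z t ω : ℝ)) P') ∧
    -- (c)
    (∃ G₀ : Measure ℝ, StieltjesLevy.IsStieltjesMeasureOf Ψ G₀ ∧
      ∀ u v : ℝ, β ^ 2 < u → u < v →
        ContinuousAt (fun t : ℝ => Gm (Iic t)) (√u - β) →
        ContinuousAt (fun t : ℝ => Gm (Iic t)) (√v - β) →
        G₀ (Ioc u v) < ∞ ∧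
        Tendsto (fun ε : ℝ => (1 / Real.pi) *
            ∫ q in Ioc u v, (ψ (Complex.I * ((√q - β : ℝ) : ℂ) + ε)).im / q)
          (𝓝[>] 0) (𝓝 (G₀.real (Ioc u v)))) ∧
    -- (d)
    (∀ (Ω' : Type*) [MeasurableSpace Ω'] (P' : Measure Ω') [IsProbabilityMeasure P']
      (Z : ℝ≥0 → Ω' → ℝ≥0) (W : ℝ≥0 → Ω' → ℝ),
      StieltjesLevy.IsSubordinator Z P' → StieltjesLevy.HasLaplaceExponent Z P' Ψ →
      IsBrownianReal W P' →
      IndepFun (fun ω t => Z t ω) (fun ω t => W t ω) P' →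
      ∀ (T : ℝ≥0) (I : Finset ℝ≥0), (∀ t ∈ I, t ≤ T) →
        IdentDistrib (fun ω => I.restrict fun t => X t ω)
          (fun ω => I.restrict fun t => √2 * W (Z t ω) ω)
          (StieltjesLevy.esscher P X β T) P') := by
  obtain ⟨C, htail, hG, hξ, hreal⟩ := StieltjesLevy.exists_charExponent_eq_of_symm (σ2 := σ2)
    (b := b) hμ hβ hX.slm_neg hX.slm_pos (by rw [← hψ]; exact hsym)
  rw [← hψ] at hξ hreal
  set G := Gp.map fun t => t - β with hGdef
  obtain ⟨hlt, hint⟩ := StieltjesLevy.sq_lt_and_integrable_of_shift htail hX.slm_neg hX.slm_pos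
    hGdef hG
  -- The point `-iβ` is the midpoint of the gap, so it lies in the domain even if `0` does not.
  have hD0 : (0 : ℂ) - Complex.I * β ∈ StieltjesLevy.cutPlane μm μp := by
    right
    constructor <;> simp <;> linarith
  have hDre {ξ : ℂ} (h : ξ.re ≠ 0) : ξ - Complex.I * β ∈ StieltjesLevy.cutPlane μm μp :=
    Or.inl (by simpa using h)
  have hψ0 : ψ (-(Complex.I * β)) = C := by
    have := (hξ 0 hD0).2
    rw [zero_sub] at this
    rw [this]
    ring
  have hψξ {ξ : ℂ} (h : ξ - Complex.I * β ∈ StieltjesLevy.cutPlane μm μp) :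
      ψ (ξ - Complex.I * β) = C - StieltjesLevy.cumulant σ2 G (-ξ ^ 2) := by
    rw [(hξ ξ h).2, StieltjesLevy.cumulant_neg_sq]
    ring
  have hψreal (ξ : ℝ) :
      ψ (ξ - Complex.I * β) = C - StieltjesLevy.cumulant σ2 G (-(ξ : ℂ) ^ 2) := by
    by_cases h : ξ = 0
    · rw [h, Complex.ofReal_zero]
      exact hψξ hD0
    · exact hψξ (hDre (by simpa using h))
  have hΨslit {q : ℂ} (hq : q ∈ Complex.slitPlane) :
      Ψ q = -StieltjesLevy.cumulant σ2 G (-q) := by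
    rw [hΨ]
    simp only
    rw [hψξ (hDre (StieltjesLevy.cpow_half hq).ne'), StieltjesLevy.cpow_half_sq, hψ0]
    ring
  have hΨreal {q : ℝ} (hq : 0 ≤ q) : Ψ q = -StieltjesLevy.cumulant σ2 G (-(q : ℂ)) := by
    rcases hq.eq_or_lt with h | h
    · rw [← h, hΨ, Complex.ofReal_zero, neg_zero, StieltjesLevy.cumulant_zero]
      simp only
      rw [Complex.zero_cpow (by norm_num), zero_sub, sub_self, neg_zero]
    · exact hΨslit (Or.inl (by simpa using h))
  -- This subordinator is the witness for (a) and (b); its mixture laws are also the reference laws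
  -- for the Esscher transform and for (d).
  obtain ⟨Ω₁, mΩ₁, P₁, Z₁, hP₁, hZm, hZ, hZp, hexp⟩ := htail.exists_subordinator hX.gauss hlt hint
  have hexp' : ∀ c : ℂ, c.re ≤ β ^ 2 →
      ∀ t : ℝ≥0, Integrable (fun ω => Complex.exp (c * (Z₁ t ω : ℝ))) P₁ ∧
        ∫ ω, Complex.exp (c * (Z₁ t ω : ℝ)) ∂P₁ =
          Complex.exp (t * StieltjesLevy.cumulant σ2 G c) := hexp
  have hprob (t : ℝ≥0) := StieltjesLevy.isProbabilityMeasure_mixtureLaw (P := P₁) (hZm t)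
  have hchar := StieltjesLevy.charFun_mixtureLaw hZm hexp'
  have hlaw := StieltjesLevy.map_eq_tilted_mixtureLaw (P := P) (C := C) hX.levy.measurable
    hX.exponent hZm hexp' fun ξ h => by
      have h1 : ((ξ : ℂ) + Complex.I * β) - Complex.I * β = ξ := by ring
      have h2 : ((ξ : ℂ) + Complex.I * β).re ≠ 0 := by simpa using h
      have h3 := hψξ (hDre h2)
      rw [h1] at h3
      have h4 : (ξ : ℂ) ∈ StieltjesLevy.cutPlane μm μp := Or.inl (by simpa using h)
      rw [← hreal ξ h4, h3]
      congr 2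
      linear_combination (-(ξ : ℂ) ^ 2 - β ^ 2) * Complex.I_sq
  have hlaw₁ (t : ℝ≥0) := (hlaw t).1
  have hlaw₂ (t : ℝ≥0) := (hlaw t).2
  refine ⟨fun T => ⟨StieltjesLevy.isProbabilityMeasure_esscher hX.levy hlaw₁ hlaw₂ T,
    fun t ht ξ => ?_⟩, ⟨Ω₁, mΩ₁, P₁, Z₁, hP₁, hZ, fun t q hq => ?_, ?_⟩,
    ⟨StieltjesLevy.sqImage (fun s => 2 / s) G, ⟨htail.isSM, 0, σ2 / 2, le_rfl, ?_, fun q hq => ?_⟩,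
      fun u v hu huv hcu hcv => ?_⟩, ?_⟩
  · rw [StieltjesLevy.integral_exp_esscher hX.levy hlaw₁ hlaw₂ ht, hchar, hψreal, hψ0]
    congr 1
    ring
  · have h1 := (hexp' (-(q : ℂ)) (by
      rw [← Complex.ofReal_neg, Complex.ofReal_re]
      linarith [sq_nonneg β]) t).2
    rw [hΨreal hq, mul_neg, neg_neg, ← h1, ← integral_complex_ofReal]
    refine integral_congr_ae (ae_of_all _ fun ω => ?_)
    push_cast
    ring_nf
  · have h1 : (μp - μm) ^ 2 / 4 = ((μp - μm) / 2) ^ 2 := by ring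
    rw [h1]
    exact hZp
  · have := hX.gauss
    positivity
  · rw [hΨslit hq, htail.cumulant_neg]
    push_cast
    ring
  · have hu0 : 0 < u := (sq_nonneg β).trans_lt hu
    refine ⟨(htail.measureReal_sqImage hu0.le).1, ?_⟩
    -- The measure `G` is `Gm` translated by `β`, so an atom of `G` at `√u` would be an atom of `Gm`
    -- at `√u - β`.
    have hatom {x : ℝ} (hc : ContinuousAt (fun t : ℝ => Gm (Iic t)) (x - β)) : G {x} = 0 := by
      have h1 := StieltjesLevy.measure_singleton_eq_zero_of_continuousAt
        (hX.slm_neg.measure_Iic_lt_top _).ne hc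
      rw [hG, Measure.map_apply (by fun_prop) (measurableSet_singleton x)]
      have h2 : (fun t : ℝ => t - -β) ⁻¹' {x} = {x - β} := by
        ext t
        simp only [mem_preimage, mem_singleton_iff]
        constructor <;> intro h <;> linarith
      rw [h2, h1]
    refine htail.tendsto_inversion (σ2 := σ2)
      (F := fun ε y => (ψ (Complex.I * ((y - β : ℝ) : ℂ) + ε)).im) (fun ε y hε => ?_) hu0 huv
      (hatom hcu) (hatom hcv)
    have h1 : Complex.I * ((y - β : ℝ) : ℂ) + ε = (Complex.I * y + ε) - Complex.I * β := by
      push_cast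
      ring
    have h2 := hξ (Complex.I * y + ε) (hDre (by simpa using hε.ne'))
    rw [h1, h2.2]
    exact StieltjesLevy.im_add_evenTransform htail hε h2.1
  -- The given `Z` lives on another space than `Z₁`, but only laws are compared: the increments of
  -- both processes have the mixture laws of `Z₁`.
  · intro Ω' _ P' _ Z W hZ' hΨ' hW hind T I hI
    have hpe := StieltjesLevy.isProbabilityMeasure_esscher hX.levy hlaw₁ hlaw₂ T
    have hac : StieltjesLevy.esscher P X β T ≪ P := tilted_absolutelyContinuous P _
    refine StieltjesLevy.identDistrib_restrict (Y := fun t ω => √2 * W (Z t ω) ω)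
      (fun t => (hX.levy.measurable t).aemeasurable)
      (fun t => (StieltjesLevy.aemeasurable_subordinated hZ' hW t).const_mul _)
      (hac.ae_le hX.levy.zero) ?_ (fun n τ hτ h0 hT => ?_) hI
    · filter_upwards [StieltjesLevy.IsLevyProcess.zero hZ', hW.eval_zero_ae_eq_zero] with ω h1 h2
      have h3 : Z 0 ω = 0 := by exact_mod_cast h1
      rw [h3, h2, mul_zero]
    · rw [← hT, StieltjesLevy.map_increments_esscher hX.levy hlaw₁ hlaw₂ hτ h0]
      refine (StieltjesLevy.map_increments_subordinated
        (μ := fun t => StieltjesLevy.mixtureLaw P₁ (Z₁ t)) hZ' hΨ' hW hind (fun t θ => ?_) hτ).symm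
      rw [hchar, hΨreal (sq_nonneg θ)]
      push_cast
      ring_nf
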